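/- **Notation.** For $\operatorname{Im}\tau>0$ and $z\in\mathbb C$ write $q=e^{2\pi i\tau}$, $\zeta=e^{2\pi iz}$, $z_2=\operatorname{Im}z$, $\tau_2=\operatorname{Im}\tau$, $(a;q)_\infty=\prod_{n\ge0}(1-aq^n)$, and let $$\vartheta(z;\tau)=i\sum_{m\in\mathbb Z+\frac12}(-1)^{m-\frac12}q^{\frac{m^2}{2}}\zeta^m,\qquad \psi(z;\tau)=i\sum_{m\in\mathbb Z+\frac12}\operatorname{sgn}\!\Big(m+\frac{z_2}{\tau_2}\Big)(-1)^{m-\frac12}q^{\frac{m^2}{2}}\zeta^m,$$ $$\eta(\tau)=q^{\frac1{24}}(q;q)_\infty,\qquad \mathcal C^*(z;\tau)=q^{-\frac1{24}}\frac{(q;q)_\infty}{(\zeta q;q)_\infty(\zeta^{-1}q;q)_\infty},\qquad \mathcal U_1(z;\tau)=-\frac{i\,\mathcal C^*(z;\tau)}{2\eta(\tau)}\big(\vartheta(2z;\tau)+\psi(2z;\tau)\big).$$ For $0\le h<k$ with $\gcd(h,k)=1$ let $0\le[-h]_k<k$ be defined by $-h[-h]_k\equiv1\pmod k$, and for $\left(\begin{smallmatrix}a&b\\c&d\end{smallmatrix}\right)\in\mathrm{SL}_2(\mathbb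 Z)$ let $\chi$ be the multiplier of $\eta$, $$\chi\begin{pmatrix}a&b\\c&d\end{pmatrix}=\begin{cases}\left(\frac{d}{|c|}\right)e^{\frac{\pi i}{12}\left((a+d)c-bd(c^2-1)-3c\right)}&\text{if }c\text{ is odd},\\ \left(\frac cd\right)e^{\frac{\pi i}{12}\left(ac(1-d^2)+d(b-c+3)-3\right)}&\text{if }c\text{ is even},\end{cases}$$ with the Kronecker symbol $\left(\frac{\cdot}{\cdot}\right)$. With $B_n(x)$ the Bernoulli polynomials, let $$\kappa(a,b,c)=\frac{(2(a+b+c))!\,(-1)^{a+c}B_{2c}(\frac12)}{a!\,(2b+1)!\,(2c)!\,\pi^a4^{a+b}},\qquad C_j(w)=\Big(\frac1{2\pi i}\frac{\partial}{\partial w}\Big)^{j}\cot(\pi w).$$ Complex powers are principal values. **Theorem.** Let $\ell\ge0$ be an even integer and let $c_0>0$. There is a constant $A>0$, depending only on $\ell$ and $c_0$, such that for all integers $0\le h<k$ with $\gcd(h,k)=1$ and all $Z\in\mathbb C\setminus\{0\}$ with $\operatorname{Re}(\frac1Z)\ge\frac k2$ and $|Z|\le\frac{c_0}{k}$ the following holds: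 the function $z\mapsto\mathcal U_1(z;\frac hk+\frac{iZ}k)$ is holomorphic near $z=0$, and $$\left[\frac{\partial^\ell}{\partial z^\ell}\,\mathcal U_1\Big(z;\frac hk+\frac{iZ}k\Big)\right]_{z=0}=\frac{(2\pi i)^\ell i^{\frac32}}{4\sqrt6\,k}\,\chi\begin{pmatrix}[-h]_k&-\frac{h[-h]_k+1}{k}\\k&-h\end{pmatrix}^{-1}\sum_{\nu=0}^{2k-1}(-1)^\nu e^{\frac{\pi i[-h]_k}{12k}(12\nu(\nu+1)+1)}$$ $$\times\sum_{j=0}^{\ell/2}\binom{\ell}{2j}\sum_{\substack{a,b,c\ge0\\a+b+c=j}}k^a\kappa(a,b,c)Z^{\frac12-a-2c}\int_{-1}^1C_{\ell-2j}\Big(\frac1{2k}\Big(\frac{x}{\sqrt6}-\nu-\frac12\Big)\Big)e^{\frac{\pi}{6kZ}(1-x^2)}\,dx+E,$$ where $|E|\le A\,\log(k+1)\,|Z|^{\frac12-\ell}$. -/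

import Mathlib

open Complex

namespace UnimodalRank

noncomputable section

/-! ### Multipliers -/

/-- The Kronecker symbol `(a / n)` for arbitrary integers `a`, `n`: it is `1` or `0` for `n = 0`
according to whether `a = ±1` or not, and otherwise it is the product of `(a / sgn n)`, of a power
of `(a / 2)` (the character `χ₈`), and of the Jacobi symbol of `a` over the odd part of `|n|`. -/
def kroneckerSymbol (a n : ℤ) : ℤ :=
  if n = 0 then (if a.natAbs = 1 then 1 else 0)
  else (if n < 0 ∧ a < 0 then -1 else 1)
    * ZMod.χ₈ (a : ZMod 8) ^ padicValNat 2 n.natAbs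
    * jacobiSym a (n.natAbs / 2 ^ padicValNat 2 n.natAbs)

/-- The multiplier `χ` of the Dedekind eta function at the matrix with rows `(a, b)` and
`(c, d)`. -/
def etaMultiplier (a b c d : ℤ) : ℂ :=
  if Odd c then
    (kroneckerSymbol d |c| : ℂ) *
      exp (Real.pi * I / 12 * ((a + d) * c - b * d * (c ^ 2 - 1) - 3 * c))
  else
    (kroneckerSymbol c d : ℂ) *
      exp (Real.pi * I / 12 * (a * c * (1 - d ^ 2) + d * (b - c + 3) - 3))

/-- `[-h]_k`, the integer in `{0, …, k - 1}` with `-h [-h]_k ≡ 1 (mod k)`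
(for `k ≥ 1` and `gcd(h, k) = 1`). -/
def negInv (h k : ℕ) : ℕ := ((-(h : ZMod k))⁻¹).val

theorem negInv_lt (h : ℕ) {k : ℕ} (hk : 0 < k) : negInv h k < k := by
  have : NeZero k := ⟨hk.ne'⟩
  exact ZMod.val_lt _

theorem negInv_spec {h k : ℕ} (hk : 0 < k) (hc : h.Coprime k) :
    -(h : ℤ) * (negInv h k : ℤ) ≡ 1 [ZMOD k] := by
  have : NeZero k := ⟨hk.ne'⟩
  rw [← ZMod.intCast_eq_intCast_iff]
  have hu : IsUnit (-(h : ZMod k)) := ((ZMod.isUnit_iff_coprime h k).2 hc).neg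
  have hv : ((negInv h k : ℕ) : ZMod k) = (-(h : ZMod k))⁻¹ := ZMod.natCast_zmod_val _
  push_cast
  rw [hv]
  exact ZMod.mul_inv_of_unit _ hu

/-- The multiplier `χ` at the matrix with rows `([-h]_k, -(h [-h]_k + 1) / k)` and `(k, -h)`.
The division by `k` is exact. -/
def chiHK (h k : ℕ) : ℂ :=
  etaMultiplier (negInv h k) (-(((h : ℤ) * negInv h k + 1) / k)) k (-h)

/-! ### Theta functions and the generating function -/

/-- The Jacobi theta function `i ∑_{m ∈ ℤ + 1/2} (-1)^{m - 1/2} q^{m² / 2} ζ^m`, with `m = n + 1/2`. -/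
def jacobiVartheta (z τ : ℂ) : ℂ :=
  I * ∑' n : ℤ, (-1 : ℂ) ^ n *
    exp (Real.pi * I * ((n : ℂ) + 1 / 2) ^ 2 * τ + 2 * Real.pi * I * ((n : ℂ) + 1 / 2) * z)

/-- The false theta function
`ψ(z; τ) = i ∑_{m ∈ ℤ + 1/2} sgn(m + Im z / Im τ) (-1)^{m - 1/2} q^{m² / 2} ζ^m`,
with `m = n + 1/2`. -/
def falseTheta (z τ : ℂ) : ℂ :=
  I * ∑' n : ℤ, (Real.sign ((n : ℝ) + 1 / 2 + z.im / τ.im) : ℂ) * (-1 : ℂ) ^ n *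
    exp (Real.pi * I * ((n : ℂ) + 1 / 2) ^ 2 * τ + 2 * Real.pi * I * ((n : ℂ) + 1 / 2) * z)

/-- The infinite `q`-Pochhammer symbol `(a; q)_∞`. -/
def qPochhammerInf (a q : ℂ) : ℂ := ∏' n : ℕ, (1 - a * q ^ n)

/-- The crank generating function `C(ζ; q)`. -/
def crankGen (ζ q : ℂ) : ℂ :=
  qPochhammerInf q q / (qPochhammerInf (ζ * q) q * qPochhammerInf (ζ⁻¹ * q) q)

/-- `𝒞*(z; τ) = q^{-1/24} C(ζ; q)`. -/
def crankStar (z τ : ℂ) : ℂ :=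
  exp (-(2 * Real.pi * I * τ / 24)) *
    crankGen (exp (2 * Real.pi * I * z)) (exp (2 * Real.pi * I * τ))

/-- `𝒰₁(z; τ)`; here `ModularForm.eta` is the Dedekind eta function. -/
def calU1 (z τ : ℂ) : ℂ :=
  -(I * crankStar z τ / (2 * ModularForm.eta τ)) *
    (jacobiVartheta (2 * z) τ + falseTheta (2 * z) τ)

/-! ### The ingredients of the main term -/

/-- The numbers `κ(a, b, c)`. -/
def kappa (a b c : ℕ) : ℝ :=
  (Nat.factorial (2 * (a + b + c)) : ℝ) * (-1) ^ (a + c) *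
      (((Polynomial.bernoulli (2 * c)).eval (1 / 2 : ℚ) : ℚ) : ℝ) /
    ((Nat.factorial a : ℝ) * (Nat.factorial (2 * b + 1) : ℝ) * (Nat.factorial (2 * c) : ℝ) *
      Real.pi ^ a * 4 ^ (a + b))

/-- `C_j(w) = ((1 / (2πi)) ∂/∂w)^j cot(πw)`. -/
def cotDeriv (j : ℕ) (w : ℂ) : ℂ :=
  (1 / (2 * Real.pi * I)) ^ j * iteratedDeriv j (fun u : ℂ => Complex.cot (Real.pi * u)) w

end

end UnimodalRank

open UnimodalRank

section

open scoped NumberTheorySymbols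

namespace UnimodalRank

/-! ### Arithmetic of the eta multiplier -/

/-! Near z = 0 the sign in ψ(2z) is sgn(m), so ϑ(2z) + ψ(2z) is twice the half of the theta series
over positive indices, and 𝒰₁ is the product of `crankQuot` and `halfTheta` (`calU1_eq`). The first
factor is even in z, so Leibniz' rule leaves its derivatives of order 2j times the moments
`partialThetaMoment` of order ℓ - 2j. The two factors need different treatments.

The crank factor is modular. By the Jacobi triple product it is a quotient built from sin, η and ϑ,
and η, ϑ transform with χ, χ³ (`modularTransform_etaMultiplier`, an induction along the Euclidean
algorithm). Hence at h/k + iZ/k it is an elementary factor, whose Taylor coefficients produce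
κ(a,b,c), times the inverse of an infinite product that differs from 1 by O(exp(-2π Re(1/(kZ))))
(`exists_iteratedDeriv_crankQuot_cusp`).

The half theta series is not modular. Each Gaussian exp(-π(n+1/2)²Z/k) is instead written as an
integral over a line Im v = -ε, and the sum over n is taken inside. The phases exp(πih(n+1/2)²/k)
are Gauss sums over ν mod 2k (`sum_cuspPhase_exp`), so the inner sum is a combination of 2k
translated derivatives of the cotangent (`integral_cuspKernel`). The Gauss sums are not evaluated
arithmetically: the law of ϑ at Z = 1 and Poisson summation give two Fourier expansions of the same
function.

With exp(π/(6kZ)) from the crank factor, the weight becomes exp(πB(1/6 - v²)), B = 1/(kZ), which is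
large only for |v| < 1/√6; this segment is the main term. Elsewhere the line is moved, interval by
interval, to the side on which the imaginary part of B does no harm. When a pole has to be crossed,
a square of half-side 1/(40‖B‖) around it is left behind and costs O(‖B‖^m)
(`HalfIntegerPoles.norm_integral_line_sub_le`). The kernel is O(k^(m+1) log(k+1)) at fixed distance
from its poles, the logarithm being a harmonic sum over the 2k translates. With the prefactor of
size |Z|^(1/2)/k and the crank derivative of size |Z|^(-2j), all powers of k cancel and |Z|^(1/2-ℓ)
log(k+1) remains. -/

/-- The `24`-th root of unity `exp (π i n / 12)`. -/
noncomputable def root24 (n : ℤ) : ℂ := exp (Real.pi * I / 12 * n)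

theorem root24_add (m n : ℤ) : root24 (m + n) = root24 m * root24 n := by
  simp only [root24, ← Complex.exp_add]
  congr 1
  push_cast
  ring

theorem root24_mul (n : ℤ) : root24 (24 * n) = 1 := by
  rw [root24, Complex.exp_eq_one_iff]
  exact ⟨n, by push_cast; ring⟩

theorem root24_congr {m n : ℤ} (h : (24 : ℤ) ∣ m - n) : root24 m = root24 n := by
  obtain ⟨t, ht⟩ := h
  rw [show m = n + 24 * t by omega, root24_add, root24_mul, mul_one]

theorem root24_twelve : root24 12 = -1 := by
  rw [root24, ← Complex.exp_pi_mul_I]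
  congr 1
  push_cast
  ring

theorem root24_congr_neg {m n : ℤ} (h : (24 : ℤ) ∣ m - n - 12) : root24 m = -root24 n := by
  rw [root24_congr (n := n + 12) (by convert h using 1; ring), root24_add, root24_twelve]
  ring

/-! ### Kronecker and Jacobi symbols: reciprocity and the shift d ↦ c + d. -/

theorem kroneckerSymbol_of_odd {a n : ℤ} (hn : Odd n) (h : 0 < n ∨ 0 < a) :
    kroneckerSymbol a n = J(a | n.natAbs) := by
  have h0 : n ≠ 0 := by rintro rfl; simp at hn
  have h2 : padicValNat 2 n.natAbs = 0 :=
    padicValNat.eq_zero_of_not_dvd (by have := Nat.odd_iff.1 (Int.natAbs_odd.2 hn); omega)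
  have h3 : ¬ (n < 0 ∧ a < 0) := by omega
  simp [kroneckerSymbol, h0, h2, h3]

theorem etaMultiplier_of_odd {a b c d : ℤ} (hc : Odd c) (h : 0 < c) :
    etaMultiplier a b c d =
      (J(d | c.natAbs) : ℂ) * root24 ((a + d) * c - b * d * (c ^ 2 - 1) - 3 * c) := by
  rw [etaMultiplier, if_pos hc, abs_of_pos h, kroneckerSymbol_of_odd hc (Or.inl h), root24]
  push_cast
  rfl

theorem etaMultiplier_of_even {a b c d : ℤ} (hc : ¬ Odd c) (hd : Odd d) (h : 0 < c) :
    etaMultiplier a b c d =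
      (J(c | d.natAbs) : ℂ) * root24 (a * c * (1 - d ^ 2) + d * (b - c + 3) - 3) := by
  rw [etaMultiplier, if_neg hc, kroneckerSymbol_of_odd hd (Or.inr h), root24]
  push_cast
  rfl

theorem odd_of_det_even {a b c d : ℤ} (hdet : a * d - b * c = 1) (hc : ¬ Odd c) : Odd d := by
  by_contra hd
  rw [Int.not_odd_iff_even] at hc hd
  have : Even (1 : ℤ) := hdet ▸ (hd.mul_left a).sub (hc.mul_left b)
  exact absurd this (by decide)

theorem chi8_natAbs (d : ℤ) : ZMod.χ₈ (d.natAbs : ZMod 8) = ZMod.χ₈ (d : ZMod 8) := by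
  rcases Int.natAbs_eq d with h | h
  · conv_rhs => rw [h]
    simp
  · conv_rhs => rw [h]
    rw [Int.cast_neg, Int.cast_natCast]
    generalize (d.natAbs : ZMod 8) = x
    revert x
    decide

/-- Reciprocity for the Jacobi symbol, with a sign allowed in one entry. -/
theorem jacobiSym_natAbs_reciprocity {m : ℕ} (hm : Odd m) {d : ℤ} (hd : Odd d) :
    J(m | d.natAbs) = (if m % 4 = 3 ∧ d % 4 = 3 then -1 else 1) * J(d | m) := by
  have hn : Odd d.natAbs := Int.natAbs_odd.2 hd
  have hm2 := Nat.odd_iff.1 hm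
  have hd2 := Int.odd_iff.1 hd
  rw [← jacobiSym.quadratic_reciprocity_if (Nat.odd_iff.1 hm) (Nat.odd_iff.1 hn)]
  rcases le_or_gt 0 d with h0 | h0
  · have h1 : (d.natAbs : ℤ) = d := by omega
    rw [h1]
    have h2 : d.natAbs % 4 = 3 ↔ d % 4 = 3 := by omega
    simp only [h2]
    split_ifs <;> simp
  -- For d < 0, passing to |d| exchanges the classes 1 and 3 modulo 4; the sign (-1/m) = χ₄(m) makes
  -- up for exactly that.
  · have h1 : (d.natAbs : ℤ) = -d := by omega
    rw [h1, jacobiSym.neg _ hm]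
    rcases (by omega : m % 4 = 1 ∨ m % 4 = 3) with h4 | h4
    · rw [ZMod.χ₄_nat_one_mod_four h4]
      simp [h4]
    · rw [ZMod.χ₄_nat_three_mod_four h4]
      rcases (by omega : d % 4 = 1 ∨ d % 4 = 3) with h5 | h5
      · have h2 : d.natAbs % 4 = 3 := by omega
        simp [h4, h2, h5]
      · have h2 : d.natAbs % 4 = 1 := by omega
        simp [h4, h2, h5]

theorem jacobiSym_two_pow_mul (e : ℕ) {m : ℕ} (hm : Odd m) {d : ℤ} (hd : Odd d) :
    J(((2 ^ e * m : ℕ) : ℤ) | d.natAbs) =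
      ZMod.χ₈ (d : ZMod 8) ^ e *
        ((if m % 4 = 3 ∧ d % 4 = 3 then -1 else 1) * J(d | m)) := by
  push_cast
  rw [jacobiSym.mul_left, jacobiSym.pow_left, jacobiSym.at_two (Int.natAbs_odd.2 hd),
    jacobiSym_natAbs_reciprocity hm hd, chi8_natAbs]

theorem chi8_sq {d : ℤ} (hd : Odd d) : ZMod.χ₈ (d : ZMod 8) ^ 2 = 1 := by
  have h2 := Int.odd_iff.1 hd
  rw [← ZMod.intCast_mod d 8]
  rcases (by omega : d % 8 = 1 ∨ d % 8 = 3 ∨ d % 8 = 5 ∨ d % 8 = 7) with h | h | h | h <;>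
    · push_cast
      rw [h]
      decide

/-- The change of the Kronecker symbol `(c / d)` under `d ↦ c + d` for even `c`. -/
theorem jacobiSym_add_self {c d : ℤ} (hc : 0 < c) (hce : Even c) (hd : Odd d) :
    J(c | (c + d).natAbs) = (if c % 4 = 2 ∧ d % 4 = 1 then -1 else 1) * J(c | d.natAbs) := by
  obtain ⟨e, m, hm, hcm⟩ := Nat.exists_eq_two_pow_mul_odd (n := c.natAbs) (by omega)
  have hc' : c = ((2 ^ e * m : ℕ) : ℤ) := by omega
  have hcd : Odd (c + d) := hce.add_odd hd
  have hJ : J(c + d | m) = J(d | m) := by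
    apply jacobiSym.mod_left'
    rw [hc']
    push_cast
    rw [add_comm, mul_comm, Int.add_mul_emod_self_left]
  -- Writing c = 2^e m with m odd isolates the dependence on x: a power of χ₈(x), a sign read off
  -- from x mod 4, and (x/m), which does not change under x ↦ c + x.
  have key : ∀ x : ℤ, Odd x → J(c | x.natAbs) =
      ZMod.χ₈ (x : ZMod 8) ^ e * ((if m % 4 = 3 ∧ x % 4 = 3 then -1 else 1) * J(x | m)) := by
    intro x hx
    conv_lhs => rw [hc']
    exact jacobiSym_two_pow_mul e hm hx
  rw [key _ hcd, key _ hd, hJ]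
  have hm2 := Nat.odd_iff.1 hm
  have hd2 := Int.odd_iff.1 hd
  have hcd2 := Int.odd_iff.1 hcd
  have hc2 := Int.even_iff.1 hce
  have hs := chi8_sq hd
  have hs' := chi8_sq hcd
  match e, hcm with
  -- Evenness of c excludes e = 0. For e = 1 both χ₈ and the reciprocity sign can change, and
  -- residues modulo 8 decide; for e = 2 the square of χ₈ is trivial; for e ≥ 3 nothing changes
  -- since 8 divides c.
  | 0, hcm => omega
  | 1, hcm =>
    have h4 : c % 4 = 2 := by omega
    rw [pow_one, pow_one, ZMod.χ₈_int_eq_if_mod_eight, ZMod.χ₈_int_eq_if_mod_eight]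
    rcases (by omega : m % 4 = 1 ∨ m % 4 = 3) with h5 | h5
    · have h8 : c % 8 = 2 := by omega
      rcases (by omega : d % 8 = 1 ∨ d % 8 = 3 ∨ d % 8 = 5 ∨ d % 8 = 7) with h | h | h | h
      · simp [h5, h4, hd2, hcd2, h, (by omega : (c + d) % 8 = 3), (by omega : d % 4 = 1)]
      · simp [h5, h4, hd2, hcd2, h, (by omega : (c + d) % 8 = 5), (by omega : d % 4 = 3)]
      · simp [h5, h4, hd2, hcd2, h, (by omega : (c + d) % 8 = 7), (by omega : d % 4 = 1)]
      · simp [h5, h4, hd2, hcd2, h, (by omega : (c + d) % 8 = 1), (by omega : d % 4 = 3)]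
    · have h8 : c % 8 = 6 := by omega
      rcases (by omega : d % 8 = 1 ∨ d % 8 = 3 ∨ d % 8 = 5 ∨ d % 8 = 7) with h | h | h | h
      · simp [h5, h4, hd2, hcd2, h, (by omega : (c + d) % 8 = 7), (by omega : d % 4 = 1),
          (by omega : (c + d) % 4 = 3)]
      · simp [h5, h4, hd2, hcd2, h, (by omega : (c + d) % 8 = 1), (by omega : d % 4 = 3),
          (by omega : (c + d) % 4 = 1)]
      · simp [h5, h4, hd2, hcd2, h, (by omega : (c + d) % 8 = 3), (by omega : d % 4 = 1),
          (by omega : (c + d) % 4 = 3)]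
      · simp [h5, h4, hd2, hcd2, h, (by omega : (c + d) % 8 = 5), (by omega : d % 4 = 3),
          (by omega : (c + d) % 4 = 1)]
  | 2, hcm =>
    have h4 : c % 4 = 0 := by omega
    have h6 : (c + d) % 4 = d % 4 := by omega
    rw [h6, hs, hs', if_neg (c := c % 4 = 2 ∧ d % 4 = 1) (by omega)]
    ring
  | (e + 3), hcm =>
    have h8 : c % 8 = 0 := by
      rw [pow_add, mul_assoc, mul_left_comm] at hcm
      generalize 2 ^ e * m = y at hcm
      omega
    have h6 : (c + d) % 4 = d % 4 := by omega
    have h7 : ((c + d : ℤ) : ZMod 8) = (d : ZMod 8) := by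
      rw [ZMod.intCast_eq_intCast_iff, Int.ModEq]
      push_cast
      omega
    rw [h6, h7, if_neg (c := c % 4 = 2 ∧ d % 4 = 1) (by omega)]
    ring

/-! ### The multiplier under right multiplication by T and S. -/

theorem three_dvd_or_sq (c : ℤ) : (3 : ℤ) ∣ c ∨ (3 : ℤ) ∣ c ^ 2 - 1 := by
  rcases (by omega : c % 3 = 0 ∨ c % 3 = 1 ∨ c % 3 = 2) with h | h | h
  · exact Or.inl (by omega)
  · exact Or.inr (by
      obtain ⟨t, ht⟩ : ∃ t, c = 3 * t + 1 := ⟨c / 3, by omega⟩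
      exact ⟨3 * t ^ 2 + 2 * t, by rw [ht]; ring⟩)
  · exact Or.inr (by
      obtain ⟨t, ht⟩ : ∃ t, c = 3 * t + 2 := ⟨c / 3, by omega⟩
      exact ⟨3 * t ^ 2 + 4 * t + 1, by rw [ht]; ring⟩)

theorem dvd_24_of {n : ℤ} (h3 : (3 : ℤ) ∣ n) (h8 : (8 : ℤ) ∣ n) : (24 : ℤ) ∣ n := by omega

/-- The behaviour of the eta multiplier under `τ ↦ τ + 1`. -/
theorem etaMultiplier_mul_T {a b c d : ℤ} (hdet : a * d - b * c = 1) (hc : 0 < c) :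
    etaMultiplier a (a + b) c (c + d) = etaMultiplier a b c d * root24 1 := by
  by_cases hco : Odd c
  · rw [etaMultiplier_of_odd hco hc, etaMultiplier_of_odd hco hc, mul_assoc _ _ (root24 1), ← root24_add]
    have hJ : J(c + d | c.natAbs) = J(d | c.natAbs) := by
      apply jacobiSym.mod_left'
      rw [Int.natCast_natAbs, Int.emod_abs, Int.emod_abs, Int.add_emod_left]
    rw [hJ]
    congr 1
    apply root24_congr
    -- Since c is odd, 8 divides c² - 1. Modulo 3 either c² - 1 vanishes or c does, and in the
    -- latter case the determinant makes the second factor a multiple of c.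
    have hE : (a + (c + d)) * c - (a + b) * (c + d) * (c ^ 2 - 1) - 3 * c -
        ((a + d) * c - b * d * (c ^ 2 - 1) - 3 * c + 1) =
        (c ^ 2 - 1) * (1 - (a * c + a * d + b * c)) := by ring
    rw [hE]
    have h8 : (8 : ℤ) ∣ c ^ 2 - 1 := Int.eight_dvd_sq_sub_one_of_odd hco
    apply dvd_24_of _ (h8.mul_right _)
    rcases three_dvd_or_sq c with h | h
    · apply Dvd.dvd.mul_left
      rw [show 1 - (a * c + a * d + b * c) = c * (-a - 2 * b) by linear_combination -hdet]
      exact h.mul_right _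
    · exact h.mul_right _
  · have hce := Int.not_odd_iff_even.1 hco
    have hd := odd_of_det_even hdet hco
    rw [etaMultiplier_of_even hco (hce.add_odd hd) hc, etaMultiplier_of_even hco hd hc,
      jacobiSym_add_self hc hce hd, mul_assoc _ _ (root24 1), ← root24_add]
    have hE : a * c * (1 - (c + d) ^ 2) + (c + d) * (a + b - c + 3) - 3 -
        (a * c * (1 - d ^ 2) + d * (b - c + 3) - 3 + 1) =
        c * (-a * c ^ 2 - 2 * a * d * c + a + 2 * b - c + 3) := by
      linear_combination hdet
    have h3 : (3 : ℤ) ∣ c * (-a * c ^ 2 - 2 * a * d * c + a + 2 * b - c + 3) := by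
      rcases three_dvd_or_sq c with h | h
      · exact h.mul_right _
      · apply Dvd.dvd.mul_left
        rw [show -a * c ^ 2 - 2 * a * d * c + a + 2 * b - c + 3 =
          (c ^ 2 - 1) * (-a - 2 * b) + 3 * (1 - c) by linear_combination -2 * c * hdet]
        exact dvd_add (h.mul_right _) (dvd_mul_right _ _)
    obtain ⟨x, hx⟩ := hce.two_dvd
    obtain ⟨y, hy⟩ : ∃ y, d = 2 * y + 1 := hd
    have ha : Odd a := by
      by_contra h
      have : Even (1 : ℤ) := hdet ▸ ((Int.not_odd_iff_even.1 h).mul_right d).sub (hce.mul_left b)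
      exact absurd this (by decide)
    obtain ⟨w, hw⟩ := ha
    -- The sign from `jacobiSym_add_self` has to be met by exponents that differ by 12 modulo 24; in
    -- the other case they agree modulo 24.
    split_ifs with h
    · have h12 : (24 : ℤ) ∣ a * c * (1 - (c + d) ^ 2) + (c + d) * (a + b - c + 3) - 3 -
        (a * c * (1 - d ^ 2) + d * (b - c + 3) - 3 + 1) - 12 := by
        rw [hE]
        apply dvd_24_of
        · omega
        · obtain ⟨u, hu⟩ : ∃ u, c = 4 * u + 2 := ⟨c / 4, by omega⟩
          obtain ⟨y, hy⟩ : ∃ y, d = 4 * y + 1 := ⟨d / 4, by omega⟩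
          -- This is the determinant relation read modulo 4.
          obtain ⟨s, hs⟩ : ∃ s, a = 1 + 2 * b + 4 * s :=
            ⟨b * u - a * y, by rw [hu, hy] at hdet; linear_combination hdet⟩
          refine ⟨u + (-a * (2 * u + 1) ^ 2 - a * d * (2 * u + 1) + b + s - u) * (2 * u + 1) - 1,
            ?_⟩
          rw [hu]
          linear_combination (4 * u + 2) * hs
      rw [root24_congr_neg h12]
      push_cast
      ring
    · have h12 : (24 : ℤ) ∣ a * c * (1 - (c + d) ^ 2) + (c + d) * (a + b - c + 3) - 3 -
        (a * c * (1 - d ^ 2) + d * (b - c + 3) - 3 + 1) := by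
        rw [hE]
        apply dvd_24_of h3
        rcases (by omega : c % 4 = 0 ∨ c % 4 = 2) with h4 | h4
        · obtain ⟨u, hu⟩ : ∃ u, c = 4 * u := ⟨c / 4, by omega⟩
          refine ⟨u * (-8 * a * u ^ 2 - 4 * a * d * u + w + b - 2 * u + 2), ?_⟩
          rw [hu]
          linear_combination 4 * u * hw
        · obtain ⟨u, hu⟩ : ∃ u, c = 4 * u + 2 := ⟨c / 4, by omega⟩
          obtain ⟨y, hy⟩ : ∃ y, d = 4 * y + 3 := ⟨d / 4, by omega⟩
          obtain ⟨s, hs⟩ : ∃ s, a = 3 + 2 * b + 4 * s :=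
            ⟨-1 - b * u - b + a * y + a, by rw [hu, hy] at hdet; linear_combination -hdet⟩
          refine ⟨(2 * u + 1) * (-a * (2 * u + 1) ^ 2 - a * d * (2 * u + 1) + b + s - u + 1), ?_⟩
          rw [hu]
          linear_combination (4 * u + 2) * hs
      rw [root24_congr h12]
      push_cast
      ring

/-- The behaviour of the eta multiplier under `τ ↦ -1 / τ`. -/
theorem etaMultiplier_mul_S {a b c d : ℤ} (hdet : a * d - b * c = 1) (hc : 0 < c) (hd : 0 < d) :
    etaMultiplier b (-a) d (-c) = etaMultiplier a b c d * root24 (-3) := by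
  by_cases hdo : Odd d
  · have h4 := Int.odd_iff.1 hdo
    have hn : Odd d.natAbs := Int.natAbs_odd.2 hdo
    rw [etaMultiplier_of_odd hdo hd, jacobiSym.neg _ hn]
    by_cases hco : Odd c
    · have hm : Odd c.natAbs := Int.natAbs_odd.2 hco
      have h5 := Int.odd_iff.1 hco
      rw [etaMultiplier_of_odd hco hc, mul_assoc _ _ (root24 (-3)), ← root24_add]
      have hrec := jacobiSym_natAbs_reciprocity hm hdo
      rw [Int.natCast_natAbs, abs_of_pos hc] at hrec
      rw [hrec]
      -- For c and d odd the difference is a multiple of 12, and its class modulo 24 reproduces the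
      -- sign of quadratic reciprocity combined with (-1/d).
      have hE : (b + -c) * d - -a * -c * (d ^ 2 - 1) - 3 * d -
          ((a + d) * c - b * d * (c ^ 2 - 1) - 3 * c + -3) = 3 * ((1 + c) * (1 - d)) := by
        linear_combination -c * d * hdet
      rcases (by omega : d % 4 = 1 ∨ d % 4 = 3) with h6 | h6
      · rw [ZMod.χ₄_nat_one_mod_four (by omega), if_neg (by omega)]
        rw [root24_congr (n := (a + d) * c - b * d * (c ^ 2 - 1) - 3 * c + -3)]
        · push_cast; ring
        · rw [hE]
          obtain ⟨x, hx⟩ : ∃ x, c = 2 * x + 1 := hco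
          obtain ⟨y, hy⟩ : ∃ y, d = 4 * y + 1 := ⟨d / 4, by omega⟩
          exact ⟨-(x + 1) * y, by rw [hx, hy]; ring⟩
      · rw [ZMod.χ₄_nat_three_mod_four (by omega)]
        obtain ⟨y, hy⟩ : ∃ y, d = 4 * y + 3 := ⟨d / 4, by omega⟩
        rcases (by omega : c % 4 = 1 ∨ c % 4 = 3) with h7 | h7
        · rw [if_neg (by omega),
            root24_congr_neg (n := (a + d) * c - b * d * (c ^ 2 - 1) - 3 * c + -3)]
          · push_cast; ring
          · rw [hE]
            obtain ⟨x, hx⟩ : ∃ x, c = 4 * x + 1 := ⟨c / 4, by omega⟩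
            exact ⟨-(2 * x * y + x + y + 1), by rw [hx, hy]; ring⟩
        · rw [if_pos (by omega), root24_congr (n := (a + d) * c - b * d * (c ^ 2 - 1) - 3 * c + -3)]
          · push_cast; ring
          · rw [hE]
            obtain ⟨x, hx⟩ : ∃ x, c = 4 * x + 3 := ⟨c / 4, by omega⟩
            exact ⟨-(x + 1) * (2 * y + 1), by rw [hx, hy]; ring⟩
    · rw [etaMultiplier_of_even hco hdo hc, mul_assoc _ _ (root24 (-3)), ← root24_add]
      have hE : (b + -c) * d - -a * -c * (d ^ 2 - 1) - 3 * d -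
          (a * c * (1 - d ^ 2) + d * (b - c + 3) - 3 + -3) = 6 * (1 - d) := by ring
      rcases (by omega : d % 4 = 1 ∨ d % 4 = 3) with h6 | h6
      · rw [ZMod.χ₄_nat_one_mod_four (by omega),
          root24_congr (n := a * c * (1 - d ^ 2) + d * (b - c + 3) - 3 + -3)]
        · push_cast; ring
        · rw [hE]; omega
      · rw [ZMod.χ₄_nat_three_mod_four (by omega),
          root24_congr_neg (n := a * c * (1 - d ^ 2) + d * (b - c + 3) - 3 + -3)]
        · push_cast; ring
        · rw [hE]; omega
  · have hco : Odd c := by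
      by_contra h
      have : Even (1 : ℤ) := hdet ▸ ((Int.not_odd_iff_even.1 hdo).mul_left a).sub
        ((Int.not_odd_iff_even.1 h).mul_left b)
      exact absurd this (by decide)
    rw [etaMultiplier_of_even hdo hco.neg hd, etaMultiplier_of_odd hco hc, Int.natAbs_neg,
      mul_assoc _ _ (root24 (-3)), ← root24_add]
    congr 2
    ring

/-- The value of the eta multiplier at `c = 1`, `d = 0`. -/
theorem etaMultiplier_one_zero (a : ℤ) : etaMultiplier a (-1) 1 0 = root24 (a - 3) := by
  rw [etaMultiplier_of_odd odd_one one_pos]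
  simp

end UnimodalRank

end

section

open Filter Topology

namespace UnimodalRank

/-! ### The Jacobi triple product -/

theorem multipliable_qPochhammer (a : ℂ) {q : ℂ} (hq : ‖q‖ < 1) :
    Multipliable fun n : ℕ => 1 - a * q ^ n := by
  have h : Summable fun n : ℕ => ‖-(a * q ^ n)‖ := by
    simpa using (summable_geometric_of_lt_one (norm_nonneg _) hq).mul_left ‖a‖
  simpa [sub_eq_add_neg] using multipliable_one_add_of_summable h

theorem tendsto_qPochhammerInf (a : ℂ) {q : ℂ} (hq : ‖q‖ < 1) :
    Tendsto (fun N : ℕ => ∏ n ∈ Finset.range N, (1 - a * q ^ n)) atTop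
      (𝓝 (qPochhammerInf a q)) :=
  (multipliable_qPochhammer a hq).tendsto_prod_tprod_nat

theorem qPochhammerInf_ne_zero {a q : ℂ} (hq : ‖q‖ < 1) (h : ∀ n : ℕ, a * q ^ n ≠ 1) :
    qPochhammerInf a q ≠ 0 := by
  have hs : Summable fun n : ℕ => ‖-(a * q ^ n)‖ := by
    simpa using (summable_geometric_of_lt_one (norm_nonneg _) hq).mul_left ‖a‖
  have := tprod_one_add_ne_zero_of_summable (f := fun n : ℕ => -(a * q ^ n))
    (fun n => by rw [← sub_eq_add_neg, sub_ne_zero]; exact (h n).symm) hs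
  simpa [qPochhammerInf, sub_eq_add_neg] using this

theorem qPochhammerInf_eq_mul (a : ℂ) {q : ℂ} (hq : ‖q‖ < 1) :
    qPochhammerInf a q = (1 - a) * qPochhammerInf (a * q) q := by
  have h1 := (tendsto_qPochhammerInf a hq).comp (tendsto_add_atTop_nat 1)
  have h2 := (tendsto_qPochhammerInf (a * q) hq).const_mul (1 - a)
  refine tendsto_nhds_unique h1 (h2.congr fun N => ?_)
  simp only [Function.comp, Finset.prod_range_succ']
  rw [mul_comm]
  simp [pow_succ', mul_assoc]

/-! ### The finite form of the triple product. -/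

/-- The finite `q`-factorial `(q; q)_m`. -/
noncomputable def qFact (q : ℂ) (m : ℕ) : ℂ := ∏ j ∈ Finset.range m, (1 - q * q ^ j)

/-- `1 / (q; q)_m`, extended by `0` to negative `m`. -/
noncomputable def qFactInv (q : ℂ) (m : ℤ) : ℂ := if m < 0 then 0 else (qFact q m.toNat)⁻¹

theorem one_sub_qpow_ne_zero {q : ℂ} (hq : ‖q‖ < 1) (n : ℕ) : 1 - q * q ^ n ≠ 0 := by
  rw [sub_ne_zero, ← pow_succ']
  intro h
  have := pow_lt_one₀ (norm_nonneg q) hq n.succ_ne_zero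
  rw [← norm_pow, ← h] at this
  simp at this

/-- The value 0 at negative arguments makes the recursion valid for all integers (at m = 0 because 1
- q^0 = 0), so that the coefficient recursion below has no boundary cases. -/
theorem qFactInv_sub_one {q : ℂ} (hq : ‖q‖ < 1) (m : ℤ) :
    qFactInv q (m - 1) = (1 - q ^ m) * qFactInv q m := by
  rcases lt_trichotomy m 0 with h | rfl | h
  · simp [qFactInv, h, (by omega : m - 1 < 0)]
  · simp [qFactInv]
  · obtain ⟨n, rfl⟩ : ∃ n : ℕ, m = n + 1 := ⟨(m - 1).toNat, by omega⟩
    have h1 := one_sub_qpow_ne_zero hq n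
    have h2 : ((n : ℤ) + 1).toNat = n + 1 := by omega
    rw [qFactInv, qFactInv, if_neg (by omega), if_neg (by omega), h2, qFact, qFact,
      Finset.prod_range_succ]
    rw [show (n : ℤ) + 1 - 1 = n by ring, Int.toNat_natCast,
      show q ^ ((n : ℤ) + 1) = q * q ^ n by exact_mod_cast pow_succ' q n, mul_inv]
    field_simp

/-- The coefficient of `ζ ^ n` in the finite triple product. -/
noncomputable def finiteTripleCoeff (q : ℂ) (N : ℕ) (n : ℤ) : ℂ :=
  (-1) ^ n * q ^ (n * (n + 1) / 2) *
    (qFact q (2 * N) * qFactInv q (N - n) * qFactInv q (N + n))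

theorem triangle_add_one (n : ℤ) : (n + 1) * (n + 1 + 1) / 2 = n * (n + 1) / 2 + (n + 1) := by
  rw [show (n + 1) * (n + 1 + 1) = n * (n + 1) + (n + 1) * 2 by ring,
    Int.add_mul_ediv_right _ _ (by norm_num)]

/-- Going from N to N + 1 multiplies the finite product by (1 - ζq^(N+1))(1 - ζ⁻¹q^N) = 1 + q^(2N+1)
- ζq^(N+1) - ζ⁻¹q^N. This is the same operation on the coefficients of ζ^n, a Pascal rule for
q-binomial coefficients. -/
theorem finiteTripleCoeff_succ {q : ℂ} (hq : ‖q‖ < 1) (hq0 : q ≠ 0) (N : ℕ) (n : ℤ) :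
    finiteTripleCoeff q (N + 1) n =
      (1 + q ^ (2 * N + 1)) * finiteTripleCoeff q N n - q ^ (N + 1) * finiteTripleCoeff q N (n - 1)
        - q ^ N * finiteTripleCoeff q N (n + 1) := by
  have e1 : qFactInv q ((N : ℤ) - n) = (1 - q ^ ((N : ℤ) + 1 - n)) * qFactInv q ((N : ℤ) + 1 - n) := by
    rw [← qFactInv_sub_one hq]; congr 1; ring
  have e2 : qFactInv q ((N : ℤ) + n) = (1 - q ^ ((N : ℤ) + 1 + n)) * qFactInv q ((N : ℤ) + 1 + n) := by
    rw [← qFactInv_sub_one hq]; congr 1; ring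
  have e3 : qFactInv q ((N : ℤ) - (n + 1)) = (1 - q ^ ((N : ℤ) - n)) * qFactInv q ((N : ℤ) - n) := by
    rw [← qFactInv_sub_one hq]; congr 1; ring
  have e4 : qFactInv q ((N : ℤ) + (n - 1)) = (1 - q ^ ((N : ℤ) + n)) * qFactInv q ((N : ℤ) + n) := by
    rw [← qFactInv_sub_one hq]; congr 1; ring
  have t1 : n * (n + 1) / 2 = (n - 1) * (n - 1 + 1) / 2 + n := by
    have := triangle_add_one (n - 1)
    rw [show n - 1 + 1 = n by ring] at this ⊢
    exact this
  have t2 := triangle_add_one n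
  have h1 : q ^ ((n - 1) * (n - 1 + 1) / 2) = q ^ (n * (n + 1) / 2) * (q ^ n)⁻¹ := by
    rw [t1, zpow_add₀ hq0]
    field_simp
  have hf : qFact q (2 * (N + 1)) = qFact q (2 * N) * (1 - q ^ (2 * N + 1)) * (1 - q ^ (2 * N + 2)) := by
    rw [show 2 * (N + 1) = 2 * N + 1 + 1 by ring, qFact, Finset.prod_range_succ,
      Finset.prod_range_succ, qFact]
    ring
  have hn : q ^ n ≠ 0 := zpow_ne_zero _ hq0
  simp only [finiteTripleCoeff]
  rw [t2, h1, hf, e3, e4, e1, e2]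
  rw [show (N : ℤ) - (n - 1) = N + 1 - n by ring, show (N : ℤ) + (n + 1) = N + 1 + n by ring]
  push_cast
  simp only [zpow_sub₀ hq0, zpow_add₀ hq0, zpow_add₀ (by norm_num : (-1 : ℂ) ≠ 0),
    zpow_sub₀ (by norm_num : (-1 : ℂ) ≠ 0), zpow_natCast, zpow_one]
  generalize qFactInv q ((N : ℤ) + 1 - n) = x
  generalize qFactInv q ((N : ℤ) + 1 + n) = y
  generalize q ^ n = Q at *
  generalize q ^ (n * (n + 1) / 2) = R
  generalize (-1 : ℂ) ^ n = s
  simp only [pow_add, pow_mul', pow_one]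
  generalize q ^ N = A
  field_simp
  ring

theorem hasSum_finiteTripleCoeff {q ζ : ℂ} (hq : ‖q‖ < 1) (hq0 : q ≠ 0) (hζ : ζ ≠ 0) (N : ℕ) :
    HasSum (fun n : ℤ => finiteTripleCoeff q N n * ζ ^ n)
      ((∏ j ∈ Finset.range N, (1 - ζ * q * q ^ j)) * ∏ j ∈ Finset.range N, (1 - ζ⁻¹ * q ^ j)) := by
  induction N with
  | zero =>
    convert hasSum_single (f := fun n : ℤ => finiteTripleCoeff q 0 n * ζ ^ n) 0 ?_ using 1
    · simp [finiteTripleCoeff, qFact, qFactInv]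
    · intro n hn
      rcases lt_or_gt_of_ne hn with h | h <;> simp [finiteTripleCoeff, qFactInv, h]
  | succ N ih =>
    have h1 := ih.mul_left (1 + q ^ (2 * N + 1))
    have h2 := ((Equiv.subRight (1 : ℤ)).hasSum_iff.2 ih).mul_left (q ^ (N + 1) * ζ)
    have h3 := ((Equiv.addRight (1 : ℤ)).hasSum_iff.2 ih).mul_left (q ^ N * ζ⁻¹)
    have h4 := (h1.sub h2).sub h3
    rw [Finset.prod_range_succ, Finset.prod_range_succ]
    convert! h4 using 1
    · ext n
      simp only [Function.comp, Equiv.subRight_apply, Equiv.coe_addRight]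
      rw [finiteTripleCoeff_succ hq hq0, zpow_sub₀ hζ, zpow_add₀ hζ, zpow_one]
      field_simp
    · field_simp
      ring

theorem tendsto_qFact {q : ℂ} (hq : ‖q‖ < 1) :
    Tendsto (qFact q) atTop (𝓝 (qPochhammerInf q q)) := tendsto_qPochhammerInf q hq

theorem qPochhammerInf_self_ne_zero {q : ℂ} (hq : ‖q‖ < 1) : qPochhammerInf q q ≠ 0 :=
  qPochhammerInf_ne_zero hq fun n => (sub_ne_zero.1 (one_sub_qpow_ne_zero hq n)).symm

/-- The Jacobi triple product identity. -/
theorem tsum_jacobi_triple {q ζ : ℂ} (hq : ‖q‖ < 1) (hq0 : q ≠ 0) (hζ : ζ ≠ 0)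
    (hs : Summable fun n : ℤ => ‖q ^ (n * (n + 1) / 2) * ζ ^ n‖) :
    ∑' n : ℤ, (-1) ^ n * (q ^ (n * (n + 1) / 2) * ζ ^ n) =
      qPochhammerInf q q * (qPochhammerInf (ζ * q) q * qPochhammerInf ζ⁻¹ q) := by
  have hP := qPochhammerInf_self_ne_zero hq
  have hlim := tendsto_qFact hq
  obtain ⟨C₁, hC₁⟩ : ∃ C, ∀ m, ‖qFact q m‖ ≤ C := by
    obtain ⟨C, hC⟩ := hlim.norm.bddAbove_range
    exact ⟨C, fun m => hC ⟨m, rfl⟩⟩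
  obtain ⟨C₂, hC₂⟩ : ∃ C, ∀ m, ‖(qFact q m)⁻¹‖ ≤ C := by
    obtain ⟨C, hC⟩ := (hlim.inv₀ hP).norm.bddAbove_range
    exact ⟨C, fun m => hC ⟨m, rfl⟩⟩
  have hC₁0 : 0 ≤ C₁ := (norm_nonneg _).trans (hC₁ 0)
  have hC₂0 : 0 ≤ C₂ := (norm_nonneg _).trans (hC₂ 0)
  have hinv : ∀ m : ℤ, ‖qFactInv q m‖ ≤ C₂ := by
    intro m
    rw [qFactInv]
    split_ifs
    · simpa using hC₂0
    · exact hC₂ _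
  have hinvlim : ∀ f : ℕ → ℤ, Tendsto f atTop atTop →
      Tendsto (fun N => qFactInv q (f N)) atTop (𝓝 (qPochhammerInf q q)⁻¹) := by
    intro f hf
    have h1 : Tendsto (fun N => (f N).toNat) atTop atTop :=
      (tendsto_atTop_mono (fun m : ℤ => Int.self_le_toNat m) tendsto_id |> fun h =>
        tendsto_natCast_atTop_iff.1 h).comp hf
    refine ((hlim.inv₀ hP).comp h1).congr' ?_
    filter_upwards [hf.eventually_ge_atTop 0] with N hN
    simp [qFactInv, not_lt.2 hN]
  -- Dominated convergence: q-factorials and their inverses are bounded uniformly, so the theta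
  -- series itself, absolutely convergent by `hs`, is a majorant up to a constant.
  have hT : Tendsto (fun N : ℕ => ∑' n : ℤ, finiteTripleCoeff q N n * ζ ^ n) atTop
      (𝓝 (∑' n : ℤ, (-1) ^ n * (q ^ (n * (n + 1) / 2) * ζ ^ n) * (qPochhammerInf q q)⁻¹)) := by
    refine tendsto_tsum_of_dominated_convergence
      (bound := fun n : ℤ => ‖q ^ (n * (n + 1) / 2) * ζ ^ n‖ * (C₁ * C₂ * C₂))
      (hs.mul_right _) ?_ ?_
    · intro n
      have a1 := hinvlim (fun N => (N : ℤ) - n)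
        (tendsto_atTop_add_const_right _ (-n) tendsto_natCast_atTop_atTop)
      have a2 := hinvlim (fun N => (N : ℤ) + n)
        (tendsto_atTop_add_const_right _ n tendsto_natCast_atTop_atTop)
      have a3 : Tendsto (fun N : ℕ => qFact q (2 * N)) atTop (𝓝 (qPochhammerInf q q)) :=
        hlim.comp (tendsto_id.const_mul_atTop' (by norm_num))
      have := (((a3.mul a1).mul a2).const_mul ((-1) ^ n * q ^ (n * (n + 1) / 2))).mul_const (ζ ^ n)
      convert this using 2
      · rw [finiteTripleCoeff]
      · field_simp
    · refine Eventually.of_forall fun N n => ?_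
      have hsgn : ‖(-1 : ℂ) ^ n‖ = 1 := by simp
      rw [finiteTripleCoeff]
      simp only [norm_mul, hsgn, one_mul]
      rw [mul_right_comm]
      have b1 := hC₁ (2 * N)
      have b2 := hinv (N - n)
      have b3 := hinv (N + n)
      gcongr
  have hF : Tendsto (fun N : ℕ => ∑' n : ℤ, finiteTripleCoeff q N n * ζ ^ n) atTop
      (𝓝 (qPochhammerInf (ζ * q) q * qPochhammerInf ζ⁻¹ q)) := by
    refine ((tendsto_qPochhammerInf (ζ * q) hq).mul (tendsto_qPochhammerInf ζ⁻¹ hq)).congr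
      fun N => ?_
    exact (hasSum_finiteTripleCoeff hq hq0 hζ N).tsum_eq.symm
  have := tendsto_nhds_unique hT hF
  rw [tsum_mul_right] at this
  rw [← this]
  field_simp

/-! ### Theta and eta as products -/

theorem norm_exp_two_pi_I_mul {τ : ℂ} (hτ : 0 < τ.im) : ‖exp (2 * Real.pi * I * τ)‖ < 1 := by
  rw [Complex.norm_exp]
  simp
  positivity

theorem exp_pi_mul_I_zpow (n : ℤ) : exp (Real.pi * I * n) = (-1) ^ n := by
  rw [mul_comm, Complex.exp_int_mul, Complex.exp_pi_mul_I]

theorem int_triangle_cast (n : ℤ) : (((n * (n + 1) / 2 : ℤ)) : ℂ) = (n : ℂ) * (n + 1) / 2 := by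
  have h : (2 : ℤ) ∣ n * (n + 1) := (Int.even_mul_succ_self n).two_dvd
  rw [Int.cast_div h (by norm_num)]
  push_cast
  ring

theorem jacobiTheta₂_term_eq_triple (n : ℤ) (z τ : ℂ) :
    jacobiTheta₂_term n (z + τ / 2 + 1 / 2) τ =
      (-1) ^ n * (exp (2 * Real.pi * I * τ) ^ (n * (n + 1) / 2) * exp (2 * Real.pi * I * z) ^ n) := by
  rw [jacobiTheta₂_term, ← Complex.exp_int_mul, ← Complex.exp_int_mul, ← exp_pi_mul_I_zpow,
    ← Complex.exp_add, ← Complex.exp_add, int_triangle_cast]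
  congr 1
  ring

theorem jacobiVartheta_term_eq (n : ℤ) (z τ : ℂ) :
    (-1 : ℂ) ^ n *
      exp (Real.pi * I * ((n : ℂ) + 1 / 2) ^ 2 * τ + 2 * Real.pi * I * ((n : ℂ) + 1 / 2) * z) =
    exp (Real.pi * I * τ / 4 + Real.pi * I * z) * jacobiTheta₂_term n (z + τ / 2 + 1 / 2) τ := by
  rw [jacobiTheta₂_term, ← exp_pi_mul_I_zpow, ← Complex.exp_add, ← Complex.exp_add]
  congr 1
  ring

theorem jacobiVartheta_eq_theta₂ (z τ : ℂ) :
    jacobiVartheta z τ =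
      I * exp (Real.pi * I * τ / 4 + Real.pi * I * z) * jacobiTheta₂ (z + τ / 2 + 1 / 2) τ := by
  simp only [jacobiVartheta, jacobiVartheta_term_eq, tsum_mul_left, jacobiTheta₂]
  ring

/-- The product `(ζ q; q)_∞ (ζ⁻¹ q; q)_∞`. -/
noncomputable def crankDenom (z τ : ℂ) : ℂ :=
  qPochhammerInf (exp (2 * Real.pi * I * z) * exp (2 * Real.pi * I * τ)) (exp (2 * Real.pi * I * τ)) *
    qPochhammerInf ((exp (2 * Real.pi * I * z))⁻¹ * exp (2 * Real.pi * I * τ))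
      (exp (2 * Real.pi * I * τ))

theorem eta_eq_qPochhammerInf (τ : ℂ) :
    ModularForm.eta τ = exp (2 * Real.pi * I * τ / 24) *
      qPochhammerInf (exp (2 * Real.pi * I * τ)) (exp (2 * Real.pi * I * τ)) := by
  rw [ModularForm.eta, qPochhammerInf]
  simp only [pow_succ', Function.Periodic.qParam, Complex.ofReal_ofNat,
    Complex.ofReal_one, div_one]

theorem jacobiVartheta_eq_product (z : ℂ) {τ : ℂ} (hτ : 0 < τ.im) :
    jacobiVartheta z τ = -2 * sin (Real.pi * z) * exp (2 * Real.pi * I * τ / 12) *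
      ModularForm.eta τ * crankDenom z τ := by
  have hq := norm_exp_two_pi_I_mul hτ
  have hs : Summable fun n : ℤ => ‖exp (2 * Real.pi * I * τ) ^ (n * (n + 1) / 2) *
      exp (2 * Real.pi * I * z) ^ n‖ := by
    have := ((summable_jacobiTheta₂_term_iff (z + τ / 2 + 1 / 2) τ).2 hτ).norm
    refine this.congr fun n => ?_
    rw [jacobiTheta₂_term_eq_triple, norm_mul]
    simp
  rw [jacobiVartheta_eq_theta₂, jacobiTheta₂]
  simp only [jacobiTheta₂_term_eq_triple]
  rw [tsum_jacobi_triple hq (exp_ne_zero _) (exp_ne_zero _) hs,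
    qPochhammerInf_eq_mul (exp (2 * Real.pi * I * z))⁻¹ hq, eta_eq_qPochhammerInf, crankDenom]
  -- The factor 1 - ζ⁻¹ split off from (ζ⁻¹; q)_∞ becomes sin(πz) once half of the exponential
  -- prefactor in z is distributed over it.
  have h1 : I * exp (Real.pi * I * τ / 4 + Real.pi * I * z) * (1 - (exp (2 * Real.pi * I * z))⁻¹) =
      -2 * sin (Real.pi * z) * exp (2 * Real.pi * I * τ / 12) * exp (2 * Real.pi * I * τ / 24) := by
    rw [← Complex.exp_neg, mul_assoc, mul_sub, ← Complex.exp_add, mul_assoc (-2 * sin _),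
      ← Complex.exp_add, Complex.sin]
    have e1 : (Real.pi * I * τ / 4 + Real.pi * I * z : ℂ) = Real.pi * I * τ / 4 + (Real.pi * z * I) := by
      ring
    have e2 : (Real.pi * I * τ / 4 + Real.pi * I * z + -(2 * Real.pi * I * z) : ℂ) =
      Real.pi * I * τ / 4 + (-(Real.pi * z) * I) := by ring
    have e3 : (2 * Real.pi * I * τ / 12 + 2 * Real.pi * I * τ / 24 : ℂ) = Real.pi * I * τ / 4 := by ring
    rw [e2, e1, e3, Complex.exp_add, Complex.exp_add]
    ring
  linear_combination (qPochhammerInf (exp (2 * Real.pi * I * τ)) (exp (2 * Real.pi * I * τ)) *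
    qPochhammerInf (exp (2 * Real.pi * I * z) * exp (2 * Real.pi * I * τ)) (exp (2 * Real.pi * I * τ)) *
    qPochhammerInf ((exp (2 * Real.pi * I * z))⁻¹ * exp (2 * Real.pi * I * τ))
      (exp (2 * Real.pi * I * τ))) * h1

end UnimodalRank

end

section

namespace UnimodalRank

/-! ### Modular transformations of eta and theta -/

/-! ### Principal powers, and the generators T and S. -/

theorem cpow_mul_of_arg {x y : ℂ} (hx : x ≠ 0) (hy : y ≠ 0)
    (h : x.arg + y.arg ∈ Set.Ioc (-Real.pi) Real.pi) (r : ℂ) : (x * y) ^ r = x ^ r * y ^ r := by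
  rw [cpow_def_of_ne_zero (mul_ne_zero hx hy), cpow_def_of_ne_zero hx, cpow_def_of_ne_zero hy,
    Complex.log_mul hx hy h, ← Complex.exp_add]
  congr 1
  ring

theorem arg_pos_of_im_pos {x : ℂ} (h : 0 < x.im) : 0 < x.arg := by
  rcases (Complex.arg_nonneg_iff.2 h.le).lt_or_eq with h1 | h1
  · exact h1
  · exact absurd (Complex.arg_eq_zero_iff.1 h1.symm).2 h.ne'

theorem arg_lt_pi_of_im_pos {x : ℂ} (h : 0 < x.im) : x.arg < Real.pi := by
  rcases (Complex.arg_le_pi x).lt_or_eq with h1 | h1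
  · exact h1
  · exact absurd (Complex.arg_eq_pi_iff.1 h1).2 h.ne'

theorem ne_zero_of_im_pos {x : ℂ} (h : 0 < x.im) : x ≠ 0 := by
  rintro rfl
  simp at h

/-- The two arguments lie in (0, π), so their sum lies in (0, 2π). A sum above π would make the
imaginary part of the product negative; hence it stays in the range where the principal logarithm is
additive. -/
theorem cpow_mul_of_im_pos {x y : ℂ} (hx : 0 < x.im) (hy : 0 < y.im) (hxy : 0 < (x * y).im)
    (r : ℂ) : (x * y) ^ r = x ^ r * y ^ r := by
  have p1 := arg_pos_of_im_pos hx
  have p2 := arg_lt_pi_of_im_pos hx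
  have p3 := arg_pos_of_im_pos hy
  have p4 := arg_lt_pi_of_im_pos hy
  refine cpow_mul_of_arg (ne_zero_of_im_pos hx) (ne_zero_of_im_pos hy)
    ⟨by linarith [Real.pi_pos], ?_⟩ r
  by_contra hcon
  push Not at hcon
  have him : (x * y).im = ‖x‖ * ‖y‖ * Real.sin (x.arg + y.arg) := by
    rw [Complex.mul_im, Real.sin_add]
    linear_combination (-y.im) * Complex.norm_mul_cos_arg x - y.re * Complex.norm_mul_sin_arg x -
      ‖x‖ * Real.cos x.arg * Complex.norm_mul_sin_arg y -
      ‖x‖ * Real.sin x.arg * Complex.norm_mul_cos_arg y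
  have hsin : Real.sin (x.arg + y.arg) < 0 := by
    rw [← Real.sin_sub_two_pi]
    exact Real.sin_neg_of_neg_of_neg_pi_lt (by linarith) (by linarith)
  have hn : 0 < ‖x‖ * ‖y‖ :=
    mul_pos (norm_pos_iff.2 (ne_zero_of_im_pos hx)) (norm_pos_iff.2 (ne_zero_of_im_pos hy))
  nlinarith

theorem neg_I_mul_cpow_half {τ : ℂ} (hτ : 0 < τ.im) :
    (-I * τ) ^ (1 / 2 : ℂ) = root24 (-3) * τ ^ (1 / 2 : ℂ) := by
  have h1 := arg_pos_of_im_pos hτ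
  have h2 := arg_lt_pi_of_im_pos hτ
  rw [cpow_mul_of_arg (by simp) (ne_zero_of_im_pos hτ)
    (by rw [Complex.arg_neg_I]; constructor <;> linarith [Real.pi_pos]),
    cpow_def_of_ne_zero (by simp), Complex.log_neg_I, root24]
  congr 2
  push_cast
  ring

theorem neg_inv_im_pos {τ : ℂ} (hτ : 0 < τ.im) : 0 < (-1 / τ).im := by
  rw [neg_div, one_div, Complex.neg_im, Complex.inv_im, neg_div, neg_neg]
  exact div_pos hτ (Complex.normSq_pos.2 (ne_zero_of_im_pos hτ))

theorem eta_neg_inv {τ : ℂ} (hτ : 0 < τ.im) :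
    ModularForm.eta (-1 / τ) = root24 (-3) * τ ^ (1 / 2 : ℂ) * ModularForm.eta τ := by
  have h := ModularForm.eta_comp_eq_csqrt_I_inv (show τ ∈ UpperHalfPlane.upperHalfPlaneSet from hτ)
  simp only [Function.comp, Pi.smul_apply, Pi.mul_apply, smul_eq_mul] at h
  rw [h, ← mul_assoc, Complex.sqrt, Complex.sqrt]
  congr 2
  · rw [← Complex.cpow_neg, cpow_def_of_ne_zero I_ne_zero, Complex.log_I, root24]
    congr 1
    push_cast
    ring
  · norm_num

theorem eta_add_one (τ : ℂ) :
    ModularForm.eta (τ + 1) = root24 1 * ModularForm.eta τ := by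
  have h : exp (2 * Real.pi * I * (τ + 1)) = exp (2 * Real.pi * I * τ) := by
    rw [mul_add, Complex.exp_add, mul_one, Complex.exp_two_pi_mul_I, mul_one]
  rw [eta_eq_qPochhammerInf, eta_eq_qPochhammerInf, h, ← mul_assoc, root24, ← Complex.exp_add]
  congr 2
  push_cast
  ring

theorem jacobiVartheta_add_one (z τ : ℂ) :
    jacobiVartheta z (τ + 1) = root24 3 * jacobiVartheta z τ := by
  rw [jacobiVartheta, jacobiVartheta, mul_left_comm, ← tsum_mul_left (a := root24 3)]
  congr 1
  apply tsum_congr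
  intro n
  rw [mul_left_comm]
  congr 1
  have h : exp (2 * Real.pi * I * ((n * (n + 1) / 2 : ℤ) : ℂ)) = 1 :=
    Complex.exp_eq_one_iff.2 ⟨_, by ring⟩
  rw [int_triangle_cast] at h
  refine Eq.trans ?_ (mul_one _)
  refine Eq.trans ?_ (congrArg (_ * ·) h)
  rw [root24, ← Complex.exp_add, ← Complex.exp_add]
  congr 1
  push_cast
  ring

theorem jacobiVartheta_neg_inv (z : ℂ) {τ : ℂ} (hτ : 0 < τ.im) :
    jacobiVartheta (z / τ) (-1 / τ) =
      root24 (-9) * τ ^ (1 / 2 : ℂ) * exp (Real.pi * I * z ^ 2 / τ) * jacobiVartheta z τ := by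
  have h0 := ne_zero_of_im_pos hτ
  have hsq : (τ : ℂ) ^ (1 / 2 : ℂ) ≠ 0 := by simp [cpow_eq_zero_iff, h0]
  rw [jacobiVartheta_eq_theta₂, jacobiVartheta_eq_theta₂,
    jacobiTheta₂_functional_equation (z + τ / 2 + 1 / 2) τ, neg_I_mul_cpow_half hτ]
  -- The functional equation produces the argument (z + τ/2 + 1/2)/τ, while ϑ at -1/τ needs it
  -- shifted by -1/τ, which is the quasi-period there.
  have h2 := jacobiTheta₂_add_left' ((z + τ / 2 + 1 / 2) / τ) (-1 / τ)
  rw [show (z + τ / 2 + 1 / 2) / τ + -1 / τ = z / τ + -1 / τ / 2 + 1 / 2 by field_simp; ring] at h2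
  rw [h2]
  have hr : root24 (-9) = -I * root24 (-3) := by
    rw [show (-9 : ℤ) = -6 + -3 by norm_num, root24_add]
    congr 1
    rw [root24, show (Real.pi * I / 12 * ((-6 : ℤ) : ℂ) : ℂ) = -Real.pi / 2 * I by push_cast; ring,
      Complex.exp_neg_pi_div_two_mul_I]
  have hr3 : root24 (-3) ≠ 0 := exp_ne_zero _
  have hexp : I * (exp (Real.pi * I * (-1 / τ) / 4 + Real.pi * I * (z / τ)) *
      exp (-Real.pi * I * (-1 / τ + 2 * ((z + τ / 2 + 1 / 2) / τ)))) =
      exp (Real.pi * I * z ^ 2 / τ) * exp (Real.pi * I * τ / 4 + Real.pi * I * z) *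
        exp (-Real.pi * I * (z + τ / 2 + 1 / 2) ^ 2 / τ) := by
    refine (congrArg (· * _) Complex.exp_pi_div_two_mul_I.symm).trans ?_
    simp only [← Complex.exp_add]
    congr 1
    field_simp
    ring
  rw [hr]
  have hinv := mul_one_div_cancel (mul_ne_zero hr3 hsq)
  generalize jacobiTheta₂ ((z + τ / 2 + 1 / 2) / τ) (-1 / τ) = T
  generalize exp (Real.pi * I * z ^ 2 / τ) = e₃ at *
  generalize exp (Real.pi * I * τ / 4 + Real.pi * I * z) = e₄ at *
  generalize exp (-Real.pi * I * (z + τ / 2 + 1 / 2) ^ 2 / τ) = e₅ at *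
  linear_combination T * hexp + (I ^ 2 * e₃ * e₄ * e₅ * T) * hinv + (e₃ * e₄ * e₅ * T) * I_sq

/-! ### The transformation law for every matrix with positive lower left entry. -/

/-- The modular transformation law of `η` and `ϑ` under the matrix with rows `(a, b)`, `(c, d)`,
with multiplier `χ` for `η` and `χ ^ 3` for `ϑ`. -/
def ModularTransform (a b c d : ℤ) (χ : ℂ) : Prop :=
  ∀ τ : ℂ, 0 < τ.im →
    ModularForm.eta ((a * τ + b) / (c * τ + d)) =
      χ * (c * τ + d) ^ (1 / 2 : ℂ) * ModularForm.eta τ ∧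
    ∀ z : ℂ, jacobiVartheta (z / (c * τ + d)) ((a * τ + b) / (c * τ + d)) =
      χ ^ 3 * (c * τ + d) ^ (1 / 2 : ℂ) * exp (Real.pi * I * c * z ^ 2 / (c * τ + d)) *
        jacobiVartheta z τ

theorem root24_pow_three (n : ℤ) : root24 n ^ 3 = root24 (3 * n) := by
  rw [root24, root24, ← Complex.exp_nat_mul]
  congr 1
  push_cast
  ring

theorem ModularTransform.mul_T {a b c d : ℤ} {χ : ℂ} (h : ModularTransform a b c d χ) :
    ModularTransform a (a + b) c (c + d) (χ * root24 1) := by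
  intro τ hτ
  have h1 := h (τ + 1) (by simpa using hτ)
  have e1 : (a : ℂ) * (τ + 1) + b = a * τ + ((a + b : ℤ) : ℂ) := by push_cast; ring
  have e2 : (c : ℂ) * (τ + 1) + d = c * τ + ((c + d : ℤ) : ℂ) := by push_cast; ring
  rw [e1, e2] at h1
  refine ⟨?_, fun z => ?_⟩
  · rw [h1.1, eta_add_one]
    ring
  · rw [h1.2, jacobiVartheta_add_one, mul_pow, root24_pow_three]
    ring_nf

/-- The backward direction is needed too, since d may have to be shifted either way. -/
theorem ModularTransform.of_mul_T {a b c d : ℤ} {χ : ℂ}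
    (h : ModularTransform a (a + b) c (c + d) (χ * root24 1)) : ModularTransform a b c d χ := by
  intro τ hτ
  have h1 := h (τ - 1) (by simpa using hτ)
  have e1 : (a : ℂ) * (τ - 1) + ((a + b : ℤ) : ℂ) = a * τ + b := by push_cast; ring
  have e2 : (c : ℂ) * (τ - 1) + ((c + d : ℤ) : ℂ) = c * τ + d := by push_cast; ring
  rw [e1, e2] at h1
  have e3 := eta_add_one (τ - 1)
  rw [sub_add_cancel] at e3
  refine ⟨?_, fun z => ?_⟩
  · rw [h1.1, e3]
    ring
  · have e4 := jacobiVartheta_add_one z (τ - 1)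
    rw [sub_add_cancel] at e4
    rw [h1.2, e4, mul_pow, root24_pow_three]
    ring_nf

/-- Positivity of c and d places c(-1/τ) + d and dτ - c in the upper half plane, so the principal
square roots multiply without a correcting sign. -/
theorem ModularTransform.mul_S {a b c d : ℤ} {χ : ℂ} (hc : 0 < c) (hd : 0 < d)
    (h : ModularTransform a b c d χ) :
    ModularTransform b (-a) d (-c) (χ * root24 (-3)) := by
  intro τ hτ
  have h0 := ne_zero_of_im_pos hτ
  have hτ' := neg_inv_im_pos hτ
  have hc' : (0 : ℝ) < c := by exact_mod_cast hc
  have hd' : (0 : ℝ) < d := by exact_mod_cast hd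
  have him : 0 < ((d : ℂ) * τ + ((-c : ℤ) : ℂ)).im := by
    simp
    positivity
  have hne := ne_zero_of_im_pos him
  have him2 : 0 < ((c : ℂ) * (-1 / τ) + d).im := by
    have : ((c : ℂ) * (-1 / τ) + d).im = c * (-1 / τ).im := by simp
    rw [this]
    positivity
  have e2 : (c : ℂ) * (-1 / τ) + d = (d * τ + ((-c : ℤ) : ℂ)) / τ := by
    push_cast
    field_simp
    ring
  have e1 : ((a : ℂ) * (-1 / τ) + b) / (c * (-1 / τ) + d) =
      (b * τ + ((-a : ℤ) : ℂ)) / (d * τ + ((-c : ℤ) : ℂ)) := by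
    rw [e2]
    push_cast at hne ⊢
    field_simp
    ring
  have hsq : ((c : ℂ) * (-1 / τ) + d) ^ (1 / 2 : ℂ) * τ ^ (1 / 2 : ℂ) =
      (d * τ + ((-c : ℤ) : ℂ)) ^ (1 / 2 : ℂ) := by
    have hmul : (d * τ + ((-c : ℤ) : ℂ)) = ((c : ℂ) * (-1 / τ) + d) * τ := by
      rw [e2]
      field_simp
    rw [hmul, cpow_mul_of_im_pos him2 hτ (hmul ▸ him)]
  have h1 := h (-1 / τ) hτ'
  rw [e1] at h1
  refine ⟨?_, fun z => ?_⟩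
  · rw [h1.1, eta_neg_inv hτ, ← hsq]
    ring
  · have h2 := h1.2 (z / τ)
    have e3 : z / τ / ((c : ℂ) * (-1 / τ) + d) = z / (d * τ + ((-c : ℤ) : ℂ)) := by
      rw [e2]
      field_simp
    rw [e3, jacobiVartheta_neg_inv z hτ] at h2
    rw [h2, ← hsq, mul_pow, root24_pow_three]
    have e4 : exp (Real.pi * I * d * z ^ 2 / (d * τ + ((-c : ℤ) : ℂ))) =
        exp (Real.pi * I * c * (z / τ) ^ 2 / (c * (-1 / τ) + d)) * exp (Real.pi * I * z ^ 2 / τ) := by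
      rw [← Complex.exp_add, e2]
      congr 1
      push_cast at hne ⊢
      field_simp
      ring
    rw [e4]
    norm_num
    ring

theorem ModularTransform.mul_T_zpow_iff {a b c d : ℤ} (hdet : a * d - b * c = 1) (hc : 0 < c)
    (n : ℤ) :
    ModularTransform a (n * a + b) c (n * c + d) (etaMultiplier a (n * a + b) c (n * c + d)) ↔
      ModularTransform a b c d (etaMultiplier a b c d) := by
  have key : ∀ b d : ℤ, a * d - b * c = 1 →
      (ModularTransform a (a + b) c (c + d) (etaMultiplier a (a + b) c (c + d)) ↔
        ModularTransform a b c d (etaMultiplier a b c d)) := by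
    intro b d hdet
    rw [etaMultiplier_mul_T hdet hc]
    exact ⟨fun h => h.of_mul_T, fun h => h.mul_T⟩
  induction n with
  | zero => simp
  | succ n ih =>
    refine Iff.trans ?_ ih
    rw [show ((n : ℤ) + 1) * a + b = a + (n * a + b) by ring,
      show ((n : ℤ) + 1) * c + d = c + (n * c + d) by ring]
    exact key _ _ (by linear_combination hdet)
  | pred n ih =>
    refine Iff.trans ?_ ih
    rw [show -(n : ℤ) * a + b = a + ((-n - 1) * a + b) by ring,
      show -(n : ℤ) * c + d = c + ((-n - 1) * c + d) by ring]
    exact (key _ _ (by linear_combination hdet)).symm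

theorem modularTransform_one_zero (a : ℤ) :
    ModularTransform a (-1) 1 0 (etaMultiplier a (-1) 1 0) := by
  have h0 : ModularTransform 0 (-1) 1 0 (etaMultiplier 0 (-1) 1 0) := by
    intro τ hτ
    rw [etaMultiplier_one_zero, root24_pow_three]
    have := eta_neg_inv hτ
    have h2 := fun z => jacobiVartheta_neg_inv z hτ
    norm_num at this h2 ⊢
    exact ⟨this, h2⟩
  intro τ hτ
  have e : ((a : ℂ) * τ + ((-1 : ℤ) : ℂ)) / (((1 : ℤ) : ℂ) * τ + ((0 : ℤ) : ℂ)) = -1 / τ + a := by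
    have := ne_zero_of_im_pos hτ
    push_cast
    rw [one_mul, add_zero]
    field_simp
    ring
  have hE : ∀ n : ℤ, ∀ x : ℂ, ModularForm.eta (x + n) = root24 n * ModularForm.eta x := by
    intro n
    induction n with
    | zero => intro x; simp [root24]
    | succ n ih =>
      intro x
      have := ih (x + 1)
      rw [eta_add_one] at this
      rw [root24_add, mul_assoc, ← this]
      congr 1
      push_cast
      ring
    | pred n ih =>
      intro x
      have := ih (x - 1)
      have h3 := eta_add_one (x - 1)
      rw [sub_add_cancel] at h3
      rw [sub_eq_add_neg (-(n : ℤ)), root24_add, mul_assoc, h3, ← mul_assoc (root24 (-1)),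
        ← root24_add]
      rw [show (-1 + 1 : ℤ) = 24 * 0 by norm_num, root24_mul, one_mul, ← this]
      congr 1
      push_cast
      ring
  have hV : ∀ n : ℤ, ∀ z x : ℂ, jacobiVartheta z (x + n) = root24 (3 * n) * jacobiVartheta z x := by
    intro n z
    induction n with
    | zero => intro x; simp [root24]
    | succ n ih =>
      intro x
      have := ih (x + 1)
      rw [jacobiVartheta_add_one] at this
      rw [mul_add, root24_add, mul_assoc, mul_one, ← this]
      congr 1
      push_cast
      ring
    | pred n ih =>
      intro x
      have := ih (x - 1)
      have h3 := jacobiVartheta_add_one z (x - 1)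
      rw [sub_add_cancel] at h3
      rw [sub_eq_add_neg (-(n : ℤ)), mul_add, root24_add, mul_assoc, h3,
        ← mul_assoc (root24 (3 * -1)), ← root24_add]
      rw [show (3 * -1 + 3 : ℤ) = 24 * 0 by norm_num, root24_mul, one_mul, ← this]
      congr 1
      push_cast
      ring
  have h1 := h0 τ hτ
  have e0 : (((0 : ℤ) : ℂ) * τ + ((-1 : ℤ) : ℂ)) / (((1 : ℤ) : ℂ) * τ + ((0 : ℤ) : ℂ)) = -1 / τ := by
    simp
  rw [e0, etaMultiplier_one_zero] at h1
  rw [e, etaMultiplier_one_zero]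
  refine ⟨?_, fun z => ?_⟩
  · rw [hE, h1.1, sub_eq_add_neg a, root24_add, zero_sub]
    ring
  · rw [hV, h1.2, root24_pow_three, root24_pow_three,
      show 3 * (a - 3) = 3 * a + 3 * (0 - 3) by ring, root24_add]
    ring

/-- `η` and `ϑ` transform with the multipliers `χ` and `χ ^ 3`. -/
theorem modularTransform_etaMultiplier {a b c d : ℤ} (hdet : a * d - b * c = 1) (hc : 0 < c) :
    ModularTransform a b c d (etaMultiplier a b c d) := by
  induction hn : c.toNat using Nat.strong_induction_on generalizing a b c d with
  | _ m ih =>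
    -- Euclidean step: a power of T moves d into (-c, 0]. If the new d' is negative, the matrix is
    -- (-b', a; -d', c) times S, whose lower row is positive and whose lower left entry is smaller;
    -- if d' = 0, the determinant forces c = 1. The nonpositive interval is chosen to meet the
    -- positivity required by `ModularTransform.mul_S`.
    obtain ⟨n, hn1, hn2⟩ : ∃ n : ℤ, -c < n * c + d ∧ n * c + d ≤ 0 := by
      refine ⟨-(d / c) - (if d % c = 0 then 0 else 1), ?_⟩
      have h1 := Int.emod_add_mul_ediv d c
      have h2 := Int.emod_nonneg d hc.ne'
      have h3 := Int.emod_lt_of_pos d hc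
      split_ifs with h
      · constructor <;> nlinarith
      · have : 0 < d % c := lt_of_le_of_ne h2 (Ne.symm h)
        constructor <;> nlinarith
    rw [← ModularTransform.mul_T_zpow_iff hdet hc n]
    have hdet' : a * (n * c + d) - (n * a + b) * c = 1 := by linear_combination hdet
    generalize n * c + d = d' at *
    generalize n * a + b = b' at *
    rcases hn2.lt_or_eq with h | rfl
    · have h1 := ih (-d').toNat (by omega) (a := -b') (b := a) (c := -d') (d := c)
        (by linear_combination hdet') (by omega) rfl
      have h2 := h1.mul_S (by omega) hc
      rw [← etaMultiplier_mul_S (by linear_combination hdet') (by omega) hc] at h2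
      simpa using h2
    · have h1 : c = 1 := by
        refine Int.eq_one_of_dvd_one hc.le ⟨-b', by linear_combination -hdet'⟩
      subst h1
      have h2 : b' = -1 := by linear_combination -hdet'
      subst h2
      exact modularTransform_one_zero a

end UnimodalRank

end

section

namespace UnimodalRank

/-! ### The action at a cusp and the Gauss sums -/

/-- The upper right entry of the matrix with rows `([-h]_k, ·)`, `(k, -h)`. -/
theorem negInv_det {h k : ℕ} (hk : 0 < k) (hc : h.Coprime k) :
    (negInv h k : ℤ) * (-h) - (-(((h : ℤ) * negInv h k + 1) / k)) * k = 1 := by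
  have h1 := (negInv_spec hk hc).dvd
  have h2 : (k : ℤ) ∣ (h : ℤ) * negInv h k + 1 := by
    convert h1 using 1
    ring
  have h3 := Int.ediv_mul_cancel h2
  linear_combination h3

theorem cusp_im_pos {k : ℕ} (hk : 0 < k) (h : ℕ) {Z : ℂ} (hZ : 0 < Z.re) :
    0 < ((h : ℂ) / k + I * Z / k).im := by
  have hk' : (0 : ℝ) < k := by exact_mod_cast hk
  have : ((h : ℂ) / k + I * Z / k).im = Z.re / k := by
    rw [add_im, mul_div_assoc, mul_im]
    simp [Complex.div_natCast_im, Complex.div_natCast_re]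
  rw [this]
  positivity

/-- The matrix with lower row (k, -h) carries h/k + iZ/k to [-h]_k/k + i/(kZ), and the automorphy
factor kτ - h is just iZ. -/
theorem cusp_transform {h k : ℕ} (hk : 0 < k) (hc : h.Coprime k) {Z : ℂ} (hZ : 0 < Z.re) :
    ModularForm.eta ((negInv h k : ℂ) / k + I / (k * Z)) =
      chiHK h k * (I * Z) ^ (1 / 2 : ℂ) * ModularForm.eta ((h : ℂ) / k + I * Z / k) ∧
    ∀ z : ℂ, jacobiVartheta (z / (I * Z)) ((negInv h k : ℂ) / k + I / (k * Z)) =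
      chiHK h k ^ 3 * (I * Z) ^ (1 / 2 : ℂ) * exp (Real.pi * k * z ^ 2 / Z) *
        jacobiVartheta z ((h : ℂ) / k + I * Z / k) := by
  have hdet := negInv_det hk hc
  have hk0 : (k : ℂ) ≠ 0 := by exact_mod_cast hk.ne'
  have hZ0 : Z ≠ 0 := by rintro rfl; simp at hZ
  have H := modularTransform_etaMultiplier hdet (by exact_mod_cast hk) _ (cusp_im_pos hk h hZ)
  have hdet' : (negInv h k : ℂ) * (-h) - ((-(((h : ℤ) * negInv h k + 1) / k) : ℤ) : ℂ) * k = 1 := by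
    exact_mod_cast hdet
  have e2 : ((k : ℤ) : ℂ) * ((h : ℂ) / k + I * Z / k) + ((-(h : ℤ) : ℤ) : ℂ) = I * Z := by
    push_cast
    field_simp
    ring
  have e1 : (((negInv h k : ℤ) : ℂ) * ((h : ℂ) / k + I * Z / k) +
      ((-(((h : ℤ) * negInv h k + 1) / k) : ℤ) : ℂ)) / (I * Z) =
      (negInv h k : ℂ) / k + I / (k * Z) := by
    generalize ((-(((h : ℤ) * negInv h k + 1) / k) : ℤ) : ℂ) = b at *
    push_cast
    rw [div_eq_iff (by simp [hZ0])]
    field_simp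
    linear_combination -hdet' - I_sq
  rw [e2, e1] at H
  refine ⟨H.1, fun z => ?_⟩
  rw [H.2 z]
  congr 3
  push_cast
  field_simp

/-! ### Gauss sums from two Fourier expansions of one function. -/

/-- The phases `(-1) ^ ν exp (π i a (ν + 1/2) ^ 2 / k)`. -/
noncomputable def cuspPhase (a k : ℕ) (ν : ℤ) : ℂ :=
  (-1) ^ ν * exp (Real.pi * I * a * ((ν : ℂ) + 1 / 2) ^ 2 / k)

theorem cuspPhase_add_mul {a k : ℕ} (hk : 0 < k) (ν j : ℤ) :
    cuspPhase a k (ν + 2 * k * j) = cuspPhase a k ν := by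
  have hk0 : (k : ℂ) ≠ 0 := by exact_mod_cast hk.ne'
  have h1 : (-1 : ℂ) ^ (ν + 2 * k * j) = (-1) ^ ν := by
    rw [zpow_add₀ (by norm_num), mul_assoc, zpow_mul]
    norm_num
  rw [cuspPhase, cuspPhase, h1]
  congr 1
  rw [Complex.exp_eq_exp_iff_exists_int]
  refine ⟨a * j * (2 * ν + 1 + 2 * k * j), ?_⟩
  push_cast
  field_simp
  ring

theorem norm_cuspPhase (a k : ℕ) (ν : ℤ) : ‖cuspPhase a k ν‖ = 1 := by
  rw [cuspPhase, norm_mul, norm_zpow, norm_neg, norm_one, one_zpow, one_mul,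
    show (Real.pi * I * a * ((ν : ℂ) + 1 / 2) ^ 2 / k : ℂ) =
      ((Real.pi * a * ((ν : ℝ) + 1 / 2) ^ 2 / k : ℝ) : ℂ) * I by push_cast; ring,
    Complex.norm_exp_ofReal_mul_I]

theorem integral_exp_pi_int {n : ℤ} (hn : n ≠ 0) :
    ∫ t in (0 : ℝ)..2, exp (Real.pi * I * n * t) = 0 := by
  have hc : (Real.pi * I * n : ℂ) ≠ 0 := by
    simp [Real.pi_ne_zero, hn]
  rw [integral_exp_mul_complex hc]
  have : exp (Real.pi * I * n * ((2 : ℝ) : ℂ)) = 1 :=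
    Complex.exp_eq_one_iff.2 ⟨n, by push_cast; ring⟩
  rw [this]
  simp

/-- Uniqueness of the coefficients of an absolutely convergent trigonometric series. -/
theorem eq_zero_of_tsum_exp_eq_zero {d : ℤ → ℂ} (hd : Summable fun n => ‖d n‖)
    (h : ∀ t : ℝ, ∑' n : ℤ, d n * exp (Real.pi * I * n * t) = 0) (N : ℤ) : d N = 0 := by
  let f : ℤ → C(ℝ, ℂ) := fun n => ⟨fun t => d n * exp (Real.pi * I * (n - N : ℤ) * t), by fun_prop⟩
  have hnorm : ∀ n t, ‖f n t‖ = ‖d n‖ := by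
    intro n t
    simp only [f, ContinuousMap.coe_mk, norm_mul]
    rw [show (Real.pi * I * (n - N : ℤ) * t : ℂ) = ((Real.pi * (n - N : ℤ) * t : ℝ) : ℂ) * I by
      push_cast; ring, Complex.norm_exp_ofReal_mul_I, mul_one]
  have hs : Summable fun n => ‖(f n).restrict (⟨Set.uIcc 0 2, isCompact_uIcc⟩ :
      TopologicalSpace.Compacts ℝ)‖ := by
    refine Summable.of_nonneg_of_le (fun _ => norm_nonneg _) (fun n => ?_) hd
    refine (ContinuousMap.norm_le _ (norm_nonneg _)).2 fun x => ?_
    exact (hnorm n x).le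
  -- Termwise integration over a period against exp(-πiNt), already built into `f`, isolates the
  -- N-th coefficient.
  have h1 := intervalIntegral.hasSum_intervalIntegral_of_summable_norm hs
  have h2 : ∀ t : ℝ, ∑' n, f n t = 0 := by
    intro t
    have : ∀ n, f n t = exp (-(Real.pi * I * N * t)) * (d n * exp (Real.pi * I * n * t)) := by
      intro n
      simp only [f, ContinuousMap.coe_mk]
      rw [mul_left_comm, ← Complex.exp_add]
      congr 2
      push_cast
      ring
    simp only [this, tsum_mul_left, h, mul_zero]
  simp only [h2, intervalIntegral.integral_zero] at h1
  have h3 : ∀ n, n ≠ N → ∫ t in (0 : ℝ)..2, f n t = 0 := by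
    intro n hn
    simp only [f, ContinuousMap.coe_mk, intervalIntegral.integral_const_mul]
    rw [integral_exp_pi_int (sub_ne_zero.2 hn), mul_zero]
  have h4 := h1.unique (hasSum_single N h3)
  simp [f] at h4
  exact h4

/-- Poisson summation for a Gaussian summed over translates by 2ℤ. -/
theorem tsum_gaussian_shift {k : ℕ} (hk : 0 < k) (x : ℂ) :
    ∑' j : ℤ, exp (-Real.pi * k * (x - 2 * j) ^ 2) =
      1 / (2 * Real.sqrt k) * ∑' n : ℤ, exp (-Real.pi * n ^ 2 / (4 * k) + Real.pi * I * n * x) := by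
  have hk' : (0 : ℝ) < k := by exact_mod_cast hk
  have hk0 : (k : ℂ) ≠ 0 := by exact_mod_cast hk.ne'
  have ha : 0 < (((1 / (4 * k) : ℝ)) : ℂ).re := by
    rw [Complex.ofReal_re]
    positivity
  have H := Complex.tsum_exp_neg_quadratic ha (I * x / 2)
  have hsq : (((1 / (4 * k) : ℝ)) : ℂ) ^ (1 / 2 : ℂ) = 1 / (2 * Real.sqrt k) := by
    rw [show (1 / 2 : ℂ) = ((1 / 2 : ℝ) : ℂ) by push_cast; rfl,
      ← Complex.ofReal_cpow (by positivity), ← Real.sqrt_eq_rpow, Real.sqrt_div zero_le_one,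
      Real.sqrt_mul (by norm_num), show (4 : ℝ) = 2 ^ 2 by norm_num, Real.sqrt_sq (by norm_num)]
    push_cast
    simp
  have hs0 : (Real.sqrt k : ℂ) ≠ 0 := by
    exact_mod_cast (Real.sqrt_pos.2 hk').ne'
  rw [hsq] at H
  have e1 : ∀ n : ℤ, exp (-Real.pi * ((1 / (4 * k) : ℝ) : ℂ) * n ^ 2 + 2 * Real.pi * (I * x / 2) * n) =
      exp (-Real.pi * n ^ 2 / (4 * k) + Real.pi * I * n * x) := by
    intro n
    congr 1
    push_cast
    field_simp
  have e2 : ∀ n : ℤ, exp (-Real.pi / ((1 / (4 * k) : ℝ) : ℂ) * (n + I * (I * x / 2)) ^ 2) =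
      exp (-Real.pi * k * (x - 2 * n) ^ 2) := by
    intro n
    congr 1
    rw [show I * (I * x / 2) = -x / 2 by linear_combination (x / 2) * I_sq]
    push_cast
    field_simp
    ring
  simp only [e1, e2] at H
  rw [H]
  field_simp

/-- The coefficients of `ϑ(t; (h + i) / k)`, up to the Gaussian factor. -/
noncomputable def thetaCoeff (h k : ℕ) (n : ℤ) : ℂ :=
  if Odd n then (-1) ^ ((n - 1) / 2) * exp (Real.pi * I * h * ((n : ℂ) / 2) ^ 2 / k) else 0

theorem summable_exp_neg_sq {k : ℕ} (hk : 0 < k) :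
    Summable fun n : ℤ => ‖exp (-Real.pi * n ^ 2 / (4 * k) : ℂ)‖ := by
  have hk0 : (k : ℂ) ≠ 0 := by exact_mod_cast hk.ne'
  have hk' : (0 : ℝ) < k := by exact_mod_cast hk
  have him : 0 < (I / (4 * k) : ℂ).im := by
    rw [show (I / (4 * k) : ℂ) = ((1 / (4 * k) : ℝ) : ℂ) * I by push_cast; field_simp,
      Complex.im_ofReal_mul, I_im, mul_one]
    positivity
  refine ((summable_jacobiTheta₂_term_iff 0 _).2 him).norm.congr fun n => ?_
  rw [jacobiTheta₂_term]
  congr 2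
  field_simp
  linear_combination (n ^ 2 : ℂ) * I_sq

/-- This is the law of ϑ at Z = 1 for real t: multiplying by exp(-πkt²) completes the squares on one
side and cancels the exponential factor on the other, which becomes a Fourier series of period 2. -/
theorem tsum_cuspPhase_eq {h k : ℕ} (hk : 0 < k) (hc : h.Coprime k) (t : ℝ) :
    ∑' r : ℤ, cuspPhase (negInv h k) k r * exp (-Real.pi * k * (t - (r + 1 / 2) / k) ^ 2) =
      chiHK h k ^ 3 * I ^ (1 / 2 : ℂ) *
        ∑' n : ℤ, thetaCoeff h k n * exp (-Real.pi * n ^ 2 / (4 * k)) * exp (Real.pi * I * n * t) := by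
  have hk0 : (k : ℂ) ≠ 0 := by exact_mod_cast hk.ne'
  have H := (cusp_transform hk hc (Z := 1) (by simp)).2 t
  have e1 : ∀ r : ℤ, cuspPhase (negInv h k) k r * exp (-Real.pi * k * (t - (r + 1 / 2) / k) ^ 2) =
      exp (-Real.pi * k * t ^ 2) * ((-1 : ℂ) ^ r *
        exp (Real.pi * I * ((r : ℂ) + 1 / 2) ^ 2 * ((negInv h k : ℂ) / k + I / (k * 1)) +
          2 * Real.pi * I * ((r : ℂ) + 1 / 2) * (t / (I * 1)))) := by
    intro r
    rw [cuspPhase, mul_assoc, ← Complex.exp_add, mul_left_comm, ← Complex.exp_add]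
    congr 2
    field_simp
    linear_combination (-4 * ((r : ℂ) + 1 / 2) ^ 2) * I_sq
  have e2 : ∑' n : ℤ, thetaCoeff h k n * exp (-Real.pi * n ^ 2 / (4 * k)) *
        exp (Real.pi * I * n * t) = ∑' n : ℤ, (-1 : ℂ) ^ n *
        exp (Real.pi * I * ((n : ℂ) + 1 / 2) ^ 2 * ((h : ℂ) / k + I * 1 / k) +
          2 * Real.pi * I * ((n : ℂ) + 1 / 2) * t) := by
    have hinj : Function.Injective fun n : ℤ => 2 * n + 1 := fun a b hab => by simpa using hab
    rw [← hinj.tsum_eq]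
    · refine tsum_congr fun n => ?_
      have ho : Odd (2 * n + 1) := ⟨n, rfl⟩
      rw [thetaCoeff, if_pos ho, show (2 * n + 1 - 1) / 2 = n by omega, mul_assoc, mul_assoc,
        ← Complex.exp_add, ← Complex.exp_add]
      congr 2
      push_cast
      field_simp
      linear_combination (-4 * (2 * (n : ℂ) + 1) ^ 2) * I_sq
    · intro n hn
      by_contra hcon
      apply hn
      have : ¬ Odd n := by
        rintro ⟨m, hm⟩
        exact hcon ⟨m, hm.symm⟩
      simp [thetaCoeff, this]
  simp only [e1, tsum_mul_left, e2]
  rw [jacobiVartheta, jacobiVartheta] at H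
  have hE : exp (-Real.pi * k * t ^ 2) * exp (Real.pi * k * t ^ 2 / 1) = 1 := by
    rw [← Complex.exp_add, show (-Real.pi * k * t ^ 2 + Real.pi * k * t ^ 2 / 1 : ℂ) = 0 by ring,
      Complex.exp_zero]
  rw [mul_one I] at H
  apply mul_left_cancel₀ I_ne_zero
  rw [mul_one I]
  linear_combination exp (-Real.pi * k * t ^ 2) * H + (chiHK h k ^ 3 * I ^ (1 / 2 : ℂ) * I *
    ∑' n : ℤ, (-1 : ℂ) ^ n *
        exp (Real.pi * I * ((n : ℂ) + 1 / 2) ^ 2 * ((h : ℂ) / k + I / k) +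
          2 * Real.pi * I * ((n : ℂ) + 1 / 2) * t)) * hE

theorem summable_gaussian_shift {k : ℕ} (hk : 0 < k) (x : ℝ) :
    Summable fun j : ℤ => ‖exp (-Real.pi * k * ((x : ℂ) - 2 * j) ^ 2)‖ := by
  have hk' : (0 : ℝ) < k := by exact_mod_cast hk
  have him : 0 < ((4 * k : ℝ) * I : ℂ).im := by
    rw [Complex.im_ofReal_mul, I_im, mul_one]
    positivity
  refine (((summable_jacobiTheta₂_term_iff (-(2 * k * x : ℝ) * I) _).2 him).norm.mul_left
    ‖exp (-Real.pi * k * (x : ℂ) ^ 2)‖).congr fun n => ?_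
  rw [jacobiTheta₂_term, ← norm_mul, ← Complex.exp_add]
  congr 2
  push_cast
  linear_combination (-4 * Real.pi * k * n * x + 4 * Real.pi * k * n ^ 2 : ℂ) * I_sq

theorem tsum_int_eq_sum_range {n : ℕ} (hn : 0 < n) (f : ℤ → ℂ)
    (hf : ∀ ν : ℕ, Summable fun j : ℤ => ‖f (ν + n * j)‖) :
    ∑' r : ℤ, f r = ∑ ν ∈ Finset.range n, ∑' j : ℤ, f (ν + n * j) := by
  have : NeZero n := ⟨hn.ne'⟩
  let e : Fin n × ℤ ≃ ℤ := (Equiv.prodComm _ _).trans (Int.divModEquiv n).symm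
  have he : ∀ p : Fin n × ℤ, e p = (p.1 : ℕ) + n * p.2 := by
    rintro ⟨a, b⟩
    simp [e, Int.divModEquiv]
    ring
  have hs : Summable fun p : Fin n × ℤ => f (e p) := by
    refine Summable.of_norm ((summable_prod_of_nonneg fun _ => norm_nonneg _).2 ⟨fun a => ?_, ?_⟩)
    · simpa only [he] using hf a
    · exact (hasSum_fintype _).summable
  rw [← e.tsum_eq, hs.tsum_prod, tsum_fintype, ← Fin.sum_univ_eq_sum_range
    (fun ν => ∑' j : ℤ, f (ν + n * j))]
  simp only [he]

/-- The phases have period 2k. Summing first over a residue class and applying Poisson summation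
there gives a second Fourier series, whose coefficients are finite Gauss sums. -/
theorem tsum_cuspPhase_eq_fourier {k : ℕ} (hk : 0 < k) (a : ℕ) (t : ℝ) :
    ∑' r : ℤ, cuspPhase a k r * exp (-Real.pi * k * (t - (r + 1 / 2) / k) ^ 2) =
      ∑' n : ℤ, (1 / (2 * Real.sqrt k) * (∑ ν ∈ Finset.range (2 * k), cuspPhase a k ν *
        exp (-(Real.pi * I * n * ((ν : ℂ) + 1 / 2) / k)))) *
        exp (-Real.pi * n ^ 2 / (4 * k)) * exp (Real.pi * I * n * t) := by
  have hk0 : (k : ℂ) ≠ 0 := by exact_mod_cast hk.ne'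
  have e1 : ∀ (ν : ℕ) (j : ℤ), cuspPhase a k (ν + (2 * k : ℕ) * j) *
      exp (-Real.pi * k * (t - ((ν + (2 * k : ℕ) * j : ℤ) + 1 / 2) / k) ^ 2) =
      cuspPhase a k ν * exp (-Real.pi * k * (((t - (ν + 1 / 2) / k : ℝ) : ℂ) - 2 * j) ^ 2) := by
    intro ν j
    have := cuspPhase_add_mul (a := a) hk ν j
    push_cast at this ⊢
    rw [this]
    congr 2
    field_simp
    ring
  rw [tsum_int_eq_sum_range (by positivity : 0 < 2 * k)]
  · simp only [e1, tsum_mul_left, tsum_gaussian_shift hk]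
    have hs : ∀ ν ∈ Finset.range (2 * k), Summable fun n : ℤ => cuspPhase a k ν *
        (1 / (2 * Real.sqrt k) * exp (-Real.pi * n ^ 2 / (4 * k) + Real.pi * I * n *
          ((t - (ν + 1 / 2) / k : ℝ) : ℂ))) := by
      intro ν _
      refine Summable.mul_left _ (Summable.mul_left _ (Summable.of_norm ?_))
      refine (summable_exp_neg_sq hk).congr fun n => ?_
      rw [Complex.exp_add, norm_mul, show (Real.pi * I * n * ((t - (ν + 1 / 2) / k : ℝ) : ℂ) : ℂ) =
        ((Real.pi * n * (t - (ν + 1 / 2) / k) : ℝ) : ℂ) * I by push_cast; ring,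
        Complex.norm_exp_ofReal_mul_I, mul_one]
    simp only [← tsum_mul_left]
    rw [← Summable.tsum_finsetSum hs]
    refine tsum_congr fun n => ?_
    rw [Finset.mul_sum, Finset.sum_mul, Finset.sum_mul]
    refine Finset.sum_congr rfl fun ν _ => ?_
    have : exp (-Real.pi * n ^ 2 / (4 * k) + Real.pi * I * n * ((t - (ν + 1 / 2) / k : ℝ) : ℂ)) =
        exp (-(Real.pi * I * n * ((ν : ℂ) + 1 / 2) / k)) * exp (-Real.pi * n ^ 2 / (4 * k)) *
          exp (Real.pi * I * n * t) := by
      rw [← Complex.exp_add, ← Complex.exp_add]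
      congr 1
      push_cast
      ring
    rw [this]
    ring
  · intro ν
    simp only [e1, norm_mul, norm_cuspPhase, one_mul]
    exact summable_gaussian_shift hk _

/-- Evaluation of the Gauss sums attached to the cusp. -/
theorem sum_cuspPhase_exp {h k : ℕ} (hk : 0 < k) (hc : h.Coprime k) (n : ℤ) :
    ∑ ν ∈ Finset.range (2 * k), cuspPhase (negInv h k) k ν *
        exp (-(Real.pi * I * n * ((ν : ℂ) + 1 / 2) / k)) =
      2 * Real.sqrt k * chiHK h k ^ 3 * I ^ (1 / 2 : ℂ) * thetaCoeff h k n := by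
  have hk' : (0 : ℝ) < k := by exact_mod_cast hk
  have hs0 : (Real.sqrt k : ℂ) ≠ 0 := by
    exact_mod_cast (Real.sqrt_pos.2 hk').ne'
  set G : ℤ → ℂ := fun n => 1 / (2 * Real.sqrt k) * (∑ ν ∈ Finset.range (2 * k),
    cuspPhase (negInv h k) k ν * exp (-(Real.pi * I * n * ((ν : ℂ) + 1 / 2) / k))) with hG
  have hE : ∀ (n : ℤ) (t : ℝ), ‖exp (Real.pi * I * n * t)‖ = 1 := by
    intro n t
    rw [show (Real.pi * I * n * t : ℂ) = ((Real.pi * n * t : ℝ) : ℂ) * I by push_cast; ring,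
      Complex.norm_exp_ofReal_mul_I]
  have hGb : ∀ n, ‖G n‖ ≤ ‖(1 / (2 * Real.sqrt k) : ℂ)‖ * (2 * k) := by
    intro n
    rw [hG, norm_mul]
    refine mul_le_mul_of_nonneg_left ((norm_sum_le _ _).trans ?_) (norm_nonneg _)
    refine (Finset.sum_le_card_nsmul _ _ 1 fun ν _ => ?_).trans (by simp)
    rw [norm_mul, norm_cuspPhase, one_mul, show (-(Real.pi * I * n * ((ν : ℂ) + 1 / 2) / k) : ℂ) =
      ((-(Real.pi * n * ((ν : ℝ) + 1 / 2) / k) : ℝ) : ℂ) * I by push_cast; ring,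
      Complex.norm_exp_ofReal_mul_I]
  have hTb : ∀ n, ‖thetaCoeff h k n‖ ≤ 1 := by
    intro n
    rw [thetaCoeff]
    split_ifs
    · rw [norm_mul, norm_zpow, norm_neg, norm_one, one_zpow, one_mul,
        show (Real.pi * I * h * ((n : ℂ) / 2) ^ 2 / k : ℂ) =
          ((Real.pi * h * ((n : ℝ) / 2) ^ 2 / k : ℝ) : ℂ) * I by push_cast; ring,
        Complex.norm_exp_ofReal_mul_I]
    · simp
  have hsum : ∀ (u : ℤ → ℂ) (C : ℝ), (∀ n, ‖u n‖ ≤ C) →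
      Summable fun n : ℤ => ‖u n * exp (-Real.pi * n ^ 2 / (4 * k))‖ := by
    intro u C hu
    refine Summable.of_nonneg_of_le (fun _ => norm_nonneg _) (fun n => ?_)
      ((summable_exp_neg_sq hk).mul_left C)
    rw [norm_mul]
    exact mul_le_mul_of_nonneg_right (hu n) (norm_nonneg _)
  set c : ℂ := chiHK h k ^ 3 * I ^ (1 / 2 : ℂ) with hcdef
  have hs1 := hsum G _ hGb
  have hs2 := hsum (fun n => c * thetaCoeff h k n) (‖c‖ * 1) fun n => by
    rw [norm_mul]
    exact mul_le_mul_of_nonneg_left (hTb n) (norm_nonneg _)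
  have hsE : ∀ (u : ℤ → ℂ) (t : ℝ), (Summable fun n : ℤ => ‖u n‖) →
      Summable fun n : ℤ => u n * exp (Real.pi * I * n * t) := by
    intro u t hu
    refine Summable.of_norm (hu.congr fun n => ?_)
    rw [norm_mul, hE, mul_one]
  -- Both series carry the weight exp(-πn²/(4k)). It secures absolute convergence and, never being
  -- zero, cancels after the coefficients have been compared.
  have key := eq_zero_of_tsum_exp_eq_zero (d := fun n : ℤ => G n * exp (-Real.pi * n ^ 2 / (4 * k)) -
    c * thetaCoeff h k n * exp (-Real.pi * n ^ 2 / (4 * k)))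
    (Summable.of_nonneg_of_le (fun _ => norm_nonneg _) (fun n => norm_sub_le _ _) (hs1.add hs2))
    (fun t => ?_) n
  · rw [sub_eq_zero] at key
    have h1 := mul_right_cancel₀ (Complex.exp_ne_zero _) key
    rw [hG] at h1
    simp only at h1
    rw [hcdef] at h1
    field_simp at h1 ⊢
    linear_combination h1
  · simp only [sub_mul]
    rw [(hsE _ t hs1).tsum_sub (hsE _ t hs2), sub_eq_zero, ← tsum_cuspPhase_eq_fourier hk,
      tsum_cuspPhase_eq hk hc, ← tsum_mul_left]
    refine tsum_congr fun n => ?_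
    ring

end UnimodalRank

end

section

open MeasureTheory

namespace UnimodalRank

/-! ### Expansion of the derivatives of the cotangent in the lower half plane -/

theorem summable_pow_mul_exp_neg (m : ℕ) {c : ℝ} (hc : 0 < c) :
    Summable fun n : ℕ => (n : ℝ) ^ m * Real.exp (-(c * n)) := by
  have h := Real.summable_pow_mul_exp_neg_nat_mul m hc
  refine h.congr fun n => ?_
  rw [neg_mul]

theorem norm_exp_neg_two_pi_I (n : ℕ) (w : ℂ) :
    ‖exp (-(2 * Real.pi * I * n) * w)‖ = Real.exp (2 * Real.pi * n * w.im) := by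
  rw [Complex.norm_exp]
  congr 1
  rw [show -(2 * Real.pi * I * n) * w = ((-(2 * Real.pi * n) : ℝ) : ℂ) * (I * w) by
    push_cast; ring, Complex.re_ofReal_mul, Complex.I_mul_re]
  ring

theorem hasDerivAt_tsum_pow_mul_exp (m : ℕ) {w : ℂ} (hw : w.im < 0) :
    HasDerivAt (fun u : ℂ => ∑' n : ℕ, (-(2 * Real.pi * I * n) : ℂ) ^ m *
        exp (-(2 * Real.pi * I * n) * u))
      (∑' n : ℕ, (-(2 * Real.pi * I * n) : ℂ) ^ (m + 1) * exp (-(2 * Real.pi * I * n) * w)) w := by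
  have hpi := Real.pi_pos
  -- On this half plane the terms are dominated by multiples of n^j exp(πn Im w), independently of
  -- the point.
  set t : Set ℂ := {u | u.im < w.im / 2} with ht
  have hto : IsOpen t := isOpen_lt Complex.continuous_im continuous_const
  have htc : IsPreconnected t := (convex_halfSpace_im_lt _).isPreconnected
  have hwt : w ∈ t := by
    simp only [ht, Set.mem_ofPred_eq]
    linarith
  have hc : 0 < -(Real.pi * w.im) := by nlinarith
  have hbound : ∀ (j n : ℕ) (y : ℂ), y ∈ t →
      ‖(-(2 * Real.pi * I * n) : ℂ) ^ j * exp (-(2 * Real.pi * I * n) * y)‖ ≤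
        (2 * Real.pi) ^ j * ((n : ℝ) ^ j * Real.exp (-(-(Real.pi * w.im) * n))) := by
    intro j n y hy
    simp only [ht, Set.mem_ofPred_eq] at hy
    rw [norm_mul, norm_exp_neg_two_pi_I, norm_pow]
    have h1 : ‖(-(2 * Real.pi * I * n) : ℂ)‖ = 2 * Real.pi * n := by
      simp [abs_of_pos hpi]
    rw [h1, mul_pow, mul_assoc]
    gcongr
    have : 0 ≤ Real.pi * n := by positivity
    nlinarith
  refine hasDerivAt_tsum_of_isPreconnected ((summable_pow_mul_exp_neg (m + 1) hc).mul_left _)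
    hto htc (g := fun (n : ℕ) (u : ℂ) => (-(2 * Real.pi * I * n) : ℂ) ^ m *
        exp (-(2 * Real.pi * I * n) * u)) (fun n y _ => ?_) (hbound (m + 1)) hwt ?_ hwt
  · have := ((hasDerivAt_id y).const_mul (-(2 * Real.pi * I * n) : ℂ)).cexp.const_mul
      ((-(2 * Real.pi * I * n) : ℂ) ^ m)
    convert! this using 1
    simp only [id]
    ring
  · exact Summable.of_norm_bounded ((summable_pow_mul_exp_neg m hc).mul_left _)
      fun n => hbound m n w hwt

theorem cot_pi_mul_of_im_neg {w : ℂ} (hw : w.im < 0) :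
    Complex.cot (Real.pi * w) =
      I * (2 * (∑' n : ℕ, exp (-(2 * Real.pi * I * n) * w)) - 1) := by
  have h := pi_mul_cot_pi_q_exp ⟨-w, by simpa using hw⟩
  simp only at h
  have hpi : (Real.pi : ℂ) ≠ 0 := by exact_mod_cast Real.pi_ne_zero
  have h1 : Complex.cot (Real.pi * -w) = - Complex.cot (Real.pi * w) := by
    rw [mul_neg, Complex.cot, Complex.cot, Complex.cos_neg, Complex.sin_neg, div_neg]
  rw [h1] at h
  have h2 : ∀ n : ℕ, exp (2 * Real.pi * I * -w) ^ n = exp (-(2 * Real.pi * I * n) * w) := by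
    intro n
    rw [← Complex.exp_nat_mul]
    congr 1
    ring
  simp only [h2] at h
  apply mul_left_cancel₀ hpi
  linear_combination -h

theorem iteratedDeriv_cot_pi_of_im_neg (m : ℕ) {w : ℂ} (hw : w.im < 0) :
    iteratedDeriv m (fun u : ℂ => Complex.cot (Real.pi * u)) w =
      I * (2 * (∑' n : ℕ, (-(2 * Real.pi * I * n) : ℂ) ^ m * exp (-(2 * Real.pi * I * n) * w)) -
        if m = 0 then 1 else 0) := by
  induction m generalizing w with
  | zero => simpa using cot_pi_mul_of_im_neg hw
  | succ m ih =>
    rw [iteratedDeriv_succ]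
    have hev : iteratedDeriv m (fun u : ℂ => Complex.cot (Real.pi * u)) =ᶠ[nhds w] fun w =>
        I * (2 * (∑' n : ℕ, (-(2 * Real.pi * I * n) : ℂ) ^ m *
          exp (-(2 * Real.pi * I * n) * w)) - if m = 0 then 1 else 0) := by
      filter_upwards [(isOpen_lt Complex.continuous_im continuous_const).mem_nhds hw] with u hu
      exact ih hu
    rw [hev.deriv_eq]
    rw [((((hasDerivAt_tsum_pow_mul_exp m hw).const_mul 2).sub_const _).const_mul I).deriv]
    simp

/-- For even m the sign of (-n)^m disappears. The term n = 0 counts only for m = 0, by the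
convention 0^0 = 1. -/
theorem cotDeriv_of_im_neg {m : ℕ} (hm : Even m) {w : ℂ} (hw : w.im < 0) :
    cotDeriv m w = I * (2 * (∑' n : ℕ, (n : ℂ) ^ m * exp (-(2 * Real.pi * I * n) * w)) -
        if m = 0 then 1 else 0) := by
  have hpi : (2 * Real.pi * I : ℂ) ≠ 0 := Complex.two_pi_I_ne_zero
  rw [cotDeriv, iteratedDeriv_cot_pi_of_im_neg m hw]
  have h1 : ∀ n : ℕ, (-(2 * Real.pi * I * n) : ℂ) ^ m * exp (-(2 * Real.pi * I * n) * w) =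
      (2 * Real.pi * I) ^ m * ((n : ℂ) ^ m * exp (-(2 * Real.pi * I * n) * w)) := by
    intro n
    rw [hm.neg_pow, mul_pow, mul_assoc]
  simp only [h1, tsum_mul_left]
  have h2 : (1 / (2 * Real.pi * I) : ℂ) ^ m * (2 * Real.pi * I) ^ m = 1 := by
    rw [← mul_pow, one_div_mul_cancel hpi, one_pow]
  split_ifs with h0
  · subst h0
    simp
  · linear_combination (2 * I * ∑' n : ℕ, (n : ℂ) ^ m * exp (-(2 * Real.pi * I * n) * w)) * h2

/-- The meromorphic kernel attached to a cusp. -/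
noncomputable def cuspKernel (a k m : ℕ) (v : ℂ) : ℂ :=
  ∑ ν ∈ Finset.range (2 * k), cuspPhase a k ν *
    cotDeriv m (1 / (2 * (k : ℂ)) * (v - (ν : ℂ) - 1 / 2))

theorem summable_pow_mul_exp_of_im_neg (m : ℕ) {w : ℂ} (hw : w.im < 0) :
    Summable fun n : ℕ => (n : ℂ) ^ m * exp (-(2 * Real.pi * I * n) * w) := by
  have hc : 0 < -(2 * Real.pi * w.im) := by nlinarith [Real.pi_pos]
  refine Summable.of_norm ((summable_pow_mul_exp_neg m hc).congr fun n => ?_)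
  rw [norm_mul, norm_exp_neg_two_pi_I, norm_pow, Complex.norm_natCast]
  congr 2
  ring

theorem thetaCoeff_neg_odd (h k n : ℕ) : thetaCoeff h k (-(2 * n + 1 : ℕ)) =
    -((-1) ^ n * exp (Real.pi * I * h * ((n : ℂ) + 1 / 2) ^ 2 / k)) := by
  have ho : Odd (-((2 * n + 1 : ℕ) : ℤ)) := ⟨-n - 1, by push_cast; ring⟩
  rw [thetaCoeff, if_pos ho, show (-((2 * n + 1 : ℕ) : ℤ) - 1) / 2 = -((n + 1 : ℕ) : ℤ) by
    push_cast; omega, zpow_neg, zpow_natCast, ← inv_pow, inv_neg_one, pow_succ,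
    mul_neg_one, neg_mul]
  congr 3
  push_cast
  ring

theorem thetaCoeff_neg_even (h k n : ℕ) : thetaCoeff h k (-(2 * n : ℕ)) = 0 := by
  rw [thetaCoeff, if_neg]
  rw [Int.not_odd_iff_even]
  exact ⟨-n, by push_cast; ring⟩

/-- Expanding every cotangent towards -i∞ and summing over ν turns the coefficient of each frequency
into a Gauss sum. Those of even frequency vanish, and those of odd frequency are the phases of the
theta series at h/k. -/
theorem cuspKernel_eq_tsum {h k : ℕ} (hk : 0 < k) (hc : h.Coprime k) {m : ℕ} (hm : Even m)
    {v : ℂ} (hv : v.im < 0) :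
    cuspKernel (negInv h k) k m v = ∑' n : ℕ, -(2 * I) *
      (2 * Real.sqrt k * chiHK h k ^ 3 * I ^ (1 / 2 : ℂ)) * ((-1) ^ n * (2 * n + 1) ^ m *
        exp (Real.pi * I * h * ((n : ℂ) + 1 / 2) ^ 2 / k) *
          exp (-(Real.pi * I * (2 * n + 1) / k) * v)) := by
  have hk0 : (k : ℂ) ≠ 0 := by exact_mod_cast hk.ne'
  have hk' : (0 : ℝ) < k := by exact_mod_cast hk
  have hw : ∀ ν : ℕ, (1 / (2 * (k : ℂ)) * (v - (ν : ℂ) - 1 / 2)).im < 0 := by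
    intro ν
    rw [show (1 / (2 * (k : ℂ)) * (v - (ν : ℂ) - 1 / 2)) =
      ((1 / (2 * k) : ℝ) : ℂ) * (v - ((ν + 1 / 2 : ℝ) : ℂ)) by push_cast; ring,
      Complex.im_ofReal_mul, sub_im, ofReal_im, sub_zero]
    exact mul_neg_of_pos_of_neg (by positivity) hv
  set κ : ℂ := 2 * Real.sqrt k * chiHK h k ^ 3 * I ^ (1 / 2 : ℂ) with hκ
  have hG : ∀ n : ℕ, ∑ ν ∈ Finset.range (2 * k), cuspPhase (negInv h k) k ν *
      exp (Real.pi * I * n * ((ν : ℂ) + 1 / 2) / k) = κ * thetaCoeff h k (-n) := by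
    intro n
    rw [← sum_cuspPhase_exp hk hc]
    refine Finset.sum_congr rfl fun ν _ => ?_
    congr 2
    push_cast
    ring
  -- Frequency 0 is even, so its Gauss sum vanishes; this removes the constant in the cotangent
  -- expansions.
  have h0 : ∑ ν ∈ Finset.range (2 * k), cuspPhase (negInv h k) k ν = 0 := by
    have := hG 0
    simpa [thetaCoeff] using this
  rw [cuspKernel]
  simp only [cotDeriv_of_im_neg hm (hw _)]
  have e1 : ∀ ν : ℕ, cuspPhase (negInv h k) k ν * (I * (2 * (∑' n : ℕ, (n : ℂ) ^ m *
      exp (-(2 * Real.pi * I * n) * (1 / (2 * (k : ℂ)) * (v - (ν : ℂ) - 1 / 2)))) -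
        if m = 0 then 1 else 0)) = (∑' n : ℕ, 2 * I * (n : ℂ) ^ m *
        exp (-(Real.pi * I * n / k) * v) * (cuspPhase (negInv h k) k ν *
          exp (Real.pi * I * n * ((ν : ℂ) + 1 / 2) / k))) -
        (I * if m = 0 then 1 else 0) * cuspPhase (negInv h k) k ν := by
    intro ν
    rw [mul_sub, mul_sub, ← tsum_mul_left, ← tsum_mul_left, ← tsum_mul_left]
    congr 1
    · refine tsum_congr fun n => ?_
      have : exp (-(2 * Real.pi * I * n) * (1 / (2 * (k : ℂ)) * (v - (ν : ℂ) - 1 / 2))) =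
          exp (-(Real.pi * I * n / k) * v) * exp (Real.pi * I * n * ((ν : ℂ) + 1 / 2) / k) := by
        rw [← Complex.exp_add]
        congr 1
        field_simp
        ring
      rw [this]
      ring
    · ring
  have hs : ∀ ν ∈ Finset.range (2 * k), Summable fun n : ℕ => 2 * I * (n : ℂ) ^ m *
        exp (-(Real.pi * I * n / k) * v) * (cuspPhase (negInv h k) k ν *
          exp (Real.pi * I * n * ((ν : ℂ) + 1 / 2) / k)) := by
    intro ν _
    refine ((summable_pow_mul_exp_of_im_neg m (hw ν)).mul_left
      (2 * I * cuspPhase (negInv h k) k ν)).congr fun n => ?_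
    have : exp (-(2 * Real.pi * I * n) * (1 / (2 * (k : ℂ)) * (v - (ν : ℂ) - 1 / 2))) =
        exp (-(Real.pi * I * n / k) * v) * exp (Real.pi * I * n * ((ν : ℂ) + 1 / 2) / k) := by
      rw [← Complex.exp_add]
      congr 1
      field_simp
      ring
    rw [this]
    ring
  simp only [e1]
  rw [Finset.sum_sub_distrib, ← Finset.mul_sum, h0, mul_zero, sub_zero,
    ← Summable.tsum_finsetSum hs]
  simp only [← Finset.mul_sum, hG]
  have hinj : Function.Injective fun n : ℕ => 2 * n + 1 := fun a b hab => by simpa using hab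
  rw [← hinj.tsum_eq]
  · refine tsum_congr fun n => ?_
    rw [thetaCoeff_neg_odd]
    push_cast
    ring
  · intro n hn
    by_contra hcon
    apply hn
    obtain ⟨j, rfl | rfl⟩ := Nat.even_or_odd' n
    · simp only [thetaCoeff_neg_even, mul_zero]
    · exact absurd ⟨j, rfl⟩ hcon

/-! ### Half of the theta series as a Gaussian contour integral. -/

/-- The derivatives at the origin of half of the theta function. -/
noncomputable def partialThetaMoment (m : ℕ) (τ : ℂ) : ℂ :=
  ∑' n : ℕ, (-1 : ℂ) ^ n * (2 * n + 1) ^ m * exp (Real.pi * I * ((n : ℂ) + 1 / 2) ^ 2 * τ)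

theorem integral_gaussian_line {B : ℂ} (hB : 0 < B.re) (ε : ℝ) (c : ℂ) :
    ∫ x : ℝ, exp (-Real.pi * B * ((x : ℂ) - ε * I) ^ 2) * exp (c * ((x : ℂ) - ε * I)) =
      (1 / B) ^ (1 / 2 : ℂ) * exp (c ^ 2 / (4 * Real.pi * B)) := by
  have hpi : (Real.pi : ℂ) ≠ 0 := by exact_mod_cast Real.pi_ne_zero
  have hB0 : B ≠ 0 := by rintro rfl; simp at hB
  have hb : (-Real.pi * B : ℂ).re < 0 := by
    rw [neg_mul, neg_re, Complex.re_ofReal_mul]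
    nlinarith [Real.pi_pos]
  have h := integral_cexp_quadratic hb (c + 2 * Real.pi * B * ε * I)
    (-(c * ε * I) + Real.pi * B * ε ^ 2)
  rw [show (Real.pi / -(-Real.pi * B) : ℂ) = 1 / B by field_simp] at h
  convert! h using 1
  · congr 1
    ext x
    rw [← Complex.exp_add]
    congr 1
    linear_combination (-Real.pi * B * ε ^ 2) * I_sq
  · congr 2
    field_simp
    linear_combination (-4 * Real.pi ^ 2 * B ^ 2 * ε ^ 2 ) * I_sq

theorem integrable_gaussian_line {B : ℂ} (hB : 0 < B.re) (ε : ℝ) (c : ℂ) :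
    Integrable fun x : ℝ => exp (-Real.pi * B * ((x : ℂ) - ε * I) ^ 2) *
      exp (c * ((x : ℂ) - ε * I)) := by
  have hb : (-Real.pi * B : ℂ).re < 0 := by
    rw [neg_mul, neg_re, Complex.re_ofReal_mul]
    nlinarith [Real.pi_pos]
  have h := integrable_cexp_quadratic' hb (c + 2 * Real.pi * B * ε * I)
    (-(c * ε * I) + Real.pi * B * ε ^ 2)
  refine h.congr (Filter.Eventually.of_forall fun x => ?_)
  simp only
  rw [← Complex.exp_add]
  congr 1
  linear_combination (Real.pi * B * ε ^ 2) * I_sq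

/-- The moments of the partial theta function as contour integrals against the cusp kernel. -/
theorem integral_cuspKernel {h k : ℕ} (hk : 0 < k) (hc : h.Coprime k) {m : ℕ} (hm : Even m)
    {Z : ℂ} (hZ : 0 < (1 / (k * Z)).re) {ε : ℝ} (hε : 0 < ε) :
    ∫ x : ℝ, exp (-Real.pi * (1 / (k * Z)) * ((x : ℂ) - ε * I) ^ 2) *
        cuspKernel (negInv h k) k m ((x : ℂ) - ε * I) =
      -(2 * I) * (2 * Real.sqrt k * chiHK h k ^ 3 * I ^ (1 / 2 : ℂ)) * (k * Z) ^ (1 / 2 : ℂ) *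
        partialThetaMoment m ((h : ℂ) / k + I * Z / k) := by
  have hk0 : (k : ℂ) ≠ 0 := by exact_mod_cast hk.ne'
  have hk' : (0 : ℝ) < k := by exact_mod_cast hk
  have hZ0 : Z ≠ 0 := by rintro rfl; simp at hZ
  set κ : ℂ := 2 * Real.sqrt k * chiHK h k ^ 3 * I ^ (1 / 2 : ℂ) with hκ
  set B : ℂ := 1 / (k * Z) with hB
  let c : ℕ → ℂ := fun n => -(2 * I) * κ * ((-1) ^ n * (2 * n + 1) ^ m *
        exp (Real.pi * I * h * ((n : ℂ) + 1 / 2) ^ 2 / k))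
  let F : ℕ → ℝ → ℂ := fun n x => c n * (exp (-Real.pi * B * ((x : ℂ) - ε * I) ^ 2) *
      exp (-(Real.pi * I * (2 * n + 1) / k) * ((x : ℂ) - ε * I)))
  have hint : ∀ n, Integrable (F n) := fun n => (integrable_gaussian_line hZ ε _).const_mul _
  have hnorm : ∀ n x, ‖F n x‖ = ‖c n‖ * Real.exp (-(Real.pi * (2 * n + 1) / k * ε)) *
      ‖exp (-Real.pi * B * ((x : ℂ) - ε * I) ^ 2)‖ := by
    intro n x
    change ‖c n * _‖ = _
    rw [norm_mul (c n), norm_mul (exp (-Real.pi * B * ((x : ℂ) - ε * I) ^ 2)),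
      mul_comm ‖exp (-Real.pi * B * ((x : ℂ) - ε * I) ^ 2)‖, ← mul_assoc]
    congr 2
    rw [Complex.norm_exp]
    congr 1
    rw [show -(Real.pi * I * (2 * n + 1) / k) * ((x : ℂ) - ε * I) =
      ((-(Real.pi * (2 * n + 1) / k) : ℝ) : ℂ) * (I * ((x : ℂ) - ε * I)) by push_cast; ring,
      Complex.re_ofReal_mul, Complex.I_mul_re]
    simp
  have hcn : ∀ n, ‖c n‖ = ‖(2 * I : ℂ) * κ‖ * (2 * n + 1) ^ m := by
    intro n
    simp only [c]
    rw [norm_mul (-(2 * I) * κ), neg_mul, norm_neg, norm_mul ((-1 : ℂ) ^ n * (2 * n + 1) ^ m),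
      norm_mul ((-1 : ℂ) ^ n), norm_pow, norm_neg, norm_one, one_pow, one_mul, norm_pow]
    rw [show (Real.pi * I * h * ((n : ℂ) + 1 / 2) ^ 2 / k : ℂ) =
          ((Real.pi * h * ((n : ℝ) + 1 / 2) ^ 2 / k : ℝ) : ℂ) * I by push_cast; ring,
        Complex.norm_exp_ofReal_mul_I, mul_one]
    congr 2
    rw [show (2 * (n : ℂ) + 1) = ((2 * n + 1 : ℝ) : ℂ) by push_cast; rfl, Complex.norm_real,
      Real.norm_of_nonneg (by positivity)]
  have hs1 : Summable fun n : ℕ => ‖c n‖ * Real.exp (-(Real.pi * (2 * n + 1) / k * ε)) := by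
    have hpos : 0 < Real.pi / k * ε := by positivity
    have hinj : Function.Injective fun n : ℕ => 2 * n + 1 := fun a b hab => by simpa using hab
    refine (((summable_pow_mul_exp_neg m hpos).comp_injective hinj).mul_left
      ‖(2 * I : ℂ) * κ‖).congr fun n => ?_
    simp only [Function.comp]
    rw [hcn]
    push_cast
    rw [mul_assoc ‖(2 * I : ℂ) * κ‖]
    congr 3
    ring
  have hsum : Summable fun n => ∫ x, ‖F n x‖ := by
    simp only [hnorm, integral_const_mul]
    exact hs1.mul_right _
  -- On Im v = -ε the n-th term gains exp(-π(2n+1)ε/k), which justifies the exchange. On the real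
  -- axis this factor is lost, and the kernel may have poles there.
  have hF := integral_tsum_of_summable_integral_norm hint hsum
  have e1 : ∀ x : ℝ, exp (-Real.pi * B * ((x : ℂ) - ε * I) ^ 2) *
        cuspKernel (negInv h k) k m ((x : ℂ) - ε * I) = ∑' n, F n x := by
    intro x
    rw [cuspKernel_eq_tsum hk hc hm (by simpa using hε), ← tsum_mul_left]
    refine tsum_congr fun n => ?_
    simp only [F, c]
    ring
  simp only [e1]
  rw [← hF, partialThetaMoment, ← tsum_mul_left]
  refine tsum_congr fun n => ?_
  simp only [F]
  rw [integral_const_mul, integral_gaussian_line hZ]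
  simp only [c]
  -- The second exponential, from completing the square with B = 1/(kZ), is the contribution of iZ/k
  -- to the theta exponent.
  have e2 : exp (Real.pi * I * ((n : ℂ) + 1 / 2) ^ 2 * ((h : ℂ) / k + I * Z / k)) =
      exp (Real.pi * I * h * ((n : ℂ) + 1 / 2) ^ 2 / k) *
        exp ((-(Real.pi * I * (2 * n + 1) / k)) ^ 2 / (4 * Real.pi * B)) := by
    rw [← Complex.exp_add]
    congr 1
    rw [hB]
    have hpi : (Real.pi : ℂ) ≠ 0 := by exact_mod_cast Real.pi_ne_zero
    field_simp
    ring
  rw [e2, show 1 / B = k * Z by rw [hB, one_div_one_div]]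
  ring

end UnimodalRank

end

section

namespace UnimodalRank

/-! ### Bounds for the cusp kernel -/

/-- |sin π(x + iy)|² = sin²(πx) + sinh²(πy); Jordan's inequality bounds the first square and sinh t
≥ t the second. -/
theorem two_mul_norm_le_norm_sin {u : ℂ} (hu : |u.re| ≤ 1 / 2) :
    2 * ‖u‖ ≤ ‖Complex.sin (Real.pi * u)‖ := by
  have hpi := Real.pi_pos
  have hpi3 := Real.pi_gt_three
  have h1 : ‖Complex.sin (Real.pi * u)‖ ^ 2 =
      Real.sin (Real.pi * u.re) ^ 2 + Real.sinh (Real.pi * u.im) ^ 2 := by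
    rw [Complex.sin_eq, Complex.re_ofReal_mul, Complex.im_ofReal_mul, ← ofReal_sin, ← ofReal_cos,
      ← ofReal_sinh, ← ofReal_cosh, ← ofReal_mul, ← ofReal_mul, Complex.sq_norm,
      Complex.normSq_add_mul_I]
    have := Real.cosh_sq (Real.pi * u.im)
    have h2 := Real.sin_sq_add_cos_sq (Real.pi * u.re)
    linear_combination Real.sin (Real.pi * u.re) ^ 2 * this +
      Real.sinh (Real.pi * u.im) ^ 2 * h2
  have h2 : (2 * u.re) ^ 2 ≤ Real.sin (Real.pi * u.re) ^ 2 := by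
    rw [← sq_abs, ← sq_abs (Real.sin _)]
    refine pow_le_pow_left₀ (abs_nonneg _) ?_ 2
    have h3 : ∀ x : ℝ, 0 ≤ x → x ≤ 1 / 2 → 2 * x ≤ Real.sin (Real.pi * x) := by
      intro x hx hx'
      have := Real.mul_le_sin (x := Real.pi * x) (by positivity) (by nlinarith)
      rwa [show 2 / Real.pi * (Real.pi * x) = 2 * x by field_simp] at this
    have h4 := h3 |u.re| (abs_nonneg _) hu
    rw [abs_mul, abs_two]
    refine h4.trans ?_
    rcases abs_cases u.re with ⟨h, _⟩ | ⟨h, _⟩ <;> rw [h]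
    · exact le_abs_self _
    · rw [mul_neg, Real.sin_neg]
      exact neg_le_abs _
  have h3 : (2 * u.im) ^ 2 ≤ Real.sinh (Real.pi * u.im) ^ 2 := by
    rw [← sq_abs, ← sq_abs (Real.sinh _)]
    refine pow_le_pow_left₀ (abs_nonneg _) ?_ 2
    rw [Real.abs_sinh, abs_mul, abs_mul, abs_two, abs_of_pos hpi]
    have := Real.self_le_sinh_iff.2 (show 0 ≤ Real.pi * |u.im| by positivity)
    nlinarith [abs_nonneg u.im]
  have h4 : (2 * ‖u‖) ^ 2 ≤ ‖Complex.sin (Real.pi * u)‖ ^ 2 := by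
    rw [h1, mul_pow, Complex.sq_norm, Complex.normSq_apply]
    nlinarith
  exact (sq_le_sq₀ (by positivity) (norm_nonneg _)).1 h4

theorem norm_cos_pi_mul_le {u : ℂ} (hu : |u.im| ≤ 2) :
    ‖Complex.cos (Real.pi * u)‖ ≤ Real.exp (2 * Real.pi) := by
  have h : ∀ w : ℂ, |w.im| ≤ 2 → ‖exp (Real.pi * w * I)‖ ≤ Real.exp (2 * Real.pi) := by
    intro w hw
    rw [Complex.norm_exp]
    refine Real.exp_le_exp.2 ?_
    rw [mul_assoc, Complex.re_ofReal_mul, mul_I_re]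
    nlinarith [Real.pi_pos, neg_abs_le w.im]
  rw [Complex.cos]
  rw [norm_div, Complex.norm_ofNat]
  have h1 := h u hu
  have h2 := h (-u) (by simpa using hu)
  have h3 := norm_add_le (exp (Real.pi * u * I)) (exp (-(Real.pi * u) * I))
  rw [mul_neg] at h2
  linarith

theorem norm_cot_pi_mul_le {u : ℂ} (hu : |u.im| ≤ 2) {d : ℝ} (hd : 0 < d)
    (h : ∀ n : ℤ, d ≤ ‖u - n‖) :
    Complex.sin (Real.pi * u) ≠ 0 ∧
      ‖Complex.cot (Real.pi * u)‖ ≤ Real.exp (2 * Real.pi) / (2 * d) := by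
  have h1 : |(u - (round u.re : ℤ)).re| ≤ 1 / 2 := by
    rw [sub_re, Complex.intCast_re]
    exact abs_sub_round _
  have h2 := two_mul_norm_le_norm_sin h1
  have h3 : ‖Complex.sin (Real.pi * (u - (round u.re : ℤ)))‖ = ‖Complex.sin (Real.pi * u)‖ := by
    have h5 := Complex.sin_int_mul_pi (round u.re)
    have h6 := Complex.sin_sq_add_cos_sq ((round u.re : ℤ) * (Real.pi : ℂ))
    have h7 : ‖Complex.cos ((round u.re : ℤ) * (Real.pi : ℂ))‖ = 1 := by
      rw [h5, zero_pow two_ne_zero, zero_add] at h6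
      have h8 := congrArg norm h6
      rw [norm_pow, norm_one] at h8
      exact (pow_eq_one_iff_of_nonneg (norm_nonneg _) two_ne_zero).1 h8
    rw [mul_sub, mul_comm (Real.pi : ℂ) (round u.re : ℤ), Complex.sin_sub, h5, mul_zero, sub_zero,
      norm_mul, h7, mul_one]
  rw [h3] at h2
  have h4 : 2 * d ≤ ‖Complex.sin (Real.pi * u)‖ := by linarith [h (round u.re)]
  refine ⟨fun h0 => ?_, ?_⟩
  · rw [h0, norm_zero] at h4
    linarith
  · rw [Complex.cot, norm_div]
    have := norm_cos_pi_mul_le hu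
    gcongr

theorem analyticAt_cot_pi_mul {w : ℂ} (hw : Complex.sin (Real.pi * w) ≠ 0) :
    AnalyticAt ℂ (fun u : ℂ => Complex.cot (Real.pi * u)) w := by
  have hd : Differentiable ℂ fun u : ℂ => (Real.pi : ℂ) * u := by fun_prop
  have h1 : AnalyticAt ℂ (fun u : ℂ => Complex.cos (Real.pi * u)) w :=
    (Complex.differentiable_cos.comp hd).analyticAt w
  have h2 : AnalyticAt ℂ (fun u : ℂ => Complex.sin (Real.pi * u)) w :=
    (Complex.differentiable_sin.comp hd).analyticAt w
  exact h1.div h2 hw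

theorem differentiableAt_cotDeriv (m : ℕ) {w : ℂ} (hw : ∀ n : ℤ, w ≠ n) :
    DifferentiableAt ℂ (cotDeriv m) w := by
  have hs : Complex.sin (Real.pi * w) ≠ 0 := by
    intro h0
    obtain ⟨n, hn⟩ := Complex.sin_eq_zero_iff.1 h0
    apply hw n
    have hpi : (Real.pi : ℂ) ≠ 0 := by exact_mod_cast Real.pi_ne_zero
    apply mul_left_cancel₀ hpi
    rw [hn, mul_comm]
  have h1 := AnalyticAt.iterated_deriv (analyticAt_cot_pi_mul hs) m
  rw [← iteratedDeriv_eq_iterate] at h1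
  exact h1.differentiableAt.const_mul _

/-- Cauchy's estimate on the circle of radius d/2, whose points are still at distance d/2 from the
integers. The factor 2^m it produces is absorbed by the normalisation (2π)^(-m). -/
theorem norm_cotDeriv_le (m : ℕ) {w : ℂ} (hw : |w.im| ≤ 1) {d : ℝ} (hd : 0 < d) (hd1 : d ≤ 1)
    (h : ∀ n : ℤ, d ≤ ‖w - n‖) :
    ‖cotDeriv m w‖ ≤ m.factorial * Real.exp (2 * Real.pi) / d ^ (m + 1) := by
  have hpi3 := Real.pi_gt_three
  have hball : ∀ u ∈ Metric.closedBall w (d / 2), Complex.sin (Real.pi * u) ≠ 0 ∧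
      ‖Complex.cot (Real.pi * u)‖ ≤ Real.exp (2 * Real.pi) / d := by
    intro u hu
    rw [Metric.mem_closedBall, dist_eq_norm] at hu
    have h1 : |u.im| ≤ 2 := by
      have h2 := (Complex.abs_im_le_norm (u - w)).trans hu
      rw [sub_im] at h2
      rw [abs_le] at *
      constructor <;> linarith [h2.1, h2.2, hw.1, hw.2]
    have := norm_cot_pi_mul_le h1 (half_pos hd) fun n => by
      have h3 := h n
      have h4 := norm_sub_norm_le (w - n) (w - u)
      rw [show w - n - (w - u) = u - n by ring, norm_sub_rev w u] at h4
      linarith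
    rwa [show 2 * (d / 2) = d by ring] at this
  have hdiff : DiffContOnCl ℂ (fun u : ℂ => Complex.cot (Real.pi * u)) (Metric.ball w (d / 2)) := by
    refine DifferentiableOn.diffContOnCl_ball (c := w) (R := d / 2) (U := Metric.closedBall w (d / 2))
      (fun u hu => ?_) subset_rfl
    exact (analyticAt_cot_pi_mul (hball u hu).1).differentiableAt.differentiableWithinAt
  have h1 := Complex.norm_iteratedDeriv_le_of_forall_mem_sphere_norm_le m (half_pos hd) hdiff
    fun z hz => (hball z (Metric.sphere_subset_closedBall hz)).2
  rw [cotDeriv, norm_mul]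
  have h2 : ‖(1 / (2 * Real.pi * I) : ℂ) ^ m‖ = 1 / (2 * Real.pi) ^ m := by
    rw [norm_pow, norm_div, norm_mul, norm_mul, norm_I, Complex.norm_real, Complex.norm_ofNat,
      norm_one, mul_one, Real.norm_of_nonneg Real.pi_pos.le, div_pow, one_pow]
  rw [h2]
  calc 1 / (2 * Real.pi) ^ m * ‖iteratedDeriv m (fun u : ℂ => Complex.cot (Real.pi * u)) w‖
      ≤ 1 / (2 * Real.pi) ^ m * (m.factorial * (Real.exp (2 * Real.pi) / d) / (d / 2) ^ m) := by
        gcongr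
    _ = (2 / (2 * Real.pi)) ^ m * (m.factorial * Real.exp (2 * Real.pi) / d ^ (m + 1)) := by
        rw [div_pow, div_pow, pow_succ]
        field_simp
    _ ≤ 1 * (m.factorial * Real.exp (2 * Real.pi) / d ^ (m + 1)) := by
        gcongr
        refine pow_le_one₀ (by positivity) ?_
        rw [div_le_one (by positivity)]
        linarith
    _ = _ := one_mul _

/-- The source of the logarithm in the error term. Enlarging k by one adds 1/(k+1) + 1/(k+2) ≤
3/(k+2), and 1/(k+2) ≤ log(k+2) - log(k+1). -/
theorem sum_inv_abs_le_log (k : ℕ) :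
    ∑ j ∈ Finset.Ico (-(k : ℤ)) k, 1 / ((|j| : ℤ) + 1 : ℝ) ≤ 4 * Real.log (k + 1) := by
  induction k with
  | zero => simp
  | succ k ih =>
    have h1 : Finset.Ico (-((k + 1 : ℕ) : ℤ)) ((k + 1 : ℕ) : ℤ) =
        insert (-((k + 1 : ℕ) : ℤ)) (insert (k : ℤ) (Finset.Ico (-(k : ℤ)) k)) := by
      ext j
      simp only [Finset.mem_Ico, Finset.mem_insert]
      push_cast
      omega
    rw [h1, Finset.sum_insert, Finset.sum_insert]
    · have h2 : 1 / ((k : ℝ) + 2) ≤ Real.log ((k + 1 : ℕ) + 1) - Real.log (k + 1) := by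
        rw [← Real.log_div (by positivity) (by positivity)]
        have := Real.one_sub_inv_le_log_of_pos
          (x := (((k + 1 : ℕ) : ℝ) + 1) / ((k : ℝ) + 1)) (by positivity)
        refine le_trans (le_of_eq ?_) this
        push_cast
        field_simp
        ring
      have h3 : 1 / ((|(k : ℤ)| : ℤ) + 1 : ℝ) ≤ 2 * (1 / ((k : ℝ) + 2)) := by
        rw [Nat.abs_cast]
        push_cast
        rw [mul_one_div, div_le_div_iff₀ (by positivity) (by positivity)]
        nlinarith [(Nat.cast_nonneg k : (0 : ℝ) ≤ k)]
      have h4 : 1 / ((|(-((k + 1 : ℕ) : ℤ))| : ℤ) + 1 : ℝ) = 1 / ((k : ℝ) + 2) := by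
        rw [abs_neg, Nat.abs_cast]
        push_cast
        ring_nf
      have h5 : 0 ≤ 1 / ((k : ℝ) + 2) := by positivity
      rw [h4]
      linarith
    · simp
    · simp only [Finset.mem_insert, Finset.mem_Ico]
      push_cast
      omega

theorem differentiableAt_cuspKernel (a : ℕ) {k : ℕ} (hk : 0 < k) (m : ℕ) {v : ℂ}
    (hv : ∀ n : ℤ, v ≠ n + 1 / 2) : DifferentiableAt ℂ (cuspKernel a k m) v := by
  have hk0 : (k : ℂ) ≠ 0 := by exact_mod_cast hk.ne'
  unfold cuspKernel
  refine DifferentiableAt.fun_sum fun ν _ => ?_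
  refine DifferentiableAt.const_mul ?_ _
  refine DifferentiableAt.fun_comp' (g := cotDeriv m) v
    (differentiableAt_cotDeriv m fun n hn => ?_) (by fun_prop)
  apply hv (ν + 2 * k * n)
  push_cast
  field_simp at hn
  linear_combination hn / 2

/-- The ν-th summand has its poles in ν + 1/2 + 2kℤ. With `J ν` the residue of ν - ⌊Re v⌋ in [-k,
k), these are at distance at least |J ν|/2 from v, so only the summand with J ν = 0 feels d, and the
others add up like a harmonic sum. -/
theorem norm_cuspKernel_le (a : ℕ) {k : ℕ} (hk : 0 < k) (m : ℕ) {v : ℂ} (hv : |v.im| ≤ 1)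
    {d : ℝ} (hd : 0 < d) (hd1 : d ≤ 1) (h : ∀ n : ℤ, d ≤ ‖v - n - 1 / 2‖) :
    ‖cuspKernel a k m v‖ ≤ m.factorial * Real.exp (2 * Real.pi) * 16 * 4 ^ (m + 1) *
      (k : ℝ) ^ (m + 1) * Real.log (k + 1) / d ^ (m + 1) := by
  have hk' : (1 : ℝ) ≤ k := by exact_mod_cast hk
  have hk0 : (k : ℂ) ≠ 0 := by exact_mod_cast hk.ne'
  set N : ℤ := ⌊v.re⌋ with hN
  let J : ℕ → ℤ := fun ν => ((ν : ℤ) - N + k) % (2 * k) - k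
  have hJ1 : ∀ ν, -(k : ℤ) ≤ J ν ∧ J ν < k := by
    intro ν
    have h1 := Int.emod_nonneg ((ν : ℤ) - N + k) (show (2 * k : ℤ) ≠ 0 by omega)
    have h2 := Int.emod_lt_of_pos ((ν : ℤ) - N + k) (show (0 : ℤ) < 2 * k by omega)
    simp only [J]
    omega
  have hJ2 : ∀ ν : ℕ, ∃ n : ℤ, (ν : ℤ) = N + J ν + 2 * k * n := by
    intro ν
    refine ⟨((ν : ℤ) - N + k) / (2 * k), ?_⟩
    have := Int.emod_add_mul_ediv ((ν : ℤ) - N + k) (2 * k)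
    simp only [J]
    linarith
  have hJ3 : Set.InjOn J (Finset.range (2 * k)) := by
    intro x hx y hy hxy
    simp only [Finset.coe_range, Set.mem_Iio] at hx hy
    simp only [J] at hxy
    have h1 : ((x : ℤ) - N + k) % (2 * k) = ((y : ℤ) - N + k) % (2 * k) := by linarith
    have h3 : (x : ℤ) ≡ y [ZMOD (2 * k)] := by
      have h4 : (x : ℤ) - N + k ≡ (y : ℤ) - N + k [ZMOD (2 * k)] := h1
      have h5 := h4.add_right (N - k)
      ring_nf at h5
      rw [mul_comm]
      exact h5
    have h4 : (x : ℤ) % (2 * k) = (y : ℤ) % (2 * k) := h3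
    rw [Int.emod_eq_of_lt (by omega) (by omega), Int.emod_eq_of_lt (by omega) (by omega)] at h4
    exact_mod_cast h4
  set M : ℝ := m.factorial * Real.exp (2 * Real.pi) with hM
  have hM0 : 0 ≤ M := by positivity
  have hterm : ∀ ν ∈ Finset.range (2 * k), ‖cuspPhase a k ν * cotDeriv m
      (1 / (2 * (k : ℂ)) * (v - (ν : ℂ) - 1 / 2))‖ ≤
      M * (4 * 4 ^ (m + 1) * (k : ℝ) ^ (m + 1) / d ^ (m + 1)) * (1 / ((|J ν| : ℤ) + 1 : ℝ)) := by
    intro ν _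
    rw [norm_mul, norm_cuspPhase, one_mul]
    obtain ⟨n₀, hn₀⟩ := hJ2 ν
    have him : |(1 / (2 * (k : ℂ)) * (v - (ν : ℂ) - 1 / 2)).im| ≤ 1 := by
      rw [show (1 / (2 * (k : ℂ)) * (v - (ν : ℂ) - 1 / 2)) =
        ((1 / (2 * k) : ℝ) : ℂ) * (v - ((ν + 1 / 2 : ℝ) : ℂ)) by push_cast; ring,
        Complex.im_ofReal_mul, sub_im, ofReal_im, sub_zero, abs_mul]
      refine mul_le_one₀ ?_ (abs_nonneg _) hv
      rw [abs_of_pos (by positivity), div_le_one (by positivity)]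
      linarith
    have hdist : ∀ n : ℤ, ‖1 / (2 * (k : ℂ)) * (v - (ν : ℂ) - 1 / 2) - n‖ =
        1 / (2 * k) * ‖v - ((N + J ν + 2 * k * (n₀ + n) : ℤ) : ℂ) - 1 / 2‖ := by
      intro n
      have e1 : (ν : ℂ) = ((N + J ν + 2 * k * n₀ : ℤ) : ℂ) := by
        rw [← hn₀]
        simp
      rw [e1, show 1 / (2 * (k : ℂ)) * (v - ((N + J ν + 2 * k * n₀ : ℤ) : ℂ) - 1 / 2) - n =
        ((1 / (2 * k) : ℝ) : ℂ) * (v - ((N + J ν + 2 * k * (n₀ + n) : ℤ) : ℂ) - 1 / 2) by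
          push_cast
          field_simp
          ring, norm_mul, Complex.norm_real, Real.norm_of_nonneg (by positivity)]
    have hdpow : 0 < d ^ (m + 1) := by positivity
    by_cases hj : J ν = 0
    · have h1 := norm_cotDeriv_le m him (d := d / (2 * k)) (by positivity)
        (by rw [div_le_one (by positivity)]; linarith) fun n => by
          rw [hdist, div_eq_inv_mul, one_div]
          exact mul_le_mul_of_nonneg_left (h _) (by positivity)
      refine h1.trans ?_
      rw [hj]
      simp only [abs_zero, Int.cast_zero, zero_add, div_one, mul_one]
      rw [div_pow, div_div_eq_mul_div, ← hM, ← mul_div_assoc, mul_pow]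
      gcongr
      nlinarith [show (2 : ℝ) ^ (m + 1) ≤ 4 ^ (m + 1) by gcongr; norm_num,
        show (0 : ℝ) ≤ k ^ (m + 1) by positivity, show (0 : ℝ) ≤ 4 ^ (m + 1) by positivity]
    · have hj1 : (1 : ℝ) ≤ |(J ν : ℝ)| := by
        have : 1 ≤ |J ν| := Int.one_le_abs hj
        exact_mod_cast this
      have hjk : |(J ν : ℝ)| ≤ k := by
        have : |J ν| ≤ k := abs_le.2 ⟨(hJ1 ν).1, (hJ1 ν).2.le⟩
        exact_mod_cast this
      have h1 := norm_cotDeriv_le m him (d := |(J ν : ℝ)| / (4 * k)) (by positivity)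
        (by rw [div_le_one (by positivity)]; linarith) fun n => by
          rw [hdist]
          have h2 : |(J ν : ℝ)| ≤ |((J ν + 2 * k * (n₀ + n) : ℤ) : ℝ)| := by
            have : |J ν| ≤ |J ν + 2 * k * (n₀ + n)| := by
              obtain ⟨h5, h6⟩ := hJ1 ν
              rcases lt_trichotomy (n₀ + n) 0 with h7 | h7 | h7
              · have : 2 * (k : ℤ) * (n₀ + n) ≤ 2 * k * (-1) := by
                  apply mul_le_mul_of_nonneg_left <;> omega
                rw [abs_of_nonpos (show J ν + 2 * k * (n₀ + n) ≤ 0 by omega), abs_le]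
                constructor <;> omega
              · rw [h7]
                simp
              · have : 2 * (k : ℤ) * 1 ≤ 2 * k * (n₀ + n) := by
                  apply mul_le_mul_of_nonneg_left <;> omega
                rw [abs_of_nonneg (show 0 ≤ J ν + 2 * k * (n₀ + n) by omega), abs_le]
                constructor <;> omega
            exact_mod_cast this
          have h3 : |((J ν + 2 * k * (n₀ + n) : ℤ) : ℝ)| - 1 / 2 ≤
              ‖v - ((N + J ν + 2 * k * (n₀ + n) : ℤ) : ℂ) - 1 / 2‖ := by
            refine le_trans ?_ (Complex.abs_re_le_norm _)
            have e1 : (v - ((N + J ν + 2 * k * (n₀ + n) : ℤ) : ℂ) - 1 / 2).re =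
                (v.re - N - 1 / 2) - ((J ν + 2 * k * (n₀ + n) : ℤ) : ℝ) := by
              rw [show (1 / 2 : ℂ) = ((1 / 2 : ℝ) : ℂ) by push_cast; rfl, sub_re, sub_re,
                Complex.intCast_re, ofReal_re]
              push_cast
              ring
            have h8 : |v.re - N - 1 / 2| ≤ 1 / 2 := by
              have h9 := Int.floor_le v.re
              have h10 := Int.lt_floor_add_one v.re
              rw [abs_le]
              constructor <;> linarith
            rw [e1, abs_sub_comm]
            have h11 := abs_sub_abs_le_abs_sub ((J ν + 2 * k * (n₀ + n) : ℤ) : ℝ)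
              (v.re - N - 1 / 2)
            linarith
          rw [show |(J ν : ℝ)| / (4 * k) = 1 / (2 * k) * (|(J ν : ℝ)| / 2) by field_simp; norm_num]
          refine mul_le_mul_of_nonneg_left ?_ (by positivity)
          linarith
      refine h1.trans ?_
      rw [div_pow, div_div_eq_mul_div, ← hM]
      -- Of the decay |J ν|^(-m-1) only the first power is kept, which treats all m alike at the
      -- price of a logarithm.
      have h2 : |(J ν : ℝ)| ≤ |(J ν : ℝ)| ^ (m + 1) := le_self_pow₀ hj1 (by omega)
      have h3 : d ^ (m + 1) ≤ 1 := pow_le_one₀ hd.le hd1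
      rw [show ((|J ν| : ℤ) : ℝ) = |(J ν : ℝ)| by push_cast; rfl, mul_div_assoc, mul_assoc M]
      refine mul_le_mul_of_nonneg_left ?_ hM0
      rw [mul_pow, div_mul_div_comm, mul_one, div_le_div_iff₀ (by positivity) (by positivity)]
      have h4 : d ^ (m + 1) * (|(J ν : ℝ)| + 1) ≤ 4 * |(J ν : ℝ)| ^ (m + 1) := by
        calc d ^ (m + 1) * (|(J ν : ℝ)| + 1) ≤ 1 * (|(J ν : ℝ)| + 1) := by gcongr
          _ ≤ _ := by linarith
      calc (4 : ℝ) ^ (m + 1) * k ^ (m + 1) * (d ^ (m + 1) * (|(J ν : ℝ)| + 1))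
          ≤ 4 ^ (m + 1) * k ^ (m + 1) * (4 * |(J ν : ℝ)| ^ (m + 1)) := by gcongr
        _ = _ := by ring
  rw [cuspKernel]
  refine (norm_sum_le _ _).trans ((Finset.sum_le_sum hterm).trans ?_)
  rw [← Finset.mul_sum]
  have hsum : ∑ ν ∈ Finset.range (2 * k), 1 / ((|J ν| : ℤ) + 1 : ℝ) ≤ 4 * Real.log (k + 1) := by
    rw [← Finset.sum_image (f := fun j : ℤ => 1 / ((|j| : ℤ) + 1 : ℝ)) hJ3]
    refine (Finset.sum_le_sum_of_subset_of_nonneg (fun j hj => ?_) fun j _ _ => ?_).trans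
      (sum_inv_abs_le_log k)
    · obtain ⟨ν, _, rfl⟩ := Finset.mem_image.1 hj
      exact Finset.mem_Ico.2 (hJ1 ν)
    · positivity
  calc M * (4 * 4 ^ (m + 1) * (k : ℝ) ^ (m + 1) / d ^ (m + 1)) *
        ∑ ν ∈ Finset.range (2 * k), 1 / ((|J ν| : ℤ) + 1 : ℝ)
      ≤ M * (4 * 4 ^ (m + 1) * (k : ℝ) ^ (m + 1) / d ^ (m + 1)) * (4 * Real.log (k + 1)) := by
        gcongr
    _ = _ := by ring

end UnimodalRank

end

section

open MeasureTheory Filter Topology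

namespace UnimodalRank

/-! ### Gaussian contour integrals of functions with poles at the half integers -/

/-- Cauchy's theorem for a rectangle, solved for one horizontal side. -/
theorem integral_horizontal_eq {f : ℂ → ℂ} {a b c d : ℝ}
    (hf : ∀ x ∈ Set.uIcc a b, ∀ y ∈ Set.uIcc c d, DifferentiableAt ℂ f (x + y * I)) :
    ∫ x in a..b, f (x + c * I) = (∫ x in a..b, f (x + d * I)) -
      I * (∫ y in c..d, f (b + y * I)) + I * ∫ y in c..d, f (a + y * I) := by
  have h := Complex.integral_boundary_rect_eq_zero_of_differentiableOn f (a + c * I) (b + d * I)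
    (fun v hv => by
      have h1 := hf v.re (by simpa using hv.1) v.im (by simpa using hv.2)
      rw [Complex.re_add_im] at h1
      exact h1.differentiableWithinAt)
  simp only [add_re, ofReal_re, mul_re, I_re, mul_zero, ofReal_im, I_im, mul_one, sub_self,
    add_zero, add_im, mul_im, zero_add, smul_eq_mul] at h
  linear_combination h

theorem intervalIntegrable_horizontal {f : ℂ → ℂ} {a b y : ℝ}
    (hf : ∀ x ∈ Set.uIcc a b, DifferentiableAt ℂ f (x + y * I)) :
    IntervalIntegrable (fun x : ℝ => f (x + y * I)) volume a b := by
  refine ContinuousOn.intervalIntegrable fun x hx => ?_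
  have h1 : ContinuousAt (fun x : ℝ => (x : ℂ) + y * I) x := by fun_prop
  exact (ContinuousAt.comp (g := f) (f := fun x : ℝ => (x : ℂ) + y * I)
    (hf x hx).continuousAt h1).continuousWithinAt

theorem intervalIntegrable_vertical {f : ℂ → ℂ} {x c d : ℝ}
    (hf : ∀ y ∈ Set.uIcc c d, DifferentiableAt ℂ f (x + y * I)) :
    IntervalIntegrable (fun y : ℝ => f (x + y * I)) volume c d := by
  refine ContinuousOn.intervalIntegrable fun y hy => ?_
  have h1 : ContinuousAt (fun y : ℝ => (x : ℂ) + y * I) y := by fun_prop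
  exact (ContinuousAt.comp (g := f) (f := fun y : ℝ => (x : ℂ) + y * I)
    (hf y hy).continuousAt h1).continuousWithinAt

theorem norm_intervalIntegral_le {g : ℝ → ℂ} {a b Q : ℝ} (hab : a ≤ b)
    (h : ∀ x, a ≤ x → x ≤ b → ‖g x‖ ≤ Q) : ‖∫ x in a..b, g x‖ ≤ Q * (b - a) := by
  have := intervalIntegral.norm_integral_le_of_norm_le_const (f := g) (a := a) (b := b) (C := Q)
    fun x hx => by
      rw [Set.uIoc_of_le hab] at hx
      exact h x hx.1.le hx.2
  rwa [abs_of_nonneg (sub_nonneg.2 hab)] at this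

theorem norm_integral_horizontal_le_of_below {f : ℂ → ℂ} {a b c d Q : ℝ} (hab : a ≤ b)
    (hcd : c ≤ d)
    (hf : ∀ x, a ≤ x → x ≤ b → ∀ y, c ≤ y → y ≤ d → DifferentiableAt ℂ f (x + y * I))
    (h1 : ∀ x : ℝ, a ≤ x → x ≤ b → ‖f (x + c * I)‖ ≤ Q)
    (h2 : ∀ y : ℝ, c ≤ y → y ≤ d → ‖f (a + y * I)‖ ≤ Q)
    (h3 : ∀ y : ℝ, c ≤ y → y ≤ d → ‖f (b + y * I)‖ ≤ Q) :
    ‖∫ x in a..b, f (x + d * I)‖ ≤ Q * (b - a + 2 * (d - c)) := by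
  have h := integral_horizontal_eq (f := f) (a := a) (b := b) (c := c) (d := d) fun x hx y hy => by
    rw [Set.uIcc_of_le hab] at hx
    rw [Set.uIcc_of_le hcd] at hy
    exact hf x hx.1 hx.2 y hy.1 hy.2
  have h4 : ∫ x in a..b, f (x + d * I) = (∫ x in a..b, f (x + c * I)) +
      I * (∫ y in c..d, f (b + y * I)) - I * ∫ y in c..d, f (a + y * I) := by
    linear_combination -h
  rw [h4]
  have h5 := norm_sub_le ((∫ x in a..b, f (x + c * I)) + I * (∫ y in c..d, f (b + y * I)))
    (I * ∫ y in c..d, f (a + y * I))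
  have h6 := norm_add_le (∫ x in a..b, f (x + c * I)) (I * (∫ y in c..d, f (b + y * I)))
  have h7 := norm_intervalIntegral_le hab h1
  have h8 := norm_intervalIntegral_le hcd h2
  have h9 := norm_intervalIntegral_le hcd h3
  rw [norm_mul, norm_I, one_mul] at h5 h6
  linarith

/-- The line Im v = -ε passes just below p. Cauchy's theorem on the rectangles to the left of, to
the right of and above the square of half-side ε around p moves it to Im v = η; what stays behind is
the boundary of the square, of length 8ε. No residue is computed. -/
theorem norm_integral_horizontal_le_of_pole {f : ℂ → ℂ} {a b p ε η Q R : ℝ} (hε : 0 < ε)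
    (hεη : ε ≤ η) (hap : a ≤ p - ε) (hpb : p + ε ≤ b)
    (hf : ∀ x y : ℝ, a ≤ x → x ≤ b → (x : ℂ) + y * I ≠ p → DifferentiableAt ℂ f (x + y * I))
    (h1 : ∀ x : ℝ, a ≤ x → x ≤ b → ‖f (x + η * I)‖ ≤ Q)
    (h2 : ∀ y : ℝ, -ε ≤ y → y ≤ η → ‖f (a + y * I)‖ ≤ Q)
    (h3 : ∀ y : ℝ, -ε ≤ y → y ≤ η → ‖f (b + y * I)‖ ≤ Q)
    (h4 : ∀ x : ℝ, p - ε ≤ x → x ≤ p + ε → ‖f (x + (-ε : ℝ) * I)‖ ≤ R ∧ ‖f (x + ε * I)‖ ≤ R)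
    (h5 : ∀ y : ℝ, -ε ≤ y → y ≤ ε →
      ‖f ((p - ε : ℝ) + y * I)‖ ≤ R ∧ ‖f ((p + ε : ℝ) + y * I)‖ ≤ R) :
    ‖∫ x in a..b, f (x + (-ε : ℝ) * I)‖ ≤ Q * (b - a + 2 * (η + ε)) + R * (8 * ε) := by
  have hab : a ≤ b := by linarith
  have hneim : ∀ x y : ℝ, y ≠ 0 → (x : ℂ) + y * I ≠ p := by
    intro x y hy h
    have := congrArg Complex.im h
    simp at this
    exact hy this
  have hnere : ∀ x y : ℝ, x ≠ p → (x : ℂ) + y * I ≠ p := by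
    intro x y hy h
    have := congrArg Complex.re h
    simp at this
    exact hy this
  have r1 := integral_horizontal_eq (f := f) (a := a) (b := p - ε) (c := -ε) (d := η)
    fun x hx y _ => by
      rw [Set.uIcc_of_le hap] at hx
      exact hf x y hx.1 (by linarith [hx.2]) (hnere x y (by linarith [hx.2] : x < p).ne)
  have r2 := integral_horizontal_eq (f := f) (a := p + ε) (b := b) (c := -ε) (d := η)
    fun x hx y _ => by
      rw [Set.uIcc_of_le hpb] at hx
      exact hf x y (by linarith [hx.1]) hx.2 (hnere x y (by linarith [hx.1] : p < x).ne')
  have r3 := integral_horizontal_eq (f := f) (a := p - ε) (b := p + ε) (c := ε) (d := η)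
    fun x hx y hy => by
      rw [Set.uIcc_of_le (by linarith)] at hx
      rw [Set.uIcc_of_le hεη] at hy
      exact hf x y (by linarith [hx.1]) (by linarith [hx.2]) (hneim x y (by linarith [hy.1]))
  have hH : ∀ y : ℝ, y ≠ 0 → ∀ s t : ℝ, a ≤ s → s ≤ t → t ≤ b →
      IntervalIntegrable (fun x : ℝ => f (x + y * I)) volume s t := by
    intro y hy s t hs hst ht
    refine intervalIntegrable_horizontal fun x hx => ?_
    rw [Set.uIcc_of_le hst] at hx
    exact hf x y (by linarith [hx.1]) (by linarith [hx.2]) (hneim x y hy)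
  have hV : ∀ x : ℝ, x ≠ p → a ≤ x → x ≤ b → ∀ s t : ℝ,
      IntervalIntegrable (fun y : ℝ => f (x + y * I)) volume s t := by
    intro x hx ha hb s t
    exact intervalIntegrable_vertical fun y _ => hf x y ha hb (hnere x y hx)
  have s1 : ∀ y : ℝ, y ≠ 0 → ∫ x in a..b, f (x + y * I) = (∫ x in a..(p - ε), f (x + y * I)) +
      (∫ x in (p - ε)..(p + ε), f (x + y * I)) + ∫ x in (p + ε)..b, f (x + y * I) := by
    intro y hy
    rw [intervalIntegral.integral_add_adjacent_intervals
      (hH y hy _ _ le_rfl hap (by linarith)) (hH y hy _ _ hap (by linarith) hpb),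
      intervalIntegral.integral_add_adjacent_intervals
      (hH y hy _ _ le_rfl (by linarith) hpb) (hH y hy _ _ (by linarith) hpb le_rfl)]
  have s2 : ∀ x : ℝ, x ≠ p → a ≤ x → x ≤ b → ∫ y in (-ε)..η, f (x + y * I) =
      (∫ y in (-ε)..ε, f (x + y * I)) + ∫ y in ε..η, f (x + y * I) := by
    intro x hx ha hb
    rw [intervalIntegral.integral_add_adjacent_intervals (hV x hx ha hb _ _) (hV x hx ha hb _ _)]
  have t1 := s2 (p - ε) (by linarith) hap (by linarith)
  have t2 := s2 (p + ε) (by linarith) (by linarith) hpb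
  have key : ∫ x in a..b, f (x + (-ε : ℝ) * I) = (∫ x in a..b, f (x + η * I)) +
      I * (∫ y in (-ε)..η, f (a + y * I)) - I * (∫ y in (-ε)..η, f (b + y * I)) +
      (∫ x in (p - ε)..(p + ε), f (x + (-ε : ℝ) * I)) -
      (∫ x in (p - ε)..(p + ε), f (x + ε * I)) -
      I * (∫ y in (-ε)..ε, f ((p - ε : ℝ) + y * I)) +
      I * (∫ y in (-ε)..ε, f ((p + ε : ℝ) + y * I)) := by
    rw [s1 (-ε) (by linarith), s1 η (by linarith)]
    linear_combination r1 + r2 + r3 - I * t1 + I * t2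
  rw [key]
  have b1 := norm_intervalIntegral_le hab h1
  have b2 := norm_intervalIntegral_le (by linarith) h2
  have b3 := norm_intervalIntegral_le (by linarith) h3
  have b4 := norm_intervalIntegral_le (a := p - ε) (b := p + ε) (by linarith)
    fun x hx hx' => (h4 x hx hx').1
  have b5 := norm_intervalIntegral_le (a := p - ε) (b := p + ε) (by linarith)
    fun x hx hx' => (h4 x hx hx').2
  have b6 := norm_intervalIntegral_le (a := -ε) (b := ε) (by linarith)
    fun x hx hx' => (h5 x hx hx').1
  have b7 := norm_intervalIntegral_le (a := -ε) (b := ε) (by linarith)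
    fun x hx hx' => (h5 x hx hx').2
  refine (norm_add_le _ _).trans ?_
  refine (add_le_add_left (norm_sub_le _ _) _).trans ?_
  refine (add_le_add_left (add_le_add_left (norm_sub_le _ _) _) _).trans ?_
  refine (add_le_add_left (add_le_add_left (add_le_add_left (norm_add_le _ _) _) _) _).trans ?_
  refine (add_le_add_left (add_le_add_left (add_le_add_left (add_le_add_left
    (norm_sub_le _ _) _) _) _) _).trans ?_
  refine (add_le_add_left (add_le_add_left (add_le_add_left (add_le_add_left (add_le_add_left
    (norm_add_le _ _) _) _) _) _) _).trans ?_
  simp only [norm_mul, norm_I, one_mul]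
  linarith

/-- The exponent has real part π(Re B (1/6 - s² + y²) + 2 Im B · sy). The bound 9/20 exceeds 1/√6 by
enough that the first term stays negative for y² ≤ 1/64, and the cross term is either nonpositive or
at most |s|/20. Exponential decay in |s| suffices for summing over unit intervals. -/
theorem norm_exp_gauss_le {B : ℂ} (hB : 1 / 2 ≤ B.re) {s y : ℝ} (hs : 9 / 20 ≤ |s|)
    (hy : |y| ≤ 1 / 8) (h : B.im * s * y ≤ 0 ∨ |y| ≤ 1 / (40 * ‖B‖)) :
    ‖exp (Real.pi * B * (1 / 6 - ((s : ℂ) + y * I) ^ 2))‖ ≤ Real.exp (2 - |s| / 2) := by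
  have hBpos : 0 < ‖B‖ := lt_of_lt_of_le (by linarith) (Complex.re_le_norm B)
  rw [Complex.norm_exp]
  refine Real.exp_le_exp.2 ?_
  have e1 : (Real.pi * B * (1 / 6 - ((s : ℂ) + y * I) ^ 2)).re =
      Real.pi * (B.re * (1 / 6 - s ^ 2 + y ^ 2) + 2 * (B.im * s * y)) := by
    have : (1 / 6 - ((s : ℂ) + y * I) ^ 2) =
        ((1 / 6 - s ^ 2 + y ^ 2 : ℝ) : ℂ) + ((-(2 * s * y) : ℝ) : ℂ) * I := by
      push_cast
      linear_combination (-(y : ℂ) ^ 2) * I_sq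
    rw [this, mul_assoc, Complex.re_ofReal_mul, mul_re]
    simp only [add_re, add_im, ofReal_re, ofReal_im, re_ofReal_mul, im_ofReal_mul, I_re, I_im,
      mul_zero, mul_one, add_zero, zero_add]
    ring
  rw [e1]
  have hy2 : y ^ 2 ≤ 1 / 64 := by
    rw [← sq_abs]
    nlinarith [abs_nonneg y]
  have hs2 : s ^ 2 = |s| ^ 2 := (sq_abs s).symm
  have h1 : B.im * s * y ≤ |s| / 40 := by
    rcases h with h | h
    · linarith [abs_nonneg s]
    · refine (le_abs_self _).trans ?_
      rw [abs_mul, abs_mul]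
      calc |B.im| * |s| * |y| ≤ ‖B‖ * |s| * (1 / (40 * ‖B‖)) := by
            gcongr
            exact Complex.abs_im_le_norm B
        _ = |s| / 40 := by field_simp
  rw [hs2]
  set t := |s| with ht
  have h2 : B.re * (1 / 6 - t ^ 2 + y ^ 2) ≤ 1 / 2 * (1 / 6 - t ^ 2 + 1 / 64) := by
    have h3 : 1 / 6 - t ^ 2 + y ^ 2 ≤ 0 := by nlinarith
    nlinarith
  have h3 : Real.pi * (B.re * (1 / 6 - t ^ 2 + y ^ 2) + 2 * (B.im * s * y)) ≤
      Real.pi * (1 / 2 * (1 / 6 - t ^ 2 + 1 / 64) + t / 20) := by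
    refine mul_le_mul_of_nonneg_left ?_ Real.pi_pos.le
    linarith
  refine h3.trans ?_
  have hp1 := Real.pi_gt_three
  have hp2 := Real.pi_lt_d2
  have h4 : 0 ≤ t ^ 2 / 2 - t / 20 - 1 / 2 * (1 / 6 + 1 / 64) + 1 / 10 := by
    nlinarith [sq_nonneg (t - 1 / 20)]
  nlinarith [mul_le_mul_of_nonneg_right hp1.le h4, sq_nonneg (t - 1 / 5)]

theorem im_le_norm_sub_half (x y : ℝ) (n : ℤ) : |y| ≤ ‖(x : ℂ) + y * I - n - 1 / 2‖ := by
  refine le_trans (le_of_eq ?_) (Complex.abs_im_le_norm _)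
  rw [show (x : ℂ) + y * I - n - 1 / 2 = ((x - n - 1 / 2 : ℝ) : ℂ) + y * I by push_cast; ring]
  simp

theorem re_le_norm_sub_half {x d : ℝ} (y : ℝ) {n₀ : ℤ} (h1 : d ≤ x - n₀ - 1 / 2)
    (h2 : x - n₀ - 1 / 2 ≤ 1 - d) (n : ℤ) : d ≤ ‖(x : ℂ) + y * I - n - 1 / 2‖ := by
  refine le_trans ?_ (Complex.abs_re_le_norm _)
  rw [show (x : ℂ) + y * I - n - 1 / 2 = ((x - n - 1 / 2 : ℝ) : ℂ) + y * I by push_cast; ring]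
  simp only [add_re, ofReal_re, mul_re, I_re, mul_zero, ofReal_im, I_im, mul_one, sub_self,
    add_zero]
  rcases le_or_gt n n₀ with h | h
  · have : (n : ℝ) ≤ n₀ := by exact_mod_cast h
    exact le_trans (by linarith) (le_abs_self _)
  · have : (n₀ : ℝ) + 1 ≤ n := by exact_mod_cast h
    exact le_trans (by linarith) (neg_le_abs _)

/-! ### Functions with poles at the half-integers, one unit interval at a time. -/

/-- A function with singularities at most at the half integers, of size at most `M / d ^ (m + 1)`
at distance `d`. -/
structure HalfIntegerPoles (K : ℂ → ℂ) (m : ℕ) (M : ℝ) : Prop where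
  differentiableAt : ∀ v : ℂ, (∀ n : ℤ, v ≠ n + 1 / 2) → DifferentiableAt ℂ K v
  norm_le : ∀ v : ℂ, |v.im| ≤ 1 → ∀ d : ℝ, 0 < d → d ≤ 1 → (∀ n : ℤ, d ≤ ‖v - n - 1 / 2‖) →
    ‖K v‖ ≤ M / d ^ (m + 1)

/-- The integrand `exp (π B (1 / 6 - v ^ 2)) K v`. -/
noncomputable def gaussMul (B : ℂ) (K : ℂ → ℂ) (v : ℂ) : ℂ :=
  exp (Real.pi * B * (1 / 6 - v ^ 2)) * K v

theorem HalfIntegerPoles.nonneg {K : ℂ → ℂ} {m : ℕ} {M : ℝ} (hK : HalfIntegerPoles K m M) :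
    0 ≤ M := by
  have h := hK.norm_le 0 (by simp) (1 / 2) (by norm_num) (by norm_num) fun n => by
    have := re_le_norm_sub_half (x := 0) (d := 1 / 2) 0 (n₀ := -1) (by norm_num) (by norm_num) n
    simpa using this
  have h1 := (norm_nonneg _).trans h
  by_contra hM
  have : M / (1 / 2) ^ (m + 1) < 0 := div_neg_of_neg_of_pos (not_le.1 hM) (by positivity)
  linarith

theorem HalfIntegerPoles.differentiableAt_gaussMul {K : ℂ → ℂ} {m : ℕ} {M : ℝ}
    (hK : HalfIntegerPoles K m M) (B : ℂ) {v : ℂ} (hv : ∀ n : ℤ, v ≠ n + 1 / 2) :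
    DifferentiableAt ℂ (gaussMul B K) v := by
  unfold gaussMul
  have := hK.differentiableAt v hv
  fun_prop

theorem HalfIntegerPoles.norm_gaussMul_le {K : ℂ → ℂ} {m : ℕ} {M : ℝ}
    (hK : HalfIntegerPoles K m M) {B : ℂ} (hB : 1 / 2 ≤ B.re) {s y : ℝ} {L d : ℝ}
    (hL : 9 / 20 ≤ L) (hs : L ≤ |s|)
    (hy : |y| ≤ 1 / 8) (h : B.im * s * y ≤ 0 ∨ |y| ≤ 1 / (40 * ‖B‖)) (hd : 0 < d) (hd1 : d ≤ 1)
    (hn : ∀ n : ℤ, d ≤ ‖(s : ℂ) + y * I - n - 1 / 2‖) :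
    ‖gaussMul B K (s + y * I)‖ ≤ Real.exp (2 - L / 2) * (M / d ^ (m + 1)) := by
  rw [gaussMul, norm_mul]
  refine mul_le_mul ?_ ?_ (norm_nonneg _) (Real.exp_pos _).le
  · refine (norm_exp_gauss_le hB (hL.trans hs) hy h).trans (Real.exp_le_exp.2 ?_)
    linarith
  · refine hK.norm_le _ ?_ d hd hd1 hn
    simp
    linarith

/-- The contribution of an interval of length one around a pole, when the contour may be moved
away from the pole. -/
theorem HalfIntegerPoles.norm_integral_tile_le_of_down {K : ℂ → ℂ} {m : ℕ} {M : ℝ}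
    (hK : HalfIntegerPoles K m M) {B : ℂ} (hB : 1 / 2 ≤ B.re) (n₀ : ℤ) {u L : ℝ}
    (hu : 1 / 20 ≤ u) (hu1 : u ≤ 19 / 20) (hL : 9 / 20 ≤ L)
    (hs : ∀ s : ℝ, n₀ + 1 / 2 - u ≤ s → s ≤ n₀ + 1 / 2 - u + 1 → L ≤ |s| ∧ 0 ≤ B.im * s) :
    ‖∫ x in (n₀ + 1 / 2 - u : ℝ)..(n₀ + 1 / 2 - u + 1), gaussMul B K (x +
        (-(1 / (40 * ‖B‖)) : ℝ) * I)‖ ≤ 40 * Real.exp (2 - L / 2) * M * (40 * ‖B‖) ^ m := by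
  have hM := hK.nonneg
  have hBn : 1 / 2 ≤ ‖B‖ := hB.trans (Complex.re_le_norm B)
  set ε := 1 / (40 * ‖B‖) with hε
  have hε0 : 0 < ε := by positivity
  have hε1 : ε ≤ 1 / 20 := by
    rw [hε]
    apply one_div_le_one_div_of_le <;> linarith
  have hbd : ∀ s y d : ℝ, n₀ + 1 / 2 - u ≤ s → s ≤ n₀ + 1 / 2 - u + 1 → -(1 / 8) ≤ y → y ≤ 0 →
      1 / 20 ≤ d → d ≤ 1 → (∀ n : ℤ, d ≤ ‖(s : ℂ) + y * I - n - 1 / 2‖) →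
      ‖gaussMul B K (s + y * I)‖ ≤ Real.exp (2 - L / 2) * (M * 20 ^ (m + 1)) := by
    intro s y d h1 h2 h3 h4 h5 h6 h7
    refine (hK.norm_gaussMul_le hB hL (hs s h1 h2).1 ?_ (Or.inl ?_) (by linarith) h6 h7).trans ?_
    · rw [abs_le]
      constructor <;> linarith
    · exact mul_nonpos_of_nonneg_of_nonpos (hs s h1 h2).2 h4
    · have : M / d ^ (m + 1) ≤ M / (1 / 20) ^ (m + 1) := by gcongr
      rw [one_div, inv_pow, div_inv_eq_mul] at this
      gcongr
  -- Since Im B · s ≥ 0, the cross term is harmless for y ≤ 0, and the line is pushed down to Im v =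
  -- -1/8. Every side keeps a distance of at least 1/20 from the half-integers.
  have h1 := norm_integral_horizontal_le_of_below (f := gaussMul B K) (a := n₀ + 1 / 2 - u)
    (b := n₀ + 1 / 2 - u + 1) (c := -(1 / 8)) (d := -ε)
    (Q := Real.exp (2 - L / 2) * (M * 20 ^ (m + 1))) (by linarith) (by linarith)
    (fun x _ _ y _ hy => hK.differentiableAt_gaussMul B fun n hn => by
      have := im_le_norm_sub_half x y n
      rw [hn] at this
      simp at this
      linarith)
    (fun x hx hx' => hbd x _ (1 / 8) hx hx' le_rfl (by norm_num) (by norm_num) (by norm_num)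
      fun n => by
        have := im_le_norm_sub_half x (-(1 / 8)) n
        rwa [abs_neg, abs_of_pos (by norm_num : (0 : ℝ) < 1 / 8)] at this)
    (fun y hy hy' => hbd _ y (1 / 20) le_rfl (by linarith) hy (by linarith) le_rfl (by norm_num)
      fun n => re_le_norm_sub_half y (n₀ := n₀ - 1) (by push_cast; linarith)
        (by push_cast; linarith) n)
    (fun y hy hy' => hbd _ y (1 / 20) (by linarith) le_rfl hy (by linarith) le_rfl (by norm_num)
      fun n => re_le_norm_sub_half y (n₀ := n₀) (by linarith) (by linarith) n)
  refine h1.trans ?_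
  have h2 : (20 : ℝ) ^ m ≤ (40 * ‖B‖) ^ m := by
    gcongr
    linarith
  have h3 : 0 < Real.exp (2 - L / 2) := Real.exp_pos _
  calc Real.exp (2 - L / 2) * (M * 20 ^ (m + 1)) * (n₀ + 1 / 2 - u + 1 - (n₀ + 1 / 2 - u) +
        2 * (-ε - -(1 / 8))) ≤ Real.exp (2 - L / 2) * (M * 20 ^ (m + 1)) * 2 := by
        gcongr
        linarith
    _ = 40 * Real.exp (2 - L / 2) * M * 20 ^ m := by ring
    _ ≤ _ := by gcongr

/-- The contribution of an interval of length one around a pole, when the contour has to be moved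
across the pole. -/
theorem HalfIntegerPoles.norm_integral_tile_le_of_up {K : ℂ → ℂ} {m : ℕ} {M : ℝ}
    (hK : HalfIntegerPoles K m M) {B : ℂ} (hB : 1 / 2 ≤ B.re) (n₀ : ℤ) {u L : ℝ}
    (hu : 1 / 20 ≤ u) (hu1 : u ≤ 19 / 20) (hL : 9 / 20 ≤ L)
    (hs : ∀ s : ℝ, n₀ + 1 / 2 - u ≤ s → s ≤ n₀ + 1 / 2 - u + 1 → L ≤ |s| ∧ B.im * s ≤ 0) :
    ‖∫ x in (n₀ + 1 / 2 - u : ℝ)..(n₀ + 1 / 2 - u + 1), gaussMul B K (x +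
        (-(1 / (40 * ‖B‖)) : ℝ) * I)‖ ≤ 40 * Real.exp (2 - L / 2) * M * (40 * ‖B‖) ^ m := by
  have hM := hK.nonneg
  have hBn : 1 / 2 ≤ ‖B‖ := hB.trans (Complex.re_le_norm B)
  set ε := 1 / (40 * ‖B‖) with hε
  have hε0 : 0 < ε := by positivity
  have hε1 : ε ≤ 1 / 20 := by
    rw [hε]
    apply one_div_le_one_div_of_le <;> linarith
  have hbd : ∀ s y d : ℝ, n₀ + 1 / 2 - u ≤ s → s ≤ n₀ + 1 / 2 - u + 1 → -ε ≤ y → y ≤ 1 / 8 →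
      0 < d → d ≤ 1 → (∀ n : ℤ, d ≤ ‖(s : ℂ) + y * I - n - 1 / 2‖) →
      ‖gaussMul B K (s + y * I)‖ ≤ Real.exp (2 - L / 2) * (M / d ^ (m + 1)) := by
    intro s y d h1 h2 h3 h4 h5 h6 h7
    refine hK.norm_gaussMul_le hB hL (hs s h1 h2).1 ?_ ?_ h5 h6 h7
    · rw [abs_le]
      constructor <;> linarith
    -- Above the axis the cross term has the good sign; in the strip -ε ≤ y < 0 it is small by the
    -- choice ε = 1/(40‖B‖).
    · rcases le_or_gt 0 y with hy | hy
      · exact Or.inl (mul_nonpos_of_nonpos_of_nonneg (hs s h1 h2).2 hy)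
      · right
        rw [abs_of_neg hy]
        linarith
  have hbd20 : ∀ s y d : ℝ, n₀ + 1 / 2 - u ≤ s → s ≤ n₀ + 1 / 2 - u + 1 → -ε ≤ y → y ≤ 1 / 8 →
      1 / 20 ≤ d → d ≤ 1 → (∀ n : ℤ, d ≤ ‖(s : ℂ) + y * I - n - 1 / 2‖) →
      ‖gaussMul B K (s + y * I)‖ ≤ Real.exp (2 - L / 2) * (M * 20 ^ (m + 1)) := by
    intro s y d h1 h2 h3 h4 h5 h6 h7
    refine (hbd s y d h1 h2 h3 h4 (by linarith) h6 h7).trans ?_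
    have : M / d ^ (m + 1) ≤ M / (1 / 20) ^ (m + 1) := by gcongr
    rw [one_div, inv_pow, div_inv_eq_mul] at this
    gcongr
  have habs : ∀ x : ℝ, ∀ n : ℤ, ε ≤ ‖(x : ℂ) + (-ε : ℝ) * I - n - 1 / 2‖ ∧
      ε ≤ ‖(x : ℂ) + ε * I - n - 1 / 2‖ := by
    intro x n
    have h1 := im_le_norm_sub_half x (-ε) n
    have h2 := im_le_norm_sub_half x ε n
    rw [abs_neg, abs_of_pos hε0] at h1
    rw [abs_of_pos hε0] at h2
    exact ⟨h1, h2⟩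
  have h1 := norm_integral_horizontal_le_of_pole (f := gaussMul B K) (a := n₀ + 1 / 2 - u)
    (b := n₀ + 1 / 2 - u + 1) (p := n₀ + 1 / 2) (ε := ε) (η := 1 / 8)
    (Q := Real.exp (2 - L / 2) * (M * 20 ^ (m + 1)))
    (R := Real.exp (2 - L / 2) * (M / ε ^ (m + 1))) hε0 (by linarith) (by linarith) (by linarith)
    (fun x y hx hx' hne => hK.differentiableAt_gaussMul B fun n hn => by
      have him := congrArg Complex.im hn
      have hre := congrArg Complex.re hn
      rw [show (n : ℂ) + 1 / 2 = ((n + 1 / 2 : ℝ) : ℂ) by push_cast; rfl] at him hre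
      simp at him hre
      have h3 : (n : ℝ) < n₀ + 1 := by linarith
      have h4 : (n₀ : ℝ) - 1 < n := by linarith
      have h5 : n < n₀ + 1 := by exact_mod_cast h3
      have h6 : n₀ - 1 < n := by exact_mod_cast h4
      have h7 : n = n₀ := by omega
      apply hne
      rw [hn, h7]
      push_cast
      rfl)
    (fun x hx hx' => hbd20 x _ (1 / 8) hx hx' (by linarith) le_rfl (by norm_num) (by norm_num)
      fun n => by
        have := im_le_norm_sub_half x (1 / 8) n
        rwa [abs_of_pos (by norm_num : (0 : ℝ) < 1 / 8)] at this)
    (fun y hy hy' => hbd20 _ y (1 / 20) le_rfl (by linarith) hy hy' le_rfl (by norm_num)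
      fun n => re_le_norm_sub_half y (n₀ := n₀ - 1) (by push_cast; linarith)
        (by push_cast; linarith) n)
    (fun y hy hy' => hbd20 _ y (1 / 20) (by linarith) le_rfl hy hy' le_rfl (by norm_num)
      fun n => re_le_norm_sub_half y (n₀ := n₀) (by linarith) (by linarith) n)
    (fun x hx hx' => ⟨hbd x _ ε (by linarith) (by linarith) le_rfl (by linarith) hε0 (by linarith)
        fun n => (habs x n).1,
      hbd x _ ε (by linarith) (by linarith) (by linarith) (by linarith) hε0 (by linarith)
        fun n => (habs x n).2⟩)
    (fun y hy hy' => ⟨hbd _ y ε (by linarith) (by linarith) hy (by linarith) hε0 (by linarith)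
        fun n => re_le_norm_sub_half y (n₀ := n₀ - 1) (by push_cast; linarith)
          (by push_cast; linarith) n,
      hbd _ y ε (by linarith) (by linarith) hy (by linarith) hε0 (by linarith)
        fun n => re_le_norm_sub_half y (n₀ := n₀) (by linarith) (by linarith) n⟩)
  refine h1.trans ?_
  have h2 : (20 : ℝ) ^ m ≤ (40 * ‖B‖) ^ m := by
    gcongr
    linarith
  have h3 : 0 < Real.exp (2 - L / 2) := Real.exp_pos _
  -- Perimeter times supremum on the square around the pole: one power of ε is regained, which
  -- leaves the m-th power of ‖B‖.
  have h4 : M / ε ^ (m + 1) * (8 * ε) = 8 * M * (40 * ‖B‖) ^ m := by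
    have h5 : ∀ e : ℝ, 0 < e → M / e ^ (m + 1) * (8 * e) = 8 * M * (1 / e) ^ m := by
      intro e he
      rw [div_pow, one_pow, pow_succ]
      field_simp
    rw [h5 ε hε0, hε, one_div_one_div]
  calc Real.exp (2 - L / 2) * (M * 20 ^ (m + 1)) * (n₀ + 1 / 2 - u + 1 - (n₀ + 1 / 2 - u) +
        2 * (1 / 8 + ε)) + Real.exp (2 - L / 2) * (M / ε ^ (m + 1)) * (8 * ε)
      ≤ Real.exp (2 - L / 2) * (M * 20 ^ (m + 1)) * (3 / 2) +
        Real.exp (2 - L / 2) * (M / ε ^ (m + 1)) * (8 * ε) := by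
        gcongr
        linarith
    _ = 30 * Real.exp (2 - L / 2) * M * 20 ^ m + 8 * Real.exp (2 - L / 2) * M * (40 * ‖B‖) ^ m := by
        rw [mul_assoc _ (M / ε ^ (m + 1)), h4]
        ring
    _ ≤ 30 * Real.exp (2 - L / 2) * M * (40 * ‖B‖) ^ m +
        10 * Real.exp (2 - L / 2) * M * (40 * ‖B‖) ^ m := by
        gcongr
        norm_num
    _ = _ := by ring

/-- The signs of Im B and of the interval decide whether to move down or up. -/
theorem HalfIntegerPoles.norm_integral_tile_le {K : ℂ → ℂ} {m : ℕ} {M : ℝ}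
    (hK : HalfIntegerPoles K m M) {B : ℂ} (hB : 1 / 2 ≤ B.re) (n₀ : ℤ) {u L : ℝ}
    (hu : 1 / 20 ≤ u) (hu1 : u ≤ 19 / 20) (hL : 9 / 20 ≤ L)
    (hs : L ≤ n₀ + 1 / 2 - u ∨ n₀ + 1 / 2 - u + 1 ≤ -L) :
    ‖∫ x in (n₀ + 1 / 2 - u : ℝ)..(n₀ + 1 / 2 - u + 1), gaussMul B K (x +
        (-(1 / (40 * ‖B‖)) : ℝ) * I)‖ ≤ 40 * Real.exp (2 - L / 2) * M * (40 * ‖B‖) ^ m := by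
  rcases hs with hs | hs <;> rcases le_total 0 B.im with h0 | h0
  · exact hK.norm_integral_tile_le_of_down hB n₀ hu hu1 hL fun s h1 h2 =>
      ⟨by rw [abs_of_nonneg (by linarith)]; linarith, mul_nonneg h0 (by linarith)⟩
  · exact hK.norm_integral_tile_le_of_up hB n₀ hu hu1 hL fun s h1 h2 =>
      ⟨by rw [abs_of_nonneg (by linarith)]; linarith,
        mul_nonpos_of_nonpos_of_nonneg h0 (by linarith)⟩
  · exact hK.norm_integral_tile_le_of_up hB n₀ hu hu1 hL fun s h1 h2 =>
      ⟨by rw [abs_of_nonpos (by linarith)]; linarith,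
        mul_nonpos_of_nonneg_of_nonpos h0 (by linarith)⟩
  · exact hK.norm_integral_tile_le_of_down hB n₀ hu hu1 hL fun s h1 h2 =>
      ⟨by rw [abs_of_nonpos (by linarith)]; linarith, mul_nonneg_of_nonpos_of_nonpos h0 (by linarith)⟩

/-! ### The two tails and the middle of the line. -/

theorem HalfIntegerPoles.differentiableAt_gaussMul_line {K : ℂ → ℂ} {m : ℕ} {M : ℝ}
    (hK : HalfIntegerPoles K m M) (B : ℂ) (x : ℝ) {y : ℝ} (hy : y ≠ 0) :
    DifferentiableAt ℂ (gaussMul B K) (x + y * I) :=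
  hK.differentiableAt_gaussMul B fun n hn => by
    have := im_le_norm_sub_half x y n
    rw [hn] at this
    simp at this
    exact hy this

theorem HalfIntegerPoles.integrable_line {K : ℂ → ℂ} {m : ℕ} {M : ℝ}
    (hK : HalfIntegerPoles K m M) {B : ℂ} (hB : 0 < B.re) {ε : ℝ} (hε : 0 < ε) (hε1 : ε ≤ 1) :
    Integrable fun x : ℝ => gaussMul B K (x + (-ε : ℝ) * I) := by
  have hcont : Continuous fun x : ℝ => gaussMul B K (x + (-ε : ℝ) * I) := by
    rw [continuous_iff_continuousAt]
    intro x
    have h1 : ContinuousAt (fun x : ℝ => (x : ℂ) + (-ε : ℝ) * I) x := by fun_prop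
    exact ContinuousAt.comp (g := gaussMul B K) (f := fun x : ℝ => (x : ℂ) + (-ε : ℝ) * I)
      (hK.differentiableAt_gaussMul_line B x (neg_ne_zero.2 hε.ne')).continuousAt h1
  refine Integrable.mono' (((integrable_gaussian_line hB ε 0).norm).const_mul
    (‖exp (Real.pi * B * (1 / 6))‖ * (M / ε ^ (m + 1)))) hcont.aestronglyMeasurable
    (Eventually.of_forall fun x => ?_)
  have hk : ‖K (x + (-ε : ℝ) * I)‖ ≤ M / ε ^ (m + 1) := by
    refine hK.norm_le _ ?_ ε hε hε1 fun n => ?_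
    · simpa [abs_of_pos hε] using hε1
    · have := im_le_norm_sub_half x (-ε) n
      rwa [abs_neg, abs_of_pos hε] at this
  have he : exp (Real.pi * B * (1 / 6 - ((x : ℂ) + (-ε : ℝ) * I) ^ 2)) =
      exp (Real.pi * B * (1 / 6)) *
        (exp (-Real.pi * B * ((x : ℂ) - ε * I) ^ 2) * exp (0 * ((x : ℂ) - ε * I))) := by
    rw [← Complex.exp_add, ← Complex.exp_add]
    congr 1
    push_cast
    ring
  rw [gaussMul, norm_mul, he, norm_mul (exp (Real.pi * B * (1 / 6)))]
  calc _ ≤ _ := mul_le_mul_of_nonneg_left hk (by positivity)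
    _ = _ := by ring

theorem sum_exp_neg_half_le (N : ℕ) :
    ∑ n ∈ Finset.range N, Real.exp (2 - (9 / 20 + n) / 2) ≤
      Real.exp 2 / (1 - Real.exp (-(1 / 2))) := by
  have h1 : Real.exp (-(1 / 2)) < 1 := Real.exp_lt_one_iff.2 (by norm_num)
  have h2 : ∀ n : ℕ, Real.exp (2 - (9 / 20 + n) / 2) ≤ Real.exp 2 * Real.exp (-(1 / 2)) ^ n := by
    intro n
    rw [← Real.exp_nat_mul, ← Real.exp_add]
    apply Real.exp_le_exp.2
    linarith
  refine (Finset.sum_le_sum fun n _ => h2 n).trans ?_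
  rw [← Finset.mul_sum, div_eq_mul_inv (Real.exp 2),
    ← tsum_geometric_of_lt_one (Real.exp_pos _).le h1]
  gcongr
  exact (summable_geometric_of_lt_one (Real.exp_pos _).le h1).sum_le_tsum _
    fun _ _ => by positivity

theorem HalfIntegerPoles.norm_integral_right_le {K : ℂ → ℂ} {m : ℕ} {M : ℝ}
    (hK : HalfIntegerPoles K m M) {B : ℂ} (hB : 1 / 2 ≤ B.re) (N : ℕ) :
    ‖∫ x in (9 / 20 : ℝ)..(9 / 20 + N), gaussMul B K (x + (-(1 / (40 * ‖B‖)) : ℝ) * I)‖ ≤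
      40 * (Real.exp 2 / (1 - Real.exp (-(1 / 2)))) * M * (40 * ‖B‖) ^ m := by
  have hM := hK.nonneg
  have hBn : 1 / 2 ≤ ‖B‖ := hB.trans (Complex.re_le_norm B)
  have hint : ∀ s t : ℝ, IntervalIntegrable (fun x : ℝ => gaussMul B K (x +
      (-(1 / (40 * ‖B‖)) : ℝ) * I)) volume s t := fun s t =>
    intervalIntegrable_horizontal fun x _ => hK.differentiableAt_gaussMul_line B x
      (neg_ne_zero.2 (by positivity))
  have h1 := intervalIntegral.sum_integral_adjacent_intervals (a := fun n : ℕ => (9 / 20 + n : ℝ))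
    (n := N) fun k _ => hint _ _
  simp only [Nat.cast_zero, add_zero] at h1
  rw [← h1]
  refine (norm_sum_le _ _).trans ?_
  have h2 : ∀ n ∈ Finset.range N, ‖∫ x in (9 / 20 + n : ℝ)..(9 / 20 + (n + 1 : ℕ)),
      gaussMul B K (x + (-(1 / (40 * ‖B‖)) : ℝ) * I)‖ ≤
      40 * M * (40 * ‖B‖) ^ m * Real.exp (2 - (9 / 20 + n) / 2) := by
    intro n _
    -- With u = 1/20 the n-th interval begins at 9/20 + n, so each has exactly one half-integer
    -- inside and none within 1/20 of its ends; the left tail uses the mirror image u = 19/20.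
    have h3 := hK.norm_integral_tile_le hB n (u := 1 / 20) (L := 9 / 20 + n) le_rfl (by norm_num)
      (by linarith [(Nat.cast_nonneg n : (0 : ℝ) ≤ n)]) (Or.inl (by push_cast; linarith))
    have e1 : (((n : ℤ) : ℝ) + 1 / 2 - 1 / 20) = 9 / 20 + n := by push_cast; ring
    rw [e1, show (9 / 20 + n + 1 : ℝ) = 9 / 20 + (n + 1 : ℕ) by push_cast; ring] at h3
    refine h3.trans (le_of_eq (by ring))
  refine (Finset.sum_le_sum h2).trans ?_
  rw [← Finset.mul_sum]
  calc _ ≤ 40 * M * (40 * ‖B‖) ^ m * (Real.exp 2 / (1 - Real.exp (-(1 / 2)))) :=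
        mul_le_mul_of_nonneg_left (sum_exp_neg_half_le N) (by positivity)
    _ = _ := by ring

theorem HalfIntegerPoles.norm_integral_left_le {K : ℂ → ℂ} {m : ℕ} {M : ℝ}
    (hK : HalfIntegerPoles K m M) {B : ℂ} (hB : 1 / 2 ≤ B.re) (N : ℕ) :
    ‖∫ x in (-(9 / 20) - N : ℝ)..(-(9 / 20)), gaussMul B K (x +
        (-(1 / (40 * ‖B‖)) : ℝ) * I)‖ ≤
      40 * (Real.exp 2 / (1 - Real.exp (-(1 / 2)))) * M * (40 * ‖B‖) ^ m := by
  have hM := hK.nonneg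
  have hBn : 1 / 2 ≤ ‖B‖ := hB.trans (Complex.re_le_norm B)
  have hint : ∀ s t : ℝ, IntervalIntegrable (fun x : ℝ => gaussMul B K (x +
      (-(1 / (40 * ‖B‖)) : ℝ) * I)) volume s t := fun s t =>
    intervalIntegrable_horizontal fun x _ => hK.differentiableAt_gaussMul_line B x
      (neg_ne_zero.2 (by positivity))
  have h1 := intervalIntegral.sum_integral_adjacent_intervals
    (a := fun n : ℕ => (-(9 / 20) - n : ℝ)) (n := N) fun k _ => hint _ _
  simp only [Nat.cast_zero, sub_zero] at h1
  rw [intervalIntegral.integral_symm, norm_neg, ← h1]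
  refine (norm_sum_le _ _).trans ?_
  have h2 : ∀ n ∈ Finset.range N, ‖∫ x in (-(9 / 20) - n : ℝ)..(-(9 / 20) - (n + 1 : ℕ)),
      gaussMul B K (x + (-(1 / (40 * ‖B‖)) : ℝ) * I)‖ ≤
      40 * M * (40 * ‖B‖) ^ m * Real.exp (2 - (9 / 20 + n) / 2) := by
    intro n _
    have h3 := hK.norm_integral_tile_le hB (-n - 1) (u := 19 / 20) (L := 9 / 20 + n) (by norm_num)
      le_rfl (by linarith [(Nat.cast_nonneg n : (0 : ℝ) ≤ n)]) (Or.inr (by push_cast; linarith))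
    have e1 : (((-n - 1 : ℤ) : ℝ) + 1 / 2 - 19 / 20) = -(9 / 20) - (n + 1 : ℕ) := by
      push_cast
      ring
    rw [e1, show (-(9 / 20) - (n + 1 : ℕ) + 1 : ℝ) = -(9 / 20) - n by push_cast; ring] at h3
    rw [intervalIntegral.integral_symm, norm_neg]
    refine h3.trans (le_of_eq (by ring))
  refine (Finset.sum_le_sum h2).trans ?_
  rw [← Finset.mul_sum]
  calc _ ≤ 40 * M * (40 * ‖B‖) ^ m * (Real.exp 2 / (1 - Real.exp (-(1 / 2)))) :=
        mul_le_mul_of_nonneg_left (sum_exp_neg_half_le N) (by positivity)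
    _ = _ := by ring

theorem inv_sqrt_six_bounds : (1 / Real.sqrt 6) ^ 2 = 1 / 6 ∧ 2 / 5 ≤ 1 / Real.sqrt 6 ∧
    1 / Real.sqrt 6 ≤ 9 / 20 := by
  have h : (1 / Real.sqrt 6) ^ 2 = 1 / 6 := by
    rw [div_pow, Real.sq_sqrt (by norm_num), one_pow]
  have h0 : 0 < 1 / Real.sqrt 6 := by positivity
  refine ⟨h, ?_, ?_⟩ <;> nlinarith

theorem HalfIntegerPoles.differentiableAt_gaussMul_middle {K : ℂ → ℂ} {m : ℕ} {M : ℝ}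
    (hK : HalfIntegerPoles K m M) (B : ℂ) {x : ℝ} (y : ℝ) (hx : -(9 / 20) ≤ x) (hx' : x ≤ 9 / 20) :
    DifferentiableAt ℂ (gaussMul B K) (x + y * I) :=
  hK.differentiableAt_gaussMul B fun n hn => by
    have := re_le_norm_sub_half (x := x) (d := 1 / 20) y (n₀ := -1) (by push_cast; linarith)
      (by push_cast; linarith) n
    rw [hn] at this
    simp at this
    linarith

/-- No half-integer is closer than 1/20 to [-9/20, 9/20], so this part of the line moves freely up
to the real axis. There the Gaussian has modulus at most 1 once |x| ≥ 1/√6, so the two outer pieces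
and the short vertical sides are errors. -/
theorem HalfIntegerPoles.norm_integral_middle_sub_le {K : ℂ → ℂ} {m : ℕ} {M : ℝ}
    (hK : HalfIntegerPoles K m M) {B : ℂ} (hB : 1 / 2 ≤ B.re) :
    ‖(∫ x in (-(9 / 20) : ℝ)..(9 / 20), gaussMul B K (x + (-(1 / (40 * ‖B‖)) : ℝ) * I)) -
      ∫ x in (-(1 / Real.sqrt 6))..(1 / Real.sqrt 6), gaussMul B K x‖ ≤
      (2 * Real.exp 2 + 2) * M * (40 * ‖B‖) ^ m := by
  have hM := hK.nonneg
  have hBn : 1 / 2 ≤ ‖B‖ := hB.trans (Complex.re_le_norm B)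
  obtain ⟨hd, hd1, hd2⟩ := inv_sqrt_six_bounds
  set δ := 1 / Real.sqrt 6
  set ε := 1 / (40 * ‖B‖) with hε
  have hε0 : 0 < ε := by positivity
  have hε1 : ε ≤ 1 / 20 := by
    rw [hε]
    apply one_div_le_one_div_of_le <;> linarith
  have h20 : (20 : ℝ) ^ m ≤ (40 * ‖B‖) ^ m := by
    gcongr
    linarith
  have r := integral_horizontal_eq (f := gaussMul B K) (a := -(9 / 20)) (b := 9 / 20) (c := -ε)
    (d := 0) fun x hx y _ => by
      rw [Set.uIcc_of_le (by norm_num)] at hx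
      exact hK.differentiableAt_gaussMul_middle B y hx.1 hx.2
  have hint : ∀ s t : ℝ, -(9 / 20) ≤ s → s ≤ t → t ≤ 9 / 20 →
      IntervalIntegrable (fun x : ℝ => gaussMul B K (x + (0 : ℝ) * I)) volume s t := by
    intro s t hs hst ht
    refine intervalIntegrable_horizontal fun x hx => ?_
    rw [Set.uIcc_of_le hst] at hx
    exact hK.differentiableAt_gaussMul_middle B 0 (by linarith [hx.1]) (by linarith [hx.2])
  have s1 : ∫ x in (-(9 / 20) : ℝ)..(9 / 20), gaussMul B K (x + (0 : ℝ) * I) =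
      (∫ x in (-(9 / 20) : ℝ)..(-δ), gaussMul B K (x + (0 : ℝ) * I)) +
      (∫ x in (-δ)..δ, gaussMul B K (x + (0 : ℝ) * I)) +
      ∫ x in δ..(9 / 20), gaussMul B K (x + (0 : ℝ) * I) := by
    rw [intervalIntegral.integral_add_adjacent_intervals
      (hint _ _ le_rfl (by linarith) (by linarith)) (hint _ _ (by linarith) (by linarith) hd2),
      intervalIntegral.integral_add_adjacent_intervals
      (hint _ _ le_rfl (by linarith) hd2) (hint _ _ (by linarith) hd2 le_rfl)]
  rw [r, s1]
  have e0 : ∫ x in (-δ)..δ, gaussMul B K x = ∫ x in (-δ)..δ, gaussMul B K (x + (0 : ℝ) * I) := by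
    simp
  rw [e0]
  have hVbd : ∀ s : ℝ, |s| = 9 / 20 → ∀ y : ℝ, -ε ≤ y → y ≤ 0 →
      ‖gaussMul B K (s + y * I)‖ ≤ Real.exp 2 * (M * 20 ^ (m + 1)) := by
    intro s hs y hy hy'
    have hs' := abs_le.1 hs.le
    have h1 := hK.norm_gaussMul_le hB (s := s) (y := y) (L := 9 / 20) (d := 1 / 20) le_rfl hs.ge
      (by rw [abs_le]; constructor <;> linarith) (Or.inr (by rw [abs_of_nonpos hy']; linarith))
      (by norm_num) (by norm_num) fun n => re_le_norm_sub_half y (n₀ := -1)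
        (by push_cast; linarith) (by push_cast; linarith) n
    refine h1.trans ?_
    have h2 : Real.exp (2 - 9 / 20 / 2) ≤ Real.exp 2 := Real.exp_le_exp.2 (by norm_num)
    rw [one_div, inv_pow, div_inv_eq_mul]
    gcongr
  have hRbd : ∀ x : ℝ, δ ≤ |x| → |x| ≤ 9 / 20 →
      ‖gaussMul B K (x + (0 : ℝ) * I)‖ ≤ M * 20 ^ (m + 1) := by
    intro x hx hx'
    rw [gaussMul, norm_mul]
    have h1 : ‖K (x + (0 : ℝ) * I)‖ ≤ M / (1 / 20) ^ (m + 1) := by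
      have hs' := abs_le.1 hx'
      exact hK.norm_le _ (by simp) _ (by norm_num) (by norm_num) fun n =>
        re_le_norm_sub_half 0 (n₀ := -1) (by push_cast; linarith) (by push_cast; linarith) n
    rw [one_div, inv_pow, div_inv_eq_mul] at h1
    have h2 : ‖exp (Real.pi * B * (1 / 6 - ((x : ℂ) + (0 : ℝ) * I) ^ 2))‖ ≤ 1 := by
      rw [Complex.norm_exp, Real.exp_le_one_iff, show (Real.pi * B * (1 / 6 - ((x : ℂ) + (0 : ℝ) * I) ^ 2)) =
        ((Real.pi * (1 / 6 - x ^ 2) : ℝ) : ℂ) * B by push_cast; ring, Complex.re_ofReal_mul]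
      have h3 : 1 / 6 ≤ x ^ 2 := by
        rw [← hd, ← sq_abs x]
        gcongr
      have : 0 ≤ Real.pi * (x ^ 2 - 1 / 6) * B.re :=
        mul_nonneg (mul_nonneg Real.pi_pos.le (by linarith)) (by linarith)
      nlinarith
    calc _ ≤ 1 * (M * 20 ^ (m + 1)) := mul_le_mul h2 h1 (norm_nonneg _) zero_le_one
      _ = _ := one_mul _
  have b1 := norm_intervalIntegral_le (a := -ε) (b := 0) (by linarith)
    fun y hy hy' => hVbd (9 / 20) (abs_of_pos (by norm_num)) y hy hy'
  have b2 := norm_intervalIntegral_le (a := -ε) (b := 0) (by linarith)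
    fun y hy hy' => hVbd (-(9 / 20)) (by rw [abs_neg]; exact abs_of_pos (by norm_num)) y hy hy'
  have b3 := norm_intervalIntegral_le (a := -(9 / 20)) (b := -δ) (by linarith)
    fun x hx hx' => hRbd x (by rw [abs_of_nonpos (by linarith)]; linarith)
      (by rw [abs_of_nonpos (by linarith)]; linarith)
  have b4 := norm_intervalIntegral_le (a := δ) (b := 9 / 20) hd2
    fun x hx hx' => hRbd x (by rw [abs_of_nonneg (by linarith)]; linarith)
      (by rw [abs_of_nonneg (by linarith)]; linarith)
  set Q : ℝ := M * 20 ^ (m + 1) with hQ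
  have hQ0 : 0 ≤ Q := by positivity
  have hQ1 : Q ≤ 20 * M * (40 * ‖B‖) ^ m := by
    rw [hQ, pow_succ]
    calc M * (20 ^ m * 20) = 20 * M * 20 ^ m := by ring
      _ ≤ _ := by gcongr
  have e1 : ∀ a b c d e : ℂ, a + b + c - I * d + I * e - b = a + c - I * d + I * e := by
    intros
    ring
  rw [e1]
  refine (norm_add_le _ _).trans ?_
  refine (add_le_add_left (norm_sub_le _ _) _).trans ?_
  refine (add_le_add_left (add_le_add_left (norm_add_le _ _) _) _).trans ?_
  rw [norm_mul, norm_mul, norm_I, one_mul, one_mul]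
  have he : 0 < Real.exp 2 := Real.exp_pos _
  have c1 : Real.exp 2 * Q * (0 - -ε) ≤ Real.exp 2 * Q * (1 / 20) := by
    gcongr
    linarith
  have c2 : Q * (-δ - -(9 / 20)) ≤ Q * (1 / 20) := by
    gcongr
    linarith
  have c3 : Q * (9 / 20 - δ) ≤ Q * (1 / 20) := by
    gcongr
    linarith
  calc _ ≤ Q * (1 / 20) + Q * (1 / 20) + Real.exp 2 * Q * (1 / 20) + Real.exp 2 * Q * (1 / 20) := by
        linarith
    _ = (2 * Real.exp 2 + 2) * (1 / 20) * Q := by ring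
    _ ≤ (2 * Real.exp 2 + 2) * (1 / 20) * (20 * M * (40 * ‖B‖) ^ m) := by gcongr
    _ = _ := by ring

/-- The contour integral is governed by the segment on which the Gaussian is large. -/
theorem HalfIntegerPoles.norm_integral_line_sub_le {K : ℂ → ℂ} {m : ℕ} {M : ℝ}
    (hK : HalfIntegerPoles K m M) {B : ℂ} (hB : 1 / 2 ≤ B.re) :
    ‖(∫ x : ℝ, gaussMul B K (x + (-(1 / (40 * ‖B‖)) : ℝ) * I)) -
      ∫ x in (-(1 / Real.sqrt 6))..(1 / Real.sqrt 6), gaussMul B K x‖ ≤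
      (80 * (Real.exp 2 / (1 - Real.exp (-(1 / 2)))) + (2 * Real.exp 2 + 2)) * M *
        (40 * ‖B‖) ^ m := by
  have hBn : 1 / 2 ≤ ‖B‖ := hB.trans (Complex.re_le_norm B)
  have hε0 : 0 < 1 / (40 * ‖B‖) := by positivity
  have hε1 : 1 / (40 * ‖B‖) ≤ 1 := by
    rw [div_le_one (by positivity)]
    linarith
  have hint := hK.integrable_line (show 0 < B.re by linarith) hε0 hε1
  have ha : Tendsto (fun N : ℕ => (-(9 / 20) - N : ℝ)) atTop atBot :=
    tendsto_atBot_add_const_left _ _ (tendsto_neg_atTop_atBot.comp tendsto_natCast_atTop_atTop)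
  have hb : Tendsto (fun N : ℕ => (9 / 20 + N : ℝ)) atTop atTop :=
    tendsto_atTop_add_const_left _ _ tendsto_natCast_atTop_atTop
  have hlim := intervalIntegral_tendsto_integral hint ha hb
  -- The bounds for the two tails do not depend on N.
  refine le_of_tendsto (hlim.sub_const _).norm (Eventually.of_forall fun N => ?_)
  have hii : ∀ s t : ℝ, IntervalIntegrable (fun x : ℝ => gaussMul B K (x +
      (-(1 / (40 * ‖B‖)) : ℝ) * I)) volume s t := fun s t => hint.intervalIntegrable
  rw [← intervalIntegral.integral_add_adjacent_intervals (hii _ (9 / 20)) (hii (9 / 20) _),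
    ← intervalIntegral.integral_add_adjacent_intervals (hii _ (-(9 / 20))) (hii (-(9 / 20)) _)]
  have h1 := hK.norm_integral_left_le hB N
  have h2 := hK.norm_integral_right_le hB N
  have h3 := hK.norm_integral_middle_sub_le hB
  have e1 : ∀ a b c d : ℂ, a + b + c - d = a + (b - d) + c := by
    intros
    ring
  rw [e1]
  refine (norm_add_le _ _).trans ?_
  refine (add_le_add_left (norm_add_le _ _) _).trans ?_
  linarith

end UnimodalRank

end

section

open PowerSeries

namespace UnimodalRank

/-! ### Taylor series at the origin -/

/-- The Taylor series of a function at the origin. -/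
noncomputable def taylorSeries (f : ℂ → ℂ) : PowerSeries ℂ :=
  PowerSeries.mk fun n => iteratedDeriv n f 0 / n.factorial

theorem coeff_taylorSeries (f : ℂ → ℂ) (n : ℕ) :
    coeff n (taylorSeries f) = iteratedDeriv n f 0 / n.factorial := by
  rw [taylorSeries, coeff_mk]

theorem taylorSeries_mul {f g : ℂ → ℂ} (hf : AnalyticAt ℂ f 0) (hg : AnalyticAt ℂ g 0) :
    taylorSeries (fun z => f z * g z) = taylorSeries f * taylorSeries g := by
  ext n
  rw [coeff_mul, coeff_taylorSeries, iteratedDeriv_fun_mul hf.contDiffAt hg.contDiffAt,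
    Finset.Nat.sum_antidiagonal_eq_sum_range_succ_mk, Finset.sum_div]
  refine Finset.sum_congr rfl fun i hi => ?_
  simp only [coeff_taylorSeries]
  have hi' : i ≤ n := by
    have := Finset.mem_range.1 hi
    omega
  have h1 : (n.factorial : ℂ) = (n.choose i : ℂ) * i.factorial * (n - i).factorial := by
    exact_mod_cast (Nat.choose_mul_factorial_mul_factorial hi').symm
  have h2 : ((n.choose i : ℕ) : ℂ) ≠ 0 := by
    exact_mod_cast (Nat.choose_pos hi').ne'
  have h3 : ((i.factorial : ℕ) : ℂ) ≠ 0 := by exact_mod_cast i.factorial_ne_zero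
  have h4 : (((n - i).factorial : ℕ) : ℂ) ≠ 0 := by exact_mod_cast (n - i).factorial_ne_zero
  rw [h1]
  field_simp

theorem taylorSeries_const_mul_id (c : ℂ) :
    taylorSeries (fun z => c * z) = C c * X := by
  ext n
  rw [coeff_taylorSeries, coeff_C_mul, coeff_X, iteratedDeriv_const_mul_field,
    iteratedDeriv_fun_id]
  rcases n with _ | _ | n <;> simp

theorem taylorSeries_exp (c : ℂ) :
    taylorSeries (fun z => Complex.exp (c * z)) = rescale c (exp ℂ) := by
  ext n
  rw [coeff_taylorSeries, iteratedDeriv_cexp_const_mul, coeff_rescale, coeff_exp]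
  simp [div_eq_mul_inv]

theorem analyticAt_exp_mul (c z : ℂ) : AnalyticAt ℂ (fun z => Complex.exp (c * z)) z :=
  (by fun_prop : Differentiable ℂ fun z => Complex.exp (c * z)).analyticAt z

theorem taylorSeries_sin (c : ℂ) :
    taylorSeries (fun z => Complex.sin (c * z)) =
      C (1 / (2 * I)) * (rescale (I * c) (exp ℂ) - rescale (-(I * c)) (exp ℂ)) := by
  rw [← taylorSeries_exp, ← taylorSeries_exp]
  ext n
  rw [coeff_C_mul, map_sub, coeff_taylorSeries, coeff_taylorSeries, coeff_taylorSeries, ← sub_div,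
    ← iteratedDeriv_fun_sub (analyticAt_exp_mul _ _).contDiffAt (analyticAt_exp_mul _ _).contDiffAt,
    ← mul_div_assoc, ← iteratedDeriv_const_mul_field]
  congr 2
  ext z
  rw [Complex.sin]
  have : (1 / (2 * I) : ℂ) = -I / 2 := by
    rw [div_eq_div_iff (by simp) (by simp)]
    linear_combination 2 * I_sq
  rw [this, show I * c * z = c * z * I by ring, show -(I * c) * z = -(c * z) * I by ring]
  ring

/-! ### Taylor series of sin w / w, of its inverse, and of exp(αz²). -/

/-- The entire function `sin w / w`. -/
noncomputable def sincC : ℂ → ℂ := dslope Complex.sin 0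

theorem mul_sincC (w : ℂ) : w * sincC w = Complex.sin w := by
  have := sub_smul_dslope Complex.sin 0 w
  simpa [sincC] using this

theorem sincC_zero : sincC 0 = 1 := by
  simp [sincC]

theorem differentiable_sincC : Differentiable ℂ sincC := by
  rw [← differentiableOn_univ, sincC, Complex.differentiableOn_dslope Filter.univ_mem,
    differentiableOn_univ]
  exact Complex.differentiable_sin

theorem two_le_pi_mul_norm_sincC {u : ℂ} (hu : |u.re| ≤ 1 / 2) :
    2 ≤ Real.pi * ‖sincC (Real.pi * u)‖ := by
  rcases eq_or_ne u 0 with rfl | h0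
  · rw [mul_zero, sincC_zero, norm_one]
    linarith [Real.pi_gt_three]
  · have h1 := two_mul_norm_le_norm_sin hu
    rw [← mul_sincC, norm_mul, norm_mul, Complex.norm_real, Real.norm_of_nonneg Real.pi_pos.le] at h1
    have h2 : 0 < ‖u‖ := norm_pos_iff.2 h0
    nlinarith

theorem analyticAt_sincC_mul (c z : ℂ) : AnalyticAt ℂ (fun z => sincC (c * z)) z :=
  (differentiable_sincC.comp (by fun_prop : Differentiable ℂ fun z => c * z)).analyticAt z

theorem C_mul_X_mul_taylorSeries_sincC (c : ℂ) :
    C c * X * taylorSeries (fun z => sincC (c * z)) =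
      C (1 / (2 * I)) * (rescale (I * c) (exp ℂ) - rescale (-(I * c)) (exp ℂ)) := by
  rw [← taylorSeries_sin, ← taylorSeries_const_mul_id, ← taylorSeries_mul
    ((by fun_prop : Differentiable ℂ fun z : ℂ => c * z).analyticAt 0) (analyticAt_sincC_mul c 0)]
  simp only [mul_sincC]

theorem coeff_taylorSeries_sincC {c : ℂ} (hc : c ≠ 0) (n : ℕ) :
    coeff n (taylorSeries fun z => sincC (c * z)) =
      if 2 ∣ n then (-1) ^ (n / 2) * c ^ n / (n + 1).factorial else 0 := by
  have h := congrArg (coeff (n + 1)) (C_mul_X_mul_taylorSeries_sincC c)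
  rw [mul_assoc, coeff_C_mul, coeff_succ_X_mul, coeff_C_mul, map_sub, coeff_rescale, coeff_rescale,
    coeff_exp] at h
  simp only [one_div, map_inv₀, map_natCast] at h
  apply mul_left_cancel₀ hc
  rw [h]
  have hI : (I : ℂ) ≠ 0 := I_ne_zero
  have hf : (((n + 1).factorial : ℕ) : ℂ) ≠ 0 := by exact_mod_cast (n + 1).factorial_ne_zero
  rcases Nat.even_or_odd' n with ⟨b, rfl | rfl⟩
  · rw [if_pos ⟨b, rfl⟩, Nat.mul_div_cancel_left _ (by norm_num), Odd.neg_pow ⟨b, rfl⟩,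
      mul_pow, pow_succ I, pow_mul I, I_sq]
    field_simp
    ring
  · rw [if_neg (by omega), Even.neg_pow ⟨b + 1, by ring⟩]
    simp

/-- The generating series of the values `B_n(1/2)`. -/
noncomputable def bernoulliHalf : PowerSeries ℂ :=
  PowerSeries.mk fun n =>
    ((((Polynomial.bernoulli n).eval (1 / 2 : ℚ) : ℚ) : ℂ)) / n.factorial

/-- The generating function (e^t - 1) Σ B_n(1/2) t^n/n! = t e^(t/2), multiplied by e^(-t/2) to make
it symmetric. -/
theorem bernoulliHalf_mul :
    bernoulliHalf * (rescale (1 / 2 : ℂ) (exp ℂ) - rescale (-(1 / 2) : ℂ) (exp ℂ)) = X := by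
  have h := Polynomial.bernoulli_generating_function (A := ℂ) (1 / 2)
  have h1 : (PowerSeries.mk fun n => Polynomial.aeval (1 / 2 : ℂ)
      ((1 / (n.factorial : ℚ) : ℚ) • Polynomial.bernoulli n)) = bernoulliHalf := by
    ext n
    rw [bernoulliHalf, coeff_mk, coeff_mk, map_smul]
    have := Polynomial.aeval_algebraMap_apply ℂ (1 / 2 : ℚ) (Polynomial.bernoulli n)
    rw [show algebraMap ℚ ℂ (1 / 2) = 1 / 2 by simp] at this
    rw [this, Polynomial.coe_aeval_eq_eval, Algebra.smul_def]
    simp [div_eq_inv_mul]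
  rw [h1] at h
  have h2 := congrArg (· * rescale (-(1 / 2) : ℂ) (exp ℂ)) h
  have e1 : exp ℂ * rescale (-(1 / 2) : ℂ) (exp ℂ) = rescale (1 / 2 : ℂ) (exp ℂ) := by
    have := exp_mul_exp_eq_exp_add (A := ℂ) 1 (-(1 / 2))
    rw [rescale_one, RingHom.id_apply] at this
    rw [this]
    norm_num
  have e2 : rescale (1 / 2 : ℂ) (exp ℂ) * rescale (-(1 / 2) : ℂ) (exp ℂ) = 1 := by
    rw [exp_mul_exp_eq_exp_add, add_neg_cancel]
    ext n
    rw [coeff_rescale, coeff_exp, coeff_one]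
    rcases n with _ | n <;> simp
  rw [mul_assoc, mul_assoc, sub_mul, one_mul, e1, e2, mul_one] at h2
  exact h2

/-- At t = 2icz the quotient t/(e^(t/2) - e^(-t/2)) is cz/sin(cz). -/
theorem taylorSeries_sincC_mul_bernoulliHalf {c : ℂ} (hc : c ≠ 0) :
    taylorSeries (fun z => sincC (c * z)) * rescale (2 * I * c) bernoulliHalf = 1 := by
  have h1 := congrArg (rescale (2 * I * c)) bernoulliHalf_mul
  rw [map_mul, map_sub, rescale_rescale, rescale_rescale, rescale_X,
    show (1 / 2 * (2 * I * c) : ℂ) = I * c by ring,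
    show (-(1 / 2) * (2 * I * c) : ℂ) = -(I * c) by ring] at h1
  have h2 := C_mul_X_mul_taylorSeries_sincC c
  have hX : (C c * X : PowerSeries ℂ) ≠ 0 :=
    mul_ne_zero (by simpa using hc) X_ne_zero
  apply mul_left_cancel₀ hX
  rw [← mul_assoc, h2, mul_one, mul_assoc, mul_comm (_ - _), h1, ← mul_assoc, ← map_mul]
  congr 2
  field_simp

/-- From f' = 2αzf the coefficients satisfy (n+2)a_(n+2) = 2αa_n; together with a_0 = 1 and a_1 = 0
this determines the series. -/
theorem taylorSeries_exp_sq (α : ℂ) :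
    taylorSeries (fun z => Complex.exp (α * z ^ 2)) =
      expand 2 two_ne_zero (rescale α (exp ℂ)) := by
  set f : ℂ → ℂ := fun z => Complex.exp (α * z ^ 2) with hf
  have hd : deriv f = fun z => (2 * α) * z * f z := by
    ext z
    have := (((hasDerivAt_pow 2 z).const_mul α).cexp).deriv
    rw [hf]
    simp only
    rw [this]
    push_cast
    ring
  have hfa : AnalyticAt ℂ f 0 := (by fun_prop : Differentiable ℂ f).analyticAt 0
  have hrec : ∀ n, coeff (n + 2) (taylorSeries f) * (n + 2) = 2 * α * coeff n (taylorSeries f) := by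
    intro n
    have h1 : taylorSeries (deriv f) = C (2 * α) * X * taylorSeries f := by
      rw [hd, ← taylorSeries_const_mul_id,
        ← taylorSeries_mul ((by fun_prop : Differentiable ℂ fun z : ℂ => 2 * α * z).analyticAt 0) hfa]
    have h2 := congrArg (coeff (n + 1)) h1
    rw [coeff_taylorSeries, ← iteratedDeriv_succ', mul_assoc, coeff_C_mul, coeff_succ_X_mul] at h2
    rw [← h2, coeff_taylorSeries, show n + 2 = n + 1 + 1 by rfl, Nat.factorial_succ (n + 1)]
    have hfac : (((n + 1).factorial : ℕ) : ℂ) ≠ 0 := by exact_mod_cast (n + 1).factorial_ne_zero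
    have hn : (n + 1 + 1 : ℂ) ≠ 0 := by exact_mod_cast (n + 1).succ_ne_zero
    push_cast
    field_simp
    ring
  have h0 : coeff 0 (taylorSeries f) = 1 := by
    rw [coeff_taylorSeries]
    simp [hf]
  have h1 : coeff 1 (taylorSeries f) = 0 := by
    rw [coeff_taylorSeries, iteratedDeriv_one, hd]
    simp
  ext n
  induction n using Nat.strong_induction_on with
  | _ n ih =>
    rcases n with _ | _ | n
    · rw [h0, coeff_expand]
      simp
    · rw [h1, coeff_expand, if_neg (by norm_num)]
    · have hn : (n + 2 : ℂ) ≠ 0 := by exact_mod_cast (n + 1).succ_ne_zero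
      apply mul_right_cancel₀ hn
      rw [hrec, ih n (by omega), coeff_expand, coeff_expand]
      by_cases h2 : 2 ∣ n
      · obtain ⟨b, rfl⟩ := h2
        rw [if_pos (by omega), if_pos (by omega), show (2 * b + 1 + 1) / 2 = b + 1 by omega,
          show 2 * b / 2 = b by omega, coeff_rescale, coeff_rescale, coeff_exp, coeff_exp,
          Nat.factorial_succ]
        have hfac : ((b.factorial : ℕ) : ℂ) ≠ 0 := by exact_mod_cast b.factorial_ne_zero
        have hb : (b + 1 : ℂ) ≠ 0 := by exact_mod_cast b.succ_ne_zero
        simp only [one_div, map_inv₀, map_natCast, Nat.cast_mul, map_mul]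
        push_cast
        field_simp
        ring
      · rw [if_neg (by omega), if_neg (by omega)]
        simp

theorem eq_expand_of_coeff_odd {φ : PowerSeries ℂ} (h : ∀ n, ¬ 2 ∣ n → coeff n φ = 0) :
    φ = expand 2 two_ne_zero (PowerSeries.mk fun n => coeff (2 * n) φ) := by
  ext n
  rw [coeff_expand]
  split_ifs with h2
  · rw [coeff_mk, Nat.mul_div_cancel' h2]
  · exact h n h2

theorem coeff_mul_three_expand (f g h : PowerSeries ℂ) (j : ℕ) :
    coeff (2 * j) (expand 2 two_ne_zero f * (expand 2 two_ne_zero g * expand 2 two_ne_zero h)) =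
      ∑ p ∈ Finset.HasAntidiagonal.antidiagonal j, ∑ r ∈ Finset.HasAntidiagonal.antidiagonal p.2,
        coeff p.1 f * (coeff r.1 g * coeff r.2 h) := by
  rw [← map_mul, ← map_mul, coeff_expand_mul, coeff_mul]
  refine Finset.sum_congr rfl fun p _ => ?_
  rw [coeff_mul, Finset.mul_sum]

/-- The even Taylor coefficients of `exp (α z ^ 2) (sin (c z) / c z) (c' z / sin (c' z))`. -/
theorem coeff_taylorSeries_exp_sq_mul_sincC_div {α c c' : ℂ} (hc : c ≠ 0) (hc' : c' ≠ 0) (j : ℕ) :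
    coeff (2 * j) (taylorSeries fun z =>
        Complex.exp (α * z ^ 2) * (sincC (c * z) * (sincC (c' * z))⁻¹)) =
      ∑ p ∈ Finset.HasAntidiagonal.antidiagonal j, ∑ r ∈ Finset.HasAntidiagonal.antidiagonal p.2,
        (α ^ p.1 / p.1.factorial) *
          (((-1) ^ r.1 * c ^ (2 * r.1) / (2 * r.1 + 1).factorial) *
            ((2 * I * c') ^ (2 * r.2) *
              ((((Polynomial.bernoulli (2 * r.2)).eval (1 / 2 : ℚ) : ℚ) : ℂ)) /
                (2 * r.2).factorial)) := by
  have hs0 : sincC (c' * 0) ≠ 0 := by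
    rw [mul_zero, sincC_zero]
    exact one_ne_zero
  have hE : AnalyticAt ℂ (fun z : ℂ => Complex.exp (α * z ^ 2)) 0 :=
    (by fun_prop : Differentiable ℂ fun z : ℂ => Complex.exp (α * z ^ 2)).analyticAt 0
  have hS := analyticAt_sincC_mul c 0
  have hS' := analyticAt_sincC_mul c' 0
  have hinv : AnalyticAt ℂ (fun z => (sincC (c' * z))⁻¹) 0 := hS'.inv hs0
  have h1 : taylorSeries (fun z => (sincC (c' * z))⁻¹) = rescale (2 * I * c') bernoulliHalf := by
    have h2 := taylorSeries_mul hS' hinv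
    have h3 : taylorSeries (fun z => sincC (c' * z) * (sincC (c' * z))⁻¹) = 1 := by
      have h4 : (fun z => sincC (c' * z) * (sincC (c' * z))⁻¹) =ᶠ[nhds 0] fun _ => (1 : ℂ) := by
        filter_upwards [hS'.continuousAt.eventually_ne hs0] with z hz
        exact mul_inv_cancel₀ hz
      ext n
      rw [coeff_taylorSeries, h4.iteratedDeriv_eq, iteratedDeriv_const, coeff_one]
      split_ifs with h5 <;> simp [h5]
    rw [h3] at h2
    have h4 := taylorSeries_sincC_mul_bernoulliHalf hc'
    have h5 : taylorSeries (fun z => sincC (c' * z)) ≠ 0 := by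
      intro h6
      rw [h6, zero_mul] at h4
      exact zero_ne_one h4
    apply mul_left_cancel₀ h5
    rw [← h2, h4]
  have hev : taylorSeries (fun z => sincC (c * z)) = expand 2 two_ne_zero
      (PowerSeries.mk fun n => coeff (2 * n) (taylorSeries fun z => sincC (c * z))) :=
    eq_expand_of_coeff_odd fun n hn => by rw [coeff_taylorSeries_sincC hc, if_neg hn]
  -- Evenness is taken from the function itself, so that the vanishing of B_n(1/2) for odd n is not
  -- needed.
  have hev' : taylorSeries (fun z => (sincC (c' * z))⁻¹) = expand 2 two_ne_zero
      (PowerSeries.mk fun n => coeff (2 * n) (taylorSeries fun z => (sincC (c' * z))⁻¹)) := by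
    refine eq_expand_of_coeff_odd fun n hn => ?_
    rw [coeff_taylorSeries]
    have h2 := iteratedDeriv_comp_neg n (fun z => (sincC (c' * z))⁻¹) 0
    have h3 : ∀ w, sincC (-w) = sincC w := by
      intro w
      rcases eq_or_ne w 0 with rfl | hw
      · simp
      · apply mul_left_cancel₀ hw
        rw [mul_sincC]
        have := mul_sincC (-w)
        rw [Complex.sin_neg] at this
        linear_combination -this
    simp only [mul_neg, h3, neg_zero] at h2
    rw [Odd.neg_one_pow (by rw [← Nat.not_even_iff_odd, even_iff_two_dvd]; exact hn), neg_smul,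
      one_smul] at h2
    have h4 : iteratedDeriv n (fun z => (sincC (c' * z))⁻¹) 0 = 0 := by
      linear_combination h2 / 2
    rw [h4, zero_div]
  have hm : AnalyticAt ℂ (fun z => sincC (c * z) * (sincC (c' * z))⁻¹) 0 := hS.mul hinv
  rw [taylorSeries_mul hE hm, taylorSeries_mul hS hinv, taylorSeries_exp_sq, hev, hev',
    coeff_mul_three_expand]
  refine Finset.sum_congr rfl fun p _ => Finset.sum_congr rfl fun r _ => ?_
  rw [coeff_mk, coeff_mk, h1, coeff_taylorSeries_sincC hc, if_pos ⟨_, rfl⟩, coeff_rescale,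
    coeff_rescale, coeff_exp, bernoulliHalf, coeff_mk, Nat.mul_div_cancel_left _ (by norm_num)]
  simp only [one_div, map_inv₀, map_natCast]
  rw [mul_div_assoc, ← div_eq_mul_inv]
  congr 2
  rw [mul_div_assoc]

end UnimodalRank

end

section

open Filter Topology

namespace UnimodalRank

/-! ### Half of the theta function -/

/-- The sum over positive indices of the theta function at `2 z`. -/
noncomputable def halfTheta (z τ : ℂ) : ℂ :=
  ∑' n : ℕ, (-1 : ℂ) ^ n *
    exp (Real.pi * I * ((n : ℂ) + 1 / 2) ^ 2 * τ + 2 * Real.pi * I * (2 * n + 1) * z)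

theorem norm_halfTheta_term (n : ℕ) (z τ : ℂ) :
    ‖exp (Real.pi * I * ((n : ℂ) + 1 / 2) ^ 2 * τ + 2 * Real.pi * I * (2 * n + 1) * z)‖ =
      Real.exp (-(Real.pi * ((n : ℝ) + 1 / 2) ^ 2 * τ.im) - 2 * Real.pi * (2 * n + 1) * z.im) := by
  rw [Complex.norm_exp]
  congr 1
  rw [show Real.pi * I * ((n : ℂ) + 1 / 2) ^ 2 * τ + 2 * Real.pi * I * (2 * n + 1) * z =
    ((Real.pi * ((n : ℝ) + 1 / 2) ^ 2 : ℝ) : ℂ) * (I * τ) +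
      ((2 * Real.pi * (2 * n + 1) : ℝ) : ℂ) * (I * z) by push_cast; ring,
    add_re, re_ofReal_mul, re_ofReal_mul, I_mul_re, I_mul_re]
  ring

/-- The polynomial factor is at most m! exp(2n+1), which only replaces c by c + 1; the rest is
dominated by the majorant of the terms of `jacobiTheta₂`. -/
theorem summable_halfTheta_bound {t : ℝ} (ht : 0 < t) (m : ℕ) (c : ℝ) :
    Summable fun n : ℕ => (2 * n + 1 : ℝ) ^ m *
      Real.exp (-(Real.pi * ((n : ℝ) + 1 / 2) ^ 2 * t) + (2 * n + 1) * c) := by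
  have h := (summable_pow_mul_jacobiTheta₂_term_bound ((c + 1) / Real.pi) ht 0).comp_injective
    (Nat.cast_injective (R := ℤ))
  refine Summable.of_nonneg_of_le (fun n => by positivity) (fun n => ?_)
    (h.mul_left (m.factorial * Real.exp (c + 1)))
  have h1 : (2 * n + 1 : ℝ) ^ m ≤ m.factorial * Real.exp (2 * n + 1) := by
    have := Real.pow_div_factorial_le_exp (2 * n + 1 : ℝ) (by positivity) m
    rw [div_le_iff₀ (by positivity)] at this
    linarith
  simp only [Function.comp, pow_zero, one_mul, Int.cast_natCast, Nat.abs_cast]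
  calc (2 * n + 1 : ℝ) ^ m * Real.exp (-(Real.pi * ((n : ℝ) + 1 / 2) ^ 2 * t) + (2 * n + 1) * c)
      ≤ m.factorial * Real.exp (2 * n + 1) *
        Real.exp (-(Real.pi * ((n : ℝ) + 1 / 2) ^ 2 * t) + (2 * n + 1) * c) := by gcongr
    _ = m.factorial * Real.exp (-(Real.pi * ((n : ℝ) + 1 / 2) ^ 2 * t) + (2 * n + 1) * (c + 1)) := by
        rw [mul_assoc, ← Real.exp_add]
        congr 2
        ring
    _ ≤ m.factorial * Real.exp (c + 1 + -Real.pi * (t * n ^ 2 - 2 * ((c + 1) / Real.pi) * n)) := by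
        have e1 : -Real.pi * (t * n ^ 2 - 2 * ((c + 1) / Real.pi) * n) =
            -(Real.pi * n ^ 2 * t) + 2 * (c + 1) * n := by
          have := Real.pi_ne_zero
          field_simp
          ring
        have : 0 ≤ Real.pi * (n + 1 / 4) * t := by positivity
        rw [e1]
        exact mul_le_mul_of_nonneg_left (Real.exp_le_exp.2 (by nlinarith)) (by positivity)
    _ = _ := by rw [Real.exp_add, ← mul_assoc]

theorem norm_halfTheta_deriv_term_le {τ : ℂ} (m n : ℕ) {z : ℂ} {R : ℝ} (hz : |z.im| ≤ R) :
    ‖(2 * Real.pi * I * (2 * n + 1) : ℂ) ^ m * ((-1 : ℂ) ^ n *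
      exp (Real.pi * I * ((n : ℂ) + 1 / 2) ^ 2 * τ + 2 * Real.pi * I * (2 * n + 1) * z))‖ ≤
      (2 * Real.pi) ^ m * ((2 * n + 1 : ℝ) ^ m *
        Real.exp (-(Real.pi * ((n : ℝ) + 1 / 2) ^ 2 * τ.im) + (2 * n + 1) * (2 * Real.pi * R))) := by
  have h1 : ‖(2 * Real.pi * I * (2 * n + 1) : ℂ)‖ = 2 * Real.pi * (2 * n + 1) := by
    rw [show (2 * Real.pi * I * (2 * n + 1) : ℂ) = ((2 * Real.pi * (2 * n + 1) : ℝ) : ℂ) * I by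
      push_cast; ring, norm_mul, norm_I, mul_one, Complex.norm_real,
      Real.norm_of_nonneg (by positivity)]
  rw [norm_mul, norm_pow, h1, norm_mul, norm_pow, norm_neg, norm_one, one_pow, one_mul,
    norm_halfTheta_term, mul_pow, mul_assoc]
  gcongr
  have h2 : -z.im ≤ R := (neg_le_abs _).trans hz
  have h3 : 0 ≤ 2 * Real.pi * (2 * n + 1) := by positivity
  nlinarith

theorem hasDerivAt_halfTheta_aux {τ : ℂ} (hτ : 0 < τ.im) (m : ℕ) (z : ℂ) :
    HasDerivAt (fun u : ℂ => ∑' n : ℕ, (2 * Real.pi * I * (2 * n + 1) : ℂ) ^ m * ((-1 : ℂ) ^ n *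
        exp (Real.pi * I * ((n : ℂ) + 1 / 2) ^ 2 * τ + 2 * Real.pi * I * (2 * n + 1) * u)))
      (∑' n : ℕ, (2 * Real.pi * I * (2 * n + 1) : ℂ) ^ (m + 1) * ((-1 : ℂ) ^ n *
        exp (Real.pi * I * ((n : ℂ) + 1 / 2) ^ 2 * τ + 2 * Real.pi * I * (2 * n + 1) * z))) z := by
  set R : ℝ := |z.im| + 1 with hR
  set t : Set ℂ := {u | -R < u.im} ∩ {u | u.im < R} with ht
  have hto : IsOpen t := (isOpen_lt continuous_const Complex.continuous_im).inter
    (isOpen_lt Complex.continuous_im continuous_const)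
  have htc : IsPreconnected t :=
    ((convex_halfSpace_im_gt _).inter (convex_halfSpace_im_lt _)).isPreconnected
  have hmem : ∀ u ∈ t, |u.im| ≤ R := fun u hu => abs_le.2 ⟨le_of_lt hu.1, le_of_lt hu.2⟩
  have hzt : z ∈ t := by
    have h1 := neg_abs_le z.im
    have h2 := le_abs_self z.im
    refine ⟨?_, ?_⟩ <;> simp only [Set.mem_ofPred_eq, hR] <;> linarith
  refine hasDerivAt_tsum_of_isPreconnected
    ((summable_halfTheta_bound hτ (m + 1) (2 * Real.pi * R)).mul_left ((2 * Real.pi) ^ (m + 1)))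
    hto htc (g := fun (n : ℕ) (u : ℂ) => (2 * Real.pi * I * (2 * n + 1) : ℂ) ^ m * ((-1 : ℂ) ^ n *
        exp (Real.pi * I * ((n : ℂ) + 1 / 2) ^ 2 * τ + 2 * Real.pi * I * (2 * n + 1) * u)))
    (fun n y _ => ?_) (fun n y hy => norm_halfTheta_deriv_term_le (m + 1) n (hmem y hy)) hzt ?_ hzt
  · have := ((((hasDerivAt_id y).const_mul (2 * Real.pi * I * (2 * n + 1) : ℂ)).const_add
      (Real.pi * I * ((n : ℂ) + 1 / 2) ^ 2 * τ)).cexp.const_mul ((-1 : ℂ) ^ n)).const_mul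
      ((2 * Real.pi * I * (2 * n + 1) : ℂ) ^ m)
    convert! this using 1
    simp only [id]
    ring
  · exact Summable.of_norm_bounded
      ((summable_halfTheta_bound hτ m (2 * Real.pi * R)).mul_left ((2 * Real.pi) ^ m))
      fun n => norm_halfTheta_deriv_term_le m n (hmem z hzt)

theorem iteratedDeriv_halfTheta {τ : ℂ} (hτ : 0 < τ.im) (m : ℕ) :
    iteratedDeriv m (fun z => halfTheta z τ) = fun z =>
      ∑' n : ℕ, (2 * Real.pi * I * (2 * n + 1) : ℂ) ^ m * ((-1 : ℂ) ^ n *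
        exp (Real.pi * I * ((n : ℂ) + 1 / 2) ^ 2 * τ + 2 * Real.pi * I * (2 * n + 1) * z)) := by
  induction m with
  | zero =>
    ext z
    simp [halfTheta]
  | succ m ih =>
    rw [iteratedDeriv_succ, ih]
    ext z
    exact (hasDerivAt_halfTheta_aux hτ m z).deriv

theorem iteratedDeriv_halfTheta_zero {τ : ℂ} (hτ : 0 < τ.im) (m : ℕ) :
    iteratedDeriv m (fun z => halfTheta z τ) 0 =
      (2 * Real.pi * I) ^ m * partialThetaMoment m τ := by
  rw [iteratedDeriv_halfTheta hτ, partialThetaMoment, ← tsum_mul_left]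
  refine tsum_congr fun n => ?_
  rw [mul_zero, add_zero, mul_pow]
  ring

theorem differentiable_halfTheta {τ : ℂ} (hτ : 0 < τ.im) :
    Differentiable ℂ fun z => halfTheta z τ := by
  intro z
  have := hasDerivAt_halfTheta_aux hτ 0 z
  simp only [pow_zero, one_mul] at this
  exact this.differentiableAt

/-- The condition on z keeps the shift inside the sign below 1/2 in absolute value, so the sign is
that of n + 1/2: terms with n < 0 cancel and the others double. -/
theorem jacobiVartheta_add_falseTheta {z τ : ℂ} (hτ : 0 < τ.im) (hz : 4 * |z.im| < τ.im) :
    jacobiVartheta (2 * z) τ + falseTheta (2 * z) τ = 2 * I * halfTheta z τ := by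
  have hs : Summable fun n : ℤ => (-1 : ℂ) ^ n *
      exp (Real.pi * I * ((n : ℂ) + 1 / 2) ^ 2 * τ + 2 * Real.pi * I * ((n : ℂ) + 1 / 2) * (2 * z)) := by
    simp only [jacobiVartheta_term_eq]
    exact ((summable_jacobiTheta₂_term_iff _ _).2 hτ).mul_left _
  have hz2 : |(2 * z).im / τ.im| < 1 / 2 := by
    rw [abs_div, abs_of_pos hτ, div_lt_iff₀ hτ, show (2 * z).im = 2 * z.im by simp, abs_mul, abs_two]
    linarith
  have hsgn : ∀ n : ℤ, Real.sign ((n : ℝ) + 1 / 2 + (2 * z).im / τ.im) = if 0 ≤ n then 1 else -1 := by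
    intro n
    have h1 := abs_lt.1 hz2
    split_ifs with h
    · have : (0 : ℝ) ≤ n := by exact_mod_cast h
      exact Real.sign_of_pos (by linarith [h1.1])
    · have : (n : ℝ) ≤ -1 := by
        have : n ≤ -1 := by omega
        exact_mod_cast this
      exact Real.sign_of_neg (by linarith [h1.2])
  have hs2 : Summable fun n : ℤ => (Real.sign ((n : ℝ) + 1 / 2 + (2 * z).im / τ.im) : ℂ) *
      (-1 : ℂ) ^ n * exp (Real.pi * I * ((n : ℂ) + 1 / 2) ^ 2 * τ +
        2 * Real.pi * I * ((n : ℂ) + 1 / 2) * (2 * z)) := by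
    refine Summable.of_norm (hs.norm.congr fun n => ?_)
    rw [mul_assoc (Real.sign _ : ℂ), norm_mul (Real.sign _ : ℂ), hsgn]
    split_ifs <;> simp
  rw [jacobiVartheta, falseTheta, ← mul_add, ← hs.tsum_add hs2, halfTheta]
  have hinj := Nat.cast_injective (R := ℤ)
  rw [← hinj.tsum_eq]
  · rw [mul_comm (2 : ℂ) I, mul_assoc I 2]
    congr 1
    rw [← tsum_mul_left]
    refine tsum_congr fun n => ?_
    rw [hsgn, if_pos (Int.natCast_nonneg n)]
    have : exp (Real.pi * I * (((n : ℤ) : ℂ) + 1 / 2) ^ 2 * τ +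
        2 * Real.pi * I * (((n : ℤ) : ℂ) + 1 / 2) * (2 * z)) =
        exp (Real.pi * I * ((n : ℂ) + 1 / 2) ^ 2 * τ + 2 * Real.pi * I * (2 * n + 1) * z) := by
      congr 1
      push_cast
      ring
    rw [this]
    simp only [zpow_natCast, ofReal_one]
    ring
  · intro n hn
    by_contra hcon
    apply hn
    have hneg : ¬ 0 ≤ n := fun h => hcon ⟨n.toNat, Int.toNat_of_nonneg h⟩
    beta_reduce
    rw [hsgn, if_neg hneg]
    push_cast
    ring

/-! ### The crank factor -/

theorem differentiable_qPochhammerInf {q : ℂ} (hq : ‖q‖ < 1) :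
    Differentiable ℂ fun a => qPochhammerInf a q := by
  intro a
  have hs : Summable fun n : ℕ => (‖a‖ + 1) * ‖q‖ ^ n :=
    (summable_geometric_of_lt_one (norm_nonneg _) hq).mul_left _
  have h := hs.hasProdLocallyUniformlyOn_nat_one_add (K := Metric.ball (0 : ℂ) (‖a‖ + 1))
    (f := fun n a => -(a * q ^ n)) Metric.isOpen_ball (Eventually.of_forall fun n x hx => by
      rw [norm_neg, norm_mul, norm_pow]
      have : ‖x‖ < ‖a‖ + 1 := by simpa using hx
      gcongr) (fun n => by fun_prop)
  have h2 := h.differentiableOn (Eventually.of_forall fun s => by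
    simpa [Finset.prod_fn] using! DifferentiableOn.finsetProd (fun _ _ => by fun_prop))
    Metric.isOpen_ball
  have h3 := h2.differentiableAt (Metric.isOpen_ball.mem_nhds (show a ∈ _ by simp))
  simpa only [qPochhammerInf, sub_eq_add_neg] using h3

theorem differentiable_crankDenom {τ : ℂ} (hτ : 0 < τ.im) :
    Differentiable ℂ fun z => crankDenom z τ := by
  have h := differentiable_qPochhammerInf (norm_exp_two_pi_I_mul hτ)
  unfold crankDenom
  simp only [← Complex.exp_neg]
  exact (h.comp (f := fun z => exp (2 * Real.pi * I * z) * exp (2 * Real.pi * I * τ))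
    (by fun_prop)).mul (h.comp
      (f := fun z => exp (-(2 * Real.pi * I * z)) * exp (2 * Real.pi * I * τ)) (by fun_prop))

theorem crankDenom_neg (z τ : ℂ) : crankDenom (-z) τ = crankDenom z τ := by
  rw [crankDenom, crankDenom, mul_neg, Complex.exp_neg, inv_inv, mul_comm]

theorem norm_exp_two_pi_I (z : ℂ) : ‖exp (2 * Real.pi * I * z)‖ = Real.exp (-(2 * Real.pi * z.im)) := by
  rw [Complex.norm_exp, show 2 * Real.pi * I * z = ((2 * Real.pi : ℝ) : ℂ) * (I * z) by
    push_cast; ring, re_ofReal_mul, I_mul_re]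
  congr 1
  ring

theorem crankDenom_ne_zero {z τ : ℂ} (hz : |z.im| < τ.im) : crankDenom z τ ≠ 0 := by
  have hτ : 0 < τ.im := (abs_nonneg _).trans_lt hz
  have hq := norm_exp_two_pi_I_mul hτ
  have h1 := abs_lt.1 hz
  have key : ∀ w : ℂ, ‖w‖ * ‖exp (2 * Real.pi * I * τ)‖ < 1 → ∀ n : ℕ,
      w * exp (2 * Real.pi * I * τ) * exp (2 * Real.pi * I * τ) ^ n ≠ 1 := by
    intro w hw n h
    have h2 := congrArg norm h
    rw [norm_mul, norm_mul, norm_pow, norm_one] at h2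
    have h3 := mul_lt_mul_of_lt_of_le_of_nonneg_of_pos hw
      (pow_le_one₀ (norm_nonneg _) hq.le (n := n)) (by positivity) one_pos
    rw [one_mul] at h3
    linarith
  refine mul_ne_zero (qPochhammerInf_ne_zero hq (key _ ?_)) (qPochhammerInf_ne_zero hq (key _ ?_))
  · rw [norm_exp_two_pi_I, norm_exp_two_pi_I, ← Real.exp_add, Real.exp_lt_one_iff]
    nlinarith [Real.pi_pos]
  · rw [← Complex.exp_neg, ← mul_neg, norm_exp_two_pi_I, norm_exp_two_pi_I, ← Real.exp_add,
      Real.exp_lt_one_iff, neg_im]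
    nlinarith [Real.pi_pos]

theorem norm_qPochhammerInf_sub_one_le (a : ℂ) {q : ℂ} (hq : ‖q‖ < 1) :
    ‖qPochhammerInf a q - 1‖ ≤ Real.exp (‖a‖ / (1 - ‖q‖)) - 1 := by
  refine le_of_tendsto ((tendsto_qPochhammerInf a hq).sub_const 1).norm
    (Eventually.of_forall fun N => ?_)
  have h := Finset.norm_prod_one_add_sub_one_le (Finset.range N) fun n => -(a * q ^ n)
  simp only [← sub_eq_add_neg, norm_neg, norm_mul, norm_pow] at h
  refine h.trans ?_
  gcongr
  rw [← Finset.mul_sum, div_eq_mul_inv, ← tsum_geometric_of_lt_one (norm_nonneg _) hq]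
  gcongr
  exact (summable_geometric_of_lt_one (norm_nonneg _) hq).sum_le_tsum _ fun _ _ => by positivity

/-- Here |q| ≤ 1/20 and |ζ^(±1)| ≤ 3, so each symbol is within 8|q| of 1 and the product within
19.2|q| ≤ 0.96. The product then has modulus at least 1/25, and 480 = 19.2 · 25. -/
theorem norm_inv_crankDenom_sub_one_le {z τ : ℂ} (hτ : 1 / 2 ≤ τ.im) (hz : ‖z‖ ≤ 1 / 8) :
    ‖(crankDenom z τ)⁻¹ - 1‖ ≤ 480 * ‖exp (2 * Real.pi * I * τ)‖ := by
  set q := exp (2 * Real.pi * I * τ) with hqdef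
  have hpi3 := Real.pi_gt_three
  have hq1 : ‖q‖ ≤ 1 / 20 := by
    rw [hqdef, norm_exp_two_pi_I]
    have h1 : Real.exp (-(2 * Real.pi * τ.im)) ≤ Real.exp (-3) := Real.exp_le_exp.2 (by nlinarith)
    have h2 : Real.exp (-3) = (Real.exp 1 ^ 3)⁻¹ := by
      rw [Real.exp_neg, ← Real.exp_nat_mul]
      norm_num
    have h3 : (20 : ℝ) ≤ Real.exp 1 ^ 3 := by
      have := Real.exp_one_gt_d9
      calc (20 : ℝ) ≤ 2.7182818283 ^ 3 := by norm_num
        _ ≤ _ := by gcongr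
    rw [h2] at h1
    refine h1.trans ?_
    rw [one_div]
    gcongr
  have hq : ‖q‖ < 1 := by linarith
  have hP : ∀ w : ℂ, ‖w‖ ≤ 3 → ‖qPochhammerInf (w * q) q - 1‖ ≤ 8 * ‖q‖ := by
    intro w hw
    refine (norm_qPochhammerInf_sub_one_le _ hq).trans ?_
    have h1 : ‖w * q‖ / (1 - ‖q‖) ≤ 4 * ‖q‖ := by
      rw [div_le_iff₀ (by linarith), norm_mul]
      nlinarith [norm_nonneg q, norm_nonneg w]
    have h0 : 0 ≤ ‖w * q‖ / (1 - ‖q‖) := div_nonneg (norm_nonneg _) (by linarith)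
    have h2 := Real.abs_exp_sub_one_le (x := ‖w * q‖ / (1 - ‖q‖))
      (by rw [abs_of_nonneg h0]; linarith)
    rw [abs_of_nonneg h0] at h2
    linarith [le_abs_self (Real.exp (‖w * q‖ / (1 - ‖q‖)) - 1)]
  have hζ : ∀ w : ℂ, ‖w‖ ≤ 1 / 8 → ‖exp (2 * Real.pi * I * w)‖ ≤ 3 := by
    intro w hw
    rw [norm_exp_two_pi_I]
    have h1 := (neg_abs_le w.im)
    have h2 := (Complex.abs_im_le_norm w).trans hw
    have h3 := Real.pi_lt_four
    calc Real.exp (-(2 * Real.pi * w.im)) ≤ Real.exp 1 := Real.exp_le_exp.2 (by nlinarith)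
      _ ≤ 3 := by linarith [Real.exp_one_lt_d9]
  have hu := hP _ (hζ z hz)
  have hv := hP _ (hζ (-z) (by rwa [norm_neg]))
  rw [mul_neg, Complex.exp_neg] at hv
  rw [crankDenom, ← hqdef]
  set P := qPochhammerInf (exp (2 * Real.pi * I * z) * q) q
  set P' := qPochhammerInf ((exp (2 * Real.pi * I * z))⁻¹ * q) q
  have hn0 := norm_nonneg q
  have h1 : ‖P * P' - 1‖ ≤ 19.2 * ‖q‖ := by
    rw [show P * P' - 1 = (P - 1) + (P' - 1) + (P - 1) * (P' - 1) by ring]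
    refine (norm_add_le _ _).trans ?_
    have h2 := norm_add_le (P - 1) (P' - 1)
    have h3 : ‖(P - 1) * (P' - 1)‖ ≤ 8 * ‖q‖ * (8 * ‖q‖) := by
      rw [norm_mul]
      gcongr
    nlinarith
  have h2 : 1 / 25 ≤ ‖P * P'‖ := by
    have h3 := norm_sub_norm_le (1 : ℂ) (1 - P * P')
    rw [sub_sub_cancel, norm_one, norm_sub_rev] at h3
    linarith
  have h3 : P * P' ≠ 0 := norm_pos_iff.1 (by linarith)
  rw [show (P * P')⁻¹ - 1 = -((P * P' - 1) * (P * P')⁻¹) by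
    rw [sub_mul, one_mul, mul_inv_cancel₀ h3]; ring, norm_neg, norm_mul,
    norm_inv]
  have h4 : ‖P * P'‖⁻¹ ≤ 25 := by
    rw [inv_le_comm₀ (by linarith) (by norm_num)]
    linarith
  calc ‖P * P' - 1‖ * ‖P * P'‖⁻¹ ≤ 19.2 * ‖q‖ * 25 := by gcongr
    _ = _ := by ring

/-- `q^{-1/12} / ((ζ q; q)_∞ (ζ⁻¹ q; q)_∞)`, the quotient of `𝒞*` by `η`. -/
noncomputable def crankQuot (z τ : ℂ) : ℂ :=
  exp (-(2 * Real.pi * I * τ / 12)) * (crankDenom z τ)⁻¹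

theorem crankStar_div_eta {τ : ℂ} (hτ : 0 < τ.im) (z : ℂ) :
    crankStar z τ / ModularForm.eta τ = crankQuot z τ := by
  have h1 := qPochhammerInf_self_ne_zero (norm_exp_two_pi_I_mul hτ)
  rw [crankStar, crankGen, eta_eq_qPochhammerInf, crankQuot, ← crankDenom]
  rw [show -(2 * Real.pi * I * τ / 12) = -(2 * Real.pi * I * τ / 24) + -(2 * Real.pi * I * τ / 24) by
    ring, Complex.exp_add, Complex.exp_neg]
  have h2 := Complex.exp_ne_zero (2 * Real.pi * I * τ / 24)
  by_cases h3 : crankDenom z τ = 0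
  · simp [h3]
  · field_simp

theorem calU1_eq {z τ : ℂ} (hτ : 0 < τ.im) (hz : 4 * |z.im| < τ.im) :
    calU1 z τ = crankQuot z τ * halfTheta z τ := by
  rw [calU1, jacobiVartheta_add_falseTheta hτ hz, ← crankStar_div_eta hτ]
  rw [show -(I * crankStar z τ / (2 * ModularForm.eta τ)) =
    -I / 2 * (crankStar z τ / ModularForm.eta τ) by rw [mul_comm (2 : ℂ), ← div_div]; ring]
  linear_combination (-(crankStar z τ / ModularForm.eta τ) * halfTheta z τ) * I_sq

theorem analyticAt_crankQuot {τ : ℂ} (hτ : 0 < τ.im) : AnalyticAt ℂ (fun z => crankQuot z τ) 0 :=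
  analyticAt_const.mul (((differentiable_crankDenom hτ).analyticAt 0).inv
    (crankDenom_ne_zero (by simpa using hτ)))

theorem calU1_eventuallyEq {τ : ℂ} (hτ : 0 < τ.im) :
    (fun z => calU1 z τ) =ᶠ[𝓝 0] fun z => crankQuot z τ * halfTheta z τ := by
  have hc : Continuous fun z : ℂ => 4 * |z.im| := by fun_prop
  filter_upwards [hc.continuousAt.eventually_lt (x₀ := (0 : ℂ)) continuousAt_const
    (show 4 * |(0 : ℂ).im| < τ.im by simpa using hτ)] with z hz
  exact calU1_eq hτ hz

theorem analyticAt_calU1 {τ : ℂ} (hτ : 0 < τ.im) : AnalyticAt ℂ (fun z => calU1 z τ) 0 :=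
  ((analyticAt_crankQuot hτ).mul ((differentiable_halfTheta hτ).analyticAt 0)).congr
    (calU1_eventuallyEq hτ).symm

theorem iteratedDeriv_crankQuot_of_odd (τ : ℂ) {n : ℕ} (hn : Odd n) :
    iteratedDeriv n (fun z => crankQuot z τ) 0 = 0 := by
  have h := iteratedDeriv_comp_neg n (fun z => crankQuot z τ) 0
  simp only [crankQuot, crankDenom_neg, neg_zero] at h
  rw [hn.neg_one_pow, neg_smul, one_smul] at h
  simp only [crankQuot]
  linear_combination h / 2

theorem sum_range_even_terms (ℓ : ℕ) (hℓ : Even ℓ) (f : ℕ → ℂ) (hf : ∀ n, Odd n → f n = 0) :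
    ∑ i ∈ Finset.range (ℓ + 1), f i = ∑ j ∈ Finset.range (ℓ / 2 + 1), f (2 * j) := by
  obtain ⟨n, rfl⟩ := hℓ
  rw [show (n + n) / 2 = n by omega]
  induction n with
  | zero => simp
  | succ n ih =>
    rw [show n + 1 + (n + 1) + 1 = (n + n + 1) + 1 + 1 by ring, Finset.sum_range_succ,
      Finset.sum_range_succ, ih, hf (n + n + 1) ⟨n, by ring⟩, add_zero,
      Finset.sum_range_succ _ (n + 1)]
    congr 2
    ring

theorem iteratedDeriv_calU1 {τ : ℂ} (hτ : 0 < τ.im) {ℓ : ℕ} (hℓ : Even ℓ) :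
    iteratedDeriv ℓ (fun z => calU1 z τ) 0 = ∑ j ∈ Finset.range (ℓ / 2 + 1),
      (ℓ.choose (2 * j) : ℂ) * iteratedDeriv (2 * j) (fun z => crankQuot z τ) 0 *
        ((2 * Real.pi * I) ^ (ℓ - 2 * j) * partialThetaMoment (ℓ - 2 * j) τ) := by
  rw [(calU1_eventuallyEq hτ).iteratedDeriv_eq, iteratedDeriv_fun_mul
    (analyticAt_crankQuot hτ).contDiffAt ((differentiable_halfTheta hτ).analyticAt 0).contDiffAt]
  simp only [iteratedDeriv_halfTheta_zero hτ]
  refine sum_range_even_terms ℓ hℓ (fun i => (ℓ.choose i : ℂ) *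
    iteratedDeriv i (fun z => crankQuot z τ) 0 *
      ((2 * Real.pi * I) ^ (ℓ - i) * partialThetaMoment (ℓ - i) τ)) fun n hn => ?_
  simp only [iteratedDeriv_crankQuot_of_odd τ hn, mul_zero, zero_mul]

end UnimodalRank

end

section

open Filter Topology Metric

namespace UnimodalRank

/-! ### The crank factor at a cusp -/

theorem ne_zero_of_le_re_inv {k : ℕ} (hk : 0 < k) {Z : ℂ} (hZ : (k : ℝ) / 2 ≤ (1 / Z).re) : Z ≠ 0 := by
  have hk' : (0 : ℝ) < k := by exact_mod_cast hk
  rintro rfl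
  rw [div_zero, zero_re] at hZ
  linarith

theorem re_pos_of_le_re_inv {k : ℕ} (hk : 0 < k) {Z : ℂ} (hZ : (k : ℝ) / 2 ≤ (1 / Z).re) :
    0 < Z.re := by
  have hk' : (0 : ℝ) < k := by exact_mod_cast hk
  have h0 := normSq_pos.2 (ne_zero_of_le_re_inv hk hZ)
  rw [one_div, inv_re] at hZ
  have h1 : 0 < Z.re / normSq Z := by linarith
  exact (div_pos_iff_of_pos_right h0).1 h1

theorem mul_norm_le_two {k : ℕ} (hk : 0 < k) {Z : ℂ} (hZ : (k : ℝ) / 2 ≤ (1 / Z).re) :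
    k * ‖Z‖ ≤ 2 := by
  have h0 := norm_pos_iff.2 (ne_zero_of_le_re_inv hk hZ)
  have h1 := hZ.trans (Complex.re_le_norm _)
  rw [norm_div, norm_one, le_div_iff₀ h0] at h1
  linarith

theorem half_le_re_inv {k : ℕ} (hk : 0 < k) {Z : ℂ} (hZ : (k : ℝ) / 2 ≤ (1 / Z).re) :
    1 / 2 ≤ (1 / (k * Z)).re := by
  have hk' : (0 : ℝ) < k := by exact_mod_cast hk
  rw [show 1 / (k * Z) = 1 / Z / (k : ℂ) by rw [div_div, mul_comm], div_natCast_re, le_div_iff₀ hk']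
  linarith

theorem cusp_image_im (a k : ℕ) (Z : ℂ) :
    ((a : ℂ) / k + I / (k * Z)).im = (1 / (k * Z)).re := by
  rw [add_im, show I / (k * Z) = I * (1 / (k * Z)) by ring, I_mul_im]
  rw [div_natCast_im, natCast_im, zero_div, zero_add]

theorem eta_ne_zero {τ : ℂ} (hτ : 0 < τ.im) : ModularForm.eta τ ≠ 0 := by
  rw [eta_eq_qPochhammerInf]
  exact mul_ne_zero (Complex.exp_ne_zero _) (qPochhammerInf_self_ne_zero (norm_exp_two_pi_I_mul hτ))

/-- Read off from the law of η at Z = 1, since η has no zeros; no Kronecker symbol has to be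
computed. -/
theorem chiHK_ne_zero {h k : ℕ} (hk : 0 < k) (hc : h.Coprime k) : chiHK h k ≠ 0 := by
  intro h0
  have H := (cusp_transform hk hc (Z := 1) (by simp)).1
  rw [h0, zero_mul, zero_mul] at H
  refine eta_ne_zero ?_ H
  rw [cusp_image_im]
  have hk' : (0 : ℝ) < k := by exact_mod_cast hk
  rw [mul_one, div_natCast_re]
  simpa using hk'

/-- The elementary factor of the crank function at a cusp. -/
noncomputable def cuspBracket (k : ℕ) (Z z : ℂ) : ℂ :=
  exp (Real.pi * k / Z * z ^ 2) * (sincC (Real.pi * z) * (sincC (Real.pi / (I * Z) * z))⁻¹)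

theorem analyticAt_cuspBracket (k : ℕ) {Z z : ℂ} (hz : sincC (Real.pi / (I * Z) * z) ≠ 0) :
    AnalyticAt ℂ (cuspBracket k Z) z :=
  ((by fun_prop : Differentiable ℂ fun z : ℂ => exp (Real.pi * k / Z * z ^ 2)).analyticAt z).mul
    ((analyticAt_sincC_mul _ z).mul ((analyticAt_sincC_mul _ z).inv hz))

theorem analyticAt_inv_crankDenom_div {τ z : ℂ} (w : ℂ) (hτ : 0 < τ.im)
    (hz : |(z / w).im| < τ.im) : AnalyticAt ℂ (fun z => (crankDenom (z / w) τ)⁻¹) z :=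
  (((differentiable_crankDenom hτ).comp
    (by fun_prop : Differentiable ℂ fun z : ℂ => z / w)).analyticAt z).inv (crankDenom_ne_zero hz)

/-- The product formula for ϑ is inserted on both sides of its transformation law. The multipliers
χ³ of ϑ and χ of η leave χ², the square roots cancel, and iZ is the ratio of the arguments of the
two sines. Since these vanish at 0, the identity is proved for z ≠ 0 and extended by continuity. -/
theorem crankQuot_cusp {h k : ℕ} (hk : 0 < k) (hc : h.Coprime k) {Z : ℂ} (hZ : 0 < Z.re) :
    (fun z => crankQuot z ((h : ℂ) / k + I * Z / k)) =ᶠ[𝓝 0] fun z =>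
      chiHK h k ^ 2 * exp (-(2 * Real.pi * I * ((negInv h k : ℂ) / k + I / (k * Z)) / 12)) * (I * Z) *
        (cuspBracket k Z z * (crankDenom (z / (I * Z)) ((negInv h k : ℂ) / k + I / (k * Z)))⁻¹) := by
  have hZ0 : Z ≠ 0 := by rintro rfl; simp at hZ
  have hIZ : I * Z ≠ 0 := mul_ne_zero I_ne_zero hZ0
  obtain ⟨H1, H2⟩ := cusp_transform hk hc hZ
  have hχ := chiHK_ne_zero hk hc
  have hτ := cusp_im_pos hk h hZ
  have hτ' : 0 < ((negInv h k : ℂ) / k + I / (k * Z)).im := by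
    rw [cusp_image_im, show 1 / (k * Z) = 1 / Z / (k : ℂ) by rw [div_div, mul_comm],
      div_natCast_re, one_div, inv_re]
    have hk' : (0 : ℝ) < k := by exact_mod_cast hk
    have := normSq_pos.2 hZ0
    positivity
  set τ := (h : ℂ) / k + I * Z / k
  set τ' := (negInv h k : ℂ) / k + I / (k * Z)
  have hη := eta_ne_zero hτ
  have hw : (I * Z) ^ (1 / 2 : ℂ) ≠ 0 := by
    rw [Ne, cpow_eq_zero_iff]
    tauto
  have hS0 : sincC (Real.pi / (I * Z) * 0) ≠ 0 := by
    rw [mul_zero, sincC_zero]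
    exact one_ne_zero
  have hD0 : crankDenom (0 / (I * Z)) τ' ≠ 0 := crankDenom_ne_zero (by simpa using hτ')
  have hD'a : Differentiable ℂ fun z => crankDenom (z / (I * Z)) τ' :=
    (differentiable_crankDenom hτ').comp (by fun_prop : Differentiable ℂ fun z : ℂ => z / (I * Z))
  have hR := ((analyticAt_cuspBracket k hS0).mul (analyticAt_inv_crankDenom_div (z := 0) (I * Z) hτ'
    (by simpa using hτ'))).continuousAt.const_mul
      (chiHK h k ^ 2 * exp (-(2 * Real.pi * I * τ' / 12)) * (I * Z))
  refine (ContinuousAt.eventuallyEq_nhds_iff_eventuallyEq_nhdsNE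
    (analyticAt_crankQuot hτ).continuousAt hR).1 ?_
  filter_upwards [self_mem_nhdsWithin,
    mem_nhdsWithin_of_mem_nhds ((analyticAt_sincC_mul _ 0).continuousAt.eventually_ne hS0),
    mem_nhdsWithin_of_mem_nhds (hD'a.continuous.continuousAt.eventually_ne hD0),
    mem_nhdsWithin_of_mem_nhds ((differentiable_crankDenom hτ).continuous.continuousAt.eventually_ne
      (crankDenom_ne_zero (show |(0 : ℂ).im| < τ.im by simpa using hτ)))] with z hz hS hD' hD
  have hz0 : z ≠ 0 := hz
  have hpi : (Real.pi : ℂ) ≠ 0 := by exact_mod_cast Real.pi_ne_zero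
  have H := H2 z
  rw [jacobiVartheta_eq_product _ hτ, jacobiVartheta_eq_product _ hτ', H1, ← mul_sincC, ← mul_sincC,
    show Real.pi * (z / (I * Z)) = Real.pi / (I * Z) * z by ring] at H
  simp only [crankQuot, Pi.mul_apply, cuspBracket]
  rw [Complex.exp_neg, Complex.exp_neg,
    show Real.pi * k / Z * z ^ 2 = Real.pi * k * z ^ 2 / Z by ring]
  have he := Complex.exp_ne_zero (2 * Real.pi * I * τ / 12)
  have he' := Complex.exp_ne_zero (2 * Real.pi * I * τ' / 12)
  generalize exp (2 * Real.pi * I * τ / 12) = e at *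
  generalize exp (2 * Real.pi * I * τ' / 12) = e' at *
  generalize crankDenom (z / (I * Z)) τ' = D' at *
  generalize crankDenom z τ = D at *
  generalize sincC (Real.pi / (I * Z) * z) = S' at *
  generalize sincC (Real.pi * z) = S at *
  generalize exp (Real.pi * k * z ^ 2 / Z) = E at *
  generalize (I * Z) ^ (1 / 2 : ℂ) = w at *
  generalize ModularForm.eta τ = η at *
  generalize chiHK h k = χ at *
  have key : S' * e' * D' = χ ^ 2 * (I * Z) * E * S * e * D := by
    have hne : -2 * (Real.pi / (I * Z) * z) * (χ * w * η) ≠ 0 := by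
      refine mul_ne_zero (mul_ne_zero (by norm_num) (mul_ne_zero (div_ne_zero hpi hIZ) hz0)) ?_
      exact mul_ne_zero (mul_ne_zero hχ hw) hη
    apply mul_left_cancel₀ hne
    have e2 : Real.pi / (I * Z) * (I * Z) = Real.pi := div_mul_cancel₀ _ hIZ
    linear_combination H - (2 * z * χ ^ 3 * w * η * E * S * e * D) * (-e2)
  have hX : S' * e' * D' ≠ 0 := mul_ne_zero (mul_ne_zero hS he') hD'
  have hY : e * D ≠ 0 := mul_ne_zero he hD
  calc e⁻¹ * D⁻¹ = S' * e' * D' * (e * D)⁻¹ * (S' * e' * D')⁻¹ := by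
        rw [mul_right_comm, mul_inv_cancel₀ hX, one_mul, mul_inv]
    _ = χ ^ 2 * (I * Z) * E * S * ((e * D) * (e * D)⁻¹) * (S' * e' * D')⁻¹ := by
        rw [key]
        ring
    _ = _ := by
        rw [mul_inv_cancel₀ hY, mul_one, mul_inv, mul_inv]
        ring

/-- The triple product of Taylor series with α = πk/Z, c = π, c' = π/(iZ). After (2πi)^(2j) is taken
out, the remaining constants are those of κ. -/
theorem iteratedDeriv_cuspBracket (k : ℕ) {Z : ℂ} (hZ : Z ≠ 0) (j : ℕ) :
    iteratedDeriv (2 * j) (cuspBracket k Z) 0 = (2 * Real.pi * I) ^ (2 * j) *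
      ∑ p ∈ Finset.HasAntidiagonal.antidiagonal j, ∑ r ∈ Finset.HasAntidiagonal.antidiagonal p.2,
        (k : ℂ) ^ p.1 * (kappa p.1 r.1 r.2 : ℂ) * (Z⁻¹) ^ (p.1 + 2 * r.2) := by
  have hpi : (Real.pi : ℂ) ≠ 0 := by exact_mod_cast Real.pi_ne_zero
  have h := coeff_taylorSeries_exp_sq_mul_sincC_div (α := Real.pi * k / Z) (c := Real.pi)
    (c' := Real.pi / (I * Z)) hpi (div_ne_zero hpi (mul_ne_zero I_ne_zero hZ)) j
  rw [coeff_taylorSeries] at h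
  have hf : (((2 * j).factorial : ℕ) : ℂ) ≠ 0 := by exact_mod_cast (2 * j).factorial_ne_zero
  rw [div_eq_iff hf] at h
  refine h.trans ?_
  rw [Finset.sum_mul, Finset.mul_sum]
  refine Finset.sum_congr rfl fun p hp => ?_
  rw [Finset.sum_mul, Finset.mul_sum]
  refine Finset.sum_congr rfl fun r hr => ?_
  obtain ⟨a, b'⟩ := p
  obtain ⟨b, c⟩ := r
  rw [Finset.HasAntidiagonal.mem_antidiagonal] at hp hr
  simp only at hp hr ⊢
  subst hr
  subst hp
  rw [kappa, show 2 * I * (Real.pi / (I * Z)) = 2 * Real.pi / Z by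
    have := I_ne_zero
    field_simp, ← add_assoc]
  push_cast
  have ha : ((a.factorial : ℕ) : ℂ) ≠ 0 := by exact_mod_cast a.factorial_ne_zero
  have hb : (((2 * b + 1).factorial : ℕ) : ℂ) ≠ 0 := by exact_mod_cast (2 * b + 1).factorial_ne_zero
  have hcf : (((2 * c).factorial : ℕ) : ℂ) ≠ 0 := by exact_mod_cast (2 * c).factorial_ne_zero
  have e1 : (2 * Real.pi * I : ℂ) ^ (2 * (a + b + c)) =
      (-1) ^ (a + b + c) * 4 ^ (a + b + c) * Real.pi ^ (2 * (a + b + c)) := by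
    rw [pow_mul, mul_pow, mul_pow, I_sq, pow_mul (Real.pi : ℂ), ← mul_pow, ← mul_pow]
    ring
  have e2 : ((-1 : ℂ)) ^ (a + b + c) * (-1) ^ (a + c) = (-1) ^ b := by
    rw [← pow_add, show a + b + c + (a + c) = 2 * (a + c) + b by ring, pow_add, pow_mul]
    norm_num
  rw [e1, ← e2, show (2 * Real.pi / Z : ℂ) ^ (2 * c) = 4 ^ c * Real.pi ^ (2 * c) * Z⁻¹ ^ (2 * c) by
    rw [div_eq_mul_inv, mul_pow, mul_pow, pow_mul (2 : ℂ)]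
    norm_num, show (Real.pi * k / Z : ℂ) ^ a = Real.pi ^ a * k ^ a * Z⁻¹ ^ a by
    rw [div_eq_mul_inv, mul_pow, mul_pow]]
  generalize ((((Polynomial.bernoulli (2 * c)).eval (1 / 2 : ℚ) : ℚ) : ℂ)) = B
  generalize Z⁻¹ = Y
  field_simp
  ring

/-- On |z| ≤ |Z|/8 the quotient z/(iZ) stays below 1/8, which keeps the denominator away from 0, and
k|Z| ≤ 2 bounds the exponential. The bound is uniform in k. -/
theorem exists_norm_cuspBracket_le : ∃ S : ℝ, 0 < S ∧ ∀ (k : ℕ) (Z z : ℂ), Z ≠ 0 → ‖Z‖ ≤ 2 →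
    k * ‖Z‖ ≤ 2 → ‖z‖ ≤ ‖Z‖ / 8 →
      sincC (Real.pi / (I * Z) * z) ≠ 0 ∧ ‖cuspBracket k Z z‖ ≤ S := by
  obtain ⟨S, hS⟩ := (isCompact_closedBall (0 : ℂ) 1).exists_bound_of_continuousOn
    differentiable_sincC.continuous.continuousOn
  have hS0 : 0 ≤ S := (norm_nonneg _).trans (hS 0 (by simp))
  refine ⟨Real.exp 1 * (S * 2) + 1, by positivity, fun k Z z hZ hZ2 hkZ hz => ?_⟩
  have hZn := norm_pos_iff.2 hZ
  have hpi4 := Real.pi_lt_four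
  have hpi0 := Real.pi_pos
  have hz' : ‖z / (I * Z)‖ ≤ 1 / 8 := by
    rw [norm_div, norm_mul, norm_I, one_mul, div_le_iff₀ hZn]
    linarith
  have h1 := two_le_pi_mul_norm_sincC (u := z / (I * Z))
    (((Complex.abs_re_le_norm _).trans hz').trans (by norm_num))
  rw [show Real.pi * (z / (I * Z)) = Real.pi / (I * Z) * z by ring] at h1
  have h2 : 1 / 2 ≤ ‖sincC (Real.pi / (I * Z) * z)‖ := by
    nlinarith [norm_nonneg (sincC (Real.pi / (I * Z) * z))]
  refine ⟨norm_pos_iff.1 (by linarith), ?_⟩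
  have h3 : ‖(sincC (Real.pi / (I * Z) * z))⁻¹‖ ≤ 2 := by
    rw [norm_inv, inv_le_comm₀ (by linarith) (by norm_num)]
    linarith
  have h4 : ‖sincC (Real.pi * z)‖ ≤ S := by
    refine hS _ ?_
    rw [mem_closedBall_zero_iff, norm_mul, Complex.norm_real, Real.norm_of_nonneg hpi0.le]
    nlinarith [norm_nonneg z]
  have h5 : ‖exp (Real.pi * k / Z * z ^ 2)‖ ≤ Real.exp 1 := by
    refine (Complex.norm_exp_le_exp_norm _).trans (Real.exp_le_exp.2 ?_)
    rw [norm_mul, norm_div, norm_mul, norm_pow, Complex.norm_real, Real.norm_of_nonneg hpi0.le,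
      Complex.norm_natCast]
    calc Real.pi * k / ‖Z‖ * ‖z‖ ^ 2 ≤ Real.pi * k / ‖Z‖ * (‖Z‖ / 8) ^ 2 := by gcongr
      _ = Real.pi * (k * ‖Z‖) / 64 := by field_simp; norm_num
      _ ≤ 4 * 2 / 64 := by gcongr
      _ ≤ 1 := by norm_num
  rw [cuspBracket, norm_mul, norm_mul]
  calc _ ≤ Real.exp 1 * (S * 2) := by gcongr
    _ ≤ _ := by linarith

theorem norm_iteratedDeriv_le_of_analyticAt {f : ℂ → ℂ} {R C : ℝ} (n : ℕ) (hR : 0 < R)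
    (hf : ∀ z, ‖z‖ ≤ R → AnalyticAt ℂ f z) (hC : ∀ z, ‖z‖ ≤ R → ‖f z‖ ≤ C) :
    ‖iteratedDeriv n f 0‖ ≤ n.factorial * C / R ^ n := by
  refine Complex.norm_iteratedDeriv_le_of_forall_mem_sphere_norm_le n hR
    (DifferentiableOn.diffContOnCl_ball (U := closedBall 0 R) (fun z hz =>
      (hf z (mem_closedBall_zero_iff.1 hz)).differentiableAt.differentiableWithinAt) subset_rfl)
    fun z hz => hC z (mem_sphere_zero_iff_norm.1 hz).le

/-- At a cusp the crank factor is its elementary factor up to an exponentially small error. -/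
theorem exists_iteratedDeriv_crankQuot_cusp (n : ℕ) : ∃ S : ℝ, 0 < S ∧
    ∀ k h : ℕ, 0 < k → h.Coprime k → ∀ Z : ℂ, (k : ℝ) / 2 ≤ (1 / Z).re →
      ‖iteratedDeriv n (cuspBracket k Z) 0‖ ≤ S / ‖Z‖ ^ n ∧ ∃ E : ℂ,
        iteratedDeriv n (fun z => crankQuot z ((h : ℂ) / k + I * Z / k)) 0 =
          chiHK h k ^ 2 * exp (-(2 * Real.pi * I * ((negInv h k : ℂ) / k + I / (k * Z)) / 12)) *
            (I * Z) * (iteratedDeriv n (cuspBracket k Z) 0 + E) ∧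
        ‖E‖ ≤ S * Real.exp (-(2 * Real.pi * (1 / (k * Z)).re)) / ‖Z‖ ^ n := by
  obtain ⟨S, hS0, hS⟩ := exists_norm_cuspBracket_le
  refine ⟨n.factorial * S * 8 ^ n * 480, by positivity, fun k h hk hc Z hZ => ?_⟩
  have hZ0 := ne_zero_of_le_re_inv hk hZ
  have hZn := norm_pos_iff.2 hZ0
  have hkZ := mul_norm_le_two hk hZ
  have hk' : (1 : ℝ) ≤ k := by exact_mod_cast hk
  have hZ2 : ‖Z‖ ≤ 2 := by nlinarith
  have hτ' : 1 / 2 ≤ ((negInv h k : ℂ) / k + I / (k * Z)).im := by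
    rw [cusp_image_im]
    exact half_le_re_inv hk hZ
  have hq := norm_exp_two_pi_I ((negInv h k : ℂ) / k + I / (k * Z))
  rw [cusp_image_im] at hq
  have hev := crankQuot_cusp hk hc (re_pos_of_le_re_inv hk hZ)
  set τ' := (negInv h k : ℂ) / k + I / (k * Z)
  have hR : 0 < ‖Z‖ / 8 := by positivity
  have hz' : ∀ z : ℂ, ‖z‖ ≤ ‖Z‖ / 8 → ‖z / (I * Z)‖ ≤ 1 / 8 := fun z hz => by
    rw [norm_div, norm_mul, norm_I, one_mul, div_le_iff₀ hZn]
    linarith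
  have hga : ∀ z : ℂ, ‖z‖ ≤ ‖Z‖ / 8 → AnalyticAt ℂ (cuspBracket k Z) z := fun z hz =>
    analyticAt_cuspBracket k (hS k Z z hZ0 hZ2 hkZ hz).1
  have hda : ∀ z : ℂ, ‖z‖ ≤ ‖Z‖ / 8 →
      AnalyticAt ℂ (fun z => cuspBracket k Z z * ((crankDenom (z / (I * Z)) τ')⁻¹ - 1)) z :=
    fun z hz => (hga z hz).mul ((analyticAt_inv_crankDenom_div _ (by linarith)
      (((Complex.abs_im_le_norm _).trans (hz' z hz)).trans_lt (by linarith))).sub analyticAt_const)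
  have h00 : ‖(0 : ℂ)‖ ≤ ‖Z‖ / 8 := by
    rw [norm_zero]
    exact hR.le
  have hpow : ∀ C : ℝ, C / (‖Z‖ / 8) ^ n = C * 8 ^ n / ‖Z‖ ^ n := fun C => by
    rw [div_pow]
    field_simp
  -- E is the derivative of the bracket times (1/D - 1), D the infinite product at the image point.
  -- Cauchy's estimate on the disc of radius |Z|/8 costs n! 8^n/|Z|^n.
  refine ⟨?_, iteratedDeriv n
    (fun z => cuspBracket k Z z * ((crankDenom (z / (I * Z)) τ')⁻¹ - 1)) 0, ?_, ?_⟩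
  · have := norm_iteratedDeriv_le_of_analyticAt n hR hga fun z hz => (hS k Z z hZ0 hZ2 hkZ hz).2
    rw [hpow] at this
    refine this.trans ?_
    have h0 : 0 ≤ n.factorial * S * 8 ^ n := by positivity
    exact div_le_div_of_nonneg_right (by linarith) (by positivity)
  · rw [hev.iteratedDeriv_eq, iteratedDeriv_const_mul_field, ← iteratedDeriv_fun_add
      (hga 0 h00).contDiffAt (hda 0 h00).contDiffAt]
    congr 3
    ext z
    ring
  · have := norm_iteratedDeriv_le_of_analyticAt n hR hda
      (C := S * (480 * Real.exp (-(2 * Real.pi * (1 / (k * Z)).re)))) fun z hz => by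
        rw [norm_mul, ← hq]
        exact mul_le_mul (hS k Z z hZ0 hZ2 hkZ hz).2
          (norm_inv_crankDenom_sub_one_le hτ' (hz' z hz)) (norm_nonneg _) hS0.le
    rw [hpow] at this
    refine this.trans (le_of_eq ?_)
    ring

end UnimodalRank

end

section

open Filter Topology

namespace UnimodalRank

/-! ### The main term and the error at a cusp -/

/-- χ is an integer times a number of modulus one, so it suffices that it does not vanish. -/
theorem one_le_norm_chiHK {h k : ℕ} (hk : 0 < k) (hc : h.Coprime k) : 1 ≤ ‖chiHK h k‖ := by
  have h0 := chiHK_ne_zero hk hc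
  have key : ∀ (n : ℤ) (x : ℝ), (n : ℂ) * exp (x * I) ≠ 0 → 1 ≤ ‖(n : ℂ) * exp (x * I)‖ := by
    intro n x hne
    have hn : n ≠ 0 := by
      rintro rfl
      simp at hne
    rw [norm_mul, norm_exp_ofReal_mul_I, mul_one, Complex.norm_intCast]
    exact_mod_cast Int.one_le_abs hn
  rw [chiHK, etaMultiplier] at h0 ⊢
  generalize (-(((h : ℤ) * negInv h k + 1) / k)) = b at *
  split_ifs at h0 ⊢ with hodd
  · rw [show Real.pi * I / 12 * ((((negInv h k : ℤ) : ℂ) + ((-(h : ℤ) : ℤ) : ℂ)) * ((k : ℤ) : ℂ) -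
      (b : ℂ) * ((-(h : ℤ) : ℤ) : ℂ) * (((k : ℤ) : ℂ) ^ 2 - 1) - 3 * ((k : ℤ) : ℂ)) =
      ((Real.pi / 12 * (((negInv h k : ℝ) + (-h)) * k - b * (-h) * ((k : ℝ) ^ 2 - 1) - 3 * k) : ℝ) : ℂ) *
        I by push_cast; ring] at h0 ⊢
    exact key _ _ h0
  · rw [show Real.pi * I / 12 * (((negInv h k : ℤ) : ℂ) * ((k : ℤ) : ℂ) *
      (1 - ((-(h : ℤ) : ℤ) : ℂ) ^ 2) + ((-(h : ℤ) : ℤ) : ℂ) * ((b : ℂ) - ((k : ℤ) : ℂ) + 3) - 3) =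
      ((Real.pi / 12 * ((negInv h k : ℝ) * k * (1 - (-h : ℝ) ^ 2) + (-h) * (b - k + 3) - 3) : ℝ) : ℂ) *
        I by push_cast; ring] at h0 ⊢
    exact key _ _ h0

theorem halfIntegerPoles_cuspKernel (a : ℕ) {k : ℕ} (hk : 0 < k) (m : ℕ) :
    HalfIntegerPoles (cuspKernel a k m) m (m.factorial * Real.exp (2 * Real.pi) * 16 * 4 ^ (m + 1) *
      (k : ℝ) ^ (m + 1) * Real.log (k + 1)) :=
  ⟨fun _ hv => differentiableAt_cuspKernel a hk m hv,
    fun _ hv _ hd hd1 h => norm_cuspKernel_le a hk m hv hd hd1 h⟩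

/-- The part of the contour integral that is not small. -/
noncomputable def cuspSegment (a k m : ℕ) (Z : ℂ) : ℂ :=
  ∫ x in (-(1 / Real.sqrt 6))..(1 / Real.sqrt 6), gaussMul (1 / (k * Z)) (cuspKernel a k m) x

/-- The substitution v = x/√6 turns 1/6 - v² into (1 - x²)/6. Sum and integral may be exchanged
because |v| ≤ 9/20 avoids the half-integers. -/
theorem cuspSegment_eq (a : ℕ) {k : ℕ} (hk : 0 < k) (m : ℕ) (Z : ℂ) :
    cuspSegment a k m Z = 1 / (Real.sqrt 6 : ℂ) * ∑ ν ∈ Finset.range (2 * k), cuspPhase a k ν *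
      ∫ x in (-1 : ℝ)..1, cotDeriv m (1 / (2 * (k : ℂ)) *
        ((x : ℂ) / (Real.sqrt 6 : ℂ) - (ν : ℂ) - 1 / 2)) *
          exp (Real.pi / (6 * k * Z) * (1 - (x : ℂ) ^ 2)) := by
  have hk0 : (k : ℂ) ≠ 0 := by exact_mod_cast hk.ne'
  have h1 := intervalIntegral.smul_integral_comp_mul_left (a := -1) (b := 1)
    (fun x : ℝ => gaussMul (1 / (k * Z)) (cuspKernel a k m) x) (1 / Real.sqrt 6)
  rw [mul_neg_one, mul_one] at h1
  rw [cuspSegment, ← h1, real_smul]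
  push_cast
  congr 1
  have hsq : (Real.sqrt 6 : ℂ) ^ 2 = 6 := by
    rw [← ofReal_pow, Real.sq_sqrt (by norm_num)]
    norm_num
  rw [Finset.sum_congr rfl fun ν _ => (intervalIntegral.integral_const_mul _ _).symm,
    ← intervalIntegral.integral_finsetSum]
  · refine intervalIntegral.integral_congr fun x _ => ?_
    rw [gaussMul, cuspKernel, Finset.mul_sum]
    refine Finset.sum_congr rfl fun ν _ => ?_
    rw [show Real.pi * (1 / (k * Z)) * (1 / 6 - (1 / (Real.sqrt 6 : ℂ) * x) ^ 2) =
      Real.pi / (6 * k * Z) * (1 - (x : ℂ) ^ 2) by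
        rw [mul_pow, div_pow, hsq, one_pow]
        ring, show 1 / (Real.sqrt 6 : ℂ) * x = x / Real.sqrt 6 by ring]
    ring
  · intro ν _
    refine ContinuousOn.intervalIntegrable fun x hx => ContinuousAt.continuousWithinAt ?_
    rw [Set.uIcc_of_le (by norm_num)] at hx
    refine continuousAt_const.mul (ContinuousAt.mul ?_ (by fun_prop))
    refine ContinuousAt.comp (g := cotDeriv m) (f := fun x : ℝ => 1 / (2 * (k : ℂ)) *
        ((x : ℂ) / (Real.sqrt 6 : ℂ) - (ν : ℂ) - 1 / 2))
      (differentiableAt_cotDeriv m fun n hn => ?_).continuousAt (by fun_prop)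
    have h2 : x * (1 / Real.sqrt 6) = ((ν + 2 * k * n : ℤ) : ℝ) + 1 / 2 := by
      have h3 : (x : ℂ) * (1 / (Real.sqrt 6 : ℂ)) = (ν : ℂ) + 2 * k * n + 1 / 2 := by
        rw [← hn]
        field_simp
        ring
      apply ofReal_injective
      push_cast
      exact h3
    obtain ⟨-, h4, h5⟩ := inv_sqrt_six_bounds
    have h6 := hx.1
    have h7 := hx.2
    rcases le_or_gt 0 (ν + 2 * k * n : ℤ) with h8 | h8
    · have : (0 : ℝ) ≤ ((ν + 2 * k * n : ℤ) : ℝ) := by exact_mod_cast h8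
      nlinarith
    · have : ((ν + 2 * k * n : ℤ) : ℝ) ≤ -1 := by
        have : (ν + 2 * k * n : ℤ) ≤ -1 := by omega
        exact_mod_cast this
      nlinarith

/-- The true exponent is π/6 · Re B; the generous 2π is allowed because it will meet the decay
exp(-2π Re B) of the crank error. -/
theorem norm_cuspSegment_le (a : ℕ) {k : ℕ} (hk : 0 < k) (m : ℕ) {Z : ℂ}
    (hB : 0 ≤ (1 / (k * Z)).re) :
    ‖cuspSegment a k m Z‖ ≤ Real.exp (2 * Real.pi * (1 / (k * Z)).re) *
      (m.factorial * Real.exp (2 * Real.pi) * 16 * 4 ^ (m + 1) *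
        (k : ℝ) ^ (m + 1) * Real.log (k + 1)) * 20 ^ (m + 1) := by
  have hK := halfIntegerPoles_cuspKernel a hk m
  have hM := hK.nonneg
  set M := m.factorial * Real.exp (2 * Real.pi) * 16 * 4 ^ (m + 1) *
        (k : ℝ) ^ (m + 1) * Real.log (k + 1)
  obtain ⟨-, h4, h5⟩ := inv_sqrt_six_bounds
  have h := intervalIntegral.norm_integral_le_of_norm_le_const (a := -(1 / Real.sqrt 6))
    (b := 1 / Real.sqrt 6) (f := fun x : ℝ => gaussMul (1 / (k * Z)) (cuspKernel a k m) x)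
    (C := Real.exp (2 * Real.pi * (1 / (k * Z)).re) * M * 20 ^ (m + 1)) fun x hx => by
    rw [Set.uIoc_of_le (by linarith)] at hx
    rw [gaussMul, norm_mul, mul_assoc (Real.exp _) M]
    refine mul_le_mul ?_ ?_ (norm_nonneg _) (Real.exp_pos _).le
    · rw [Complex.norm_exp]
      refine Real.exp_le_exp.2 ?_
      rw [show Real.pi * (1 / (k * Z)) * (1 / 6 - (x : ℂ) ^ 2) =
        ((Real.pi * (1 / 6 - x ^ 2) : ℝ) : ℂ) * (1 / (k * Z)) by push_cast; ring, re_ofReal_mul]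
      exact mul_le_mul_of_nonneg_right (by nlinarith [Real.pi_pos, sq_nonneg x]) hB
    · have h6 := hK.norm_le x (by simp) (1 / 20) (by norm_num) (by norm_num) fun n => by
        have := re_le_norm_sub_half (x := x) (d := 1 / 20) 0 (n₀ := -1)
          (by push_cast; linarith [hx.1]) (by push_cast; linarith [hx.2]) n
        simpa using this
      refine h6.trans (le_of_eq ?_)
      rw [one_div, inv_pow, div_inv_eq_mul]
  refine h.trans (mul_le_of_le_one_right (by positivity) ?_)
  rw [abs_of_nonneg (by linarith)]
  linarith

/-- The factor in front of the main term. -/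
noncomputable def cuspPrefactor (h k : ℕ) (Z : ℂ) : ℂ :=
  (chiHK h k)⁻¹ * I ^ (3 / 2 : ℂ) * exp (-(Real.pi * I * negInv h k / (6 * k))) *
    Z ^ (1 / 2 : ℂ) / (4 * k)

theorem norm_cuspPrefactor_le {h k : ℕ} (hk : 0 < k) (hc : h.Coprime k) {Z : ℂ} (hZ : Z ≠ 0) :
    ‖cuspPrefactor h k Z‖ ≤ ‖Z‖ ^ (1 / 2 : ℝ) / k := by
  have hk' : (0 : ℝ) < k := by exact_mod_cast hk
  have h1 : ‖(chiHK h k)⁻¹‖ ≤ 1 := by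
    rw [norm_inv]
    exact inv_le_one_of_one_le₀ (one_le_norm_chiHK hk hc)
  have h2 : ‖I ^ (3 / 2 : ℂ)‖ = 1 := by
    rw [Complex.norm_cpow_of_ne_zero I_ne_zero, norm_I, Real.one_rpow]
    simp
  have h3 : ‖Z ^ (1 / 2 : ℂ)‖ = ‖Z‖ ^ (1 / 2 : ℝ) := by
    rw [Complex.norm_cpow_of_ne_zero hZ]
    simp
  have h4 : ‖exp (-(Real.pi * I * negInv h k / (6 * k)))‖ = 1 := by
    rw [show -(Real.pi * I * negInv h k / (6 * k)) =
      ((-(Real.pi * negInv h k / (6 * k)) : ℝ) : ℂ) * I by push_cast; ring, norm_exp_ofReal_mul_I]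
  rw [cuspPrefactor, norm_div, norm_mul, norm_mul, norm_mul, h2, h3, h4, mul_one, mul_one, norm_mul,
    Complex.norm_natCast]
  refine div_le_div₀ (by positivity) (mul_le_of_le_one_left (by positivity) h1) hk' ?_
  norm_num
  linarith

/-- χ² from the crank factor against χ³ in `integral_cuspKernel` leaves χ⁻¹; the exponential
exp(π/(6kZ)) supplies the 1/6 in the Gaussian; i^(3/2) enters through i^(3/2) i^(1/2) = -1. -/
theorem crankQuot_mul_moment {h k : ℕ} (hk : 0 < k) (hc : h.Coprime k) {m : ℕ} (hm : Even m)
    {Z : ℂ} (hZ : (k : ℝ) / 2 ≤ (1 / Z).re) {ε : ℝ} (hε : 0 < ε) :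
    chiHK h k ^ 2 * exp (-(2 * Real.pi * I * ((negInv h k : ℂ) / k + I / (k * Z)) / 12)) * (I * Z) *
      partialThetaMoment m ((h : ℂ) / k + I * Z / k) = cuspPrefactor h k Z *
        ∫ x : ℝ, gaussMul (1 / (k * Z)) (cuspKernel (negInv h k) k m) (x + (-ε : ℝ) * I) := by
  have hZ0 := ne_zero_of_le_re_inv hk hZ
  have hk0 : (k : ℂ) ≠ 0 := by exact_mod_cast hk.ne'
  have hk' : (0 : ℝ) < k := by exact_mod_cast hk
  have hχ := chiHK_ne_zero hk hc
  have H := integral_cuspKernel hk hc hm (lt_of_lt_of_le (by norm_num) (half_le_re_inv hk hZ)) hε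
  have e1 : ∀ x : ℝ, gaussMul (1 / (k * Z)) (cuspKernel (negInv h k) k m) (x + (-ε : ℝ) * I) =
      exp (Real.pi / (6 * k * Z)) * (exp (-Real.pi * (1 / (k * Z)) * ((x : ℂ) - ε * I) ^ 2) *
        cuspKernel (negInv h k) k m ((x : ℂ) - ε * I)) := by
    intro x
    rw [gaussMul, show (x : ℂ) + (-ε : ℝ) * I = x - ε * I by push_cast; ring, ← mul_assoc,
      ← Complex.exp_add]
    congr 2
    field_simp
    ring
  simp only [e1]
  rw [MeasureTheory.integral_const_mul, H, cuspPrefactor,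
    show -(2 * Real.pi * I * ((negInv h k : ℂ) / k + I / (k * Z)) / 12) =
      -(Real.pi * I * negInv h k / (6 * k)) + Real.pi / (6 * k * Z) by
      field_simp
      linear_combination (-12 : ℂ) * I_sq, Complex.exp_add]
  have e2 : (k * Z : ℂ) ^ (1 / 2 : ℂ) = Real.sqrt k * Z ^ (1 / 2 : ℂ) := by
    rw [← ofReal_natCast, cpow_def_of_ne_zero (mul_ne_zero (by exact_mod_cast hk0) hZ0),
      log_ofReal_mul hk' hZ0, add_mul, Complex.exp_add, ← cpow_def_of_ne_zero hZ0, ofReal_log hk'.le,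
      ← cpow_def_of_ne_zero (by exact_mod_cast hk0), Real.sqrt_eq_rpow, ofReal_cpow hk'.le]
    push_cast
    rfl
  have e3 : (Z ^ (1 / 2 : ℂ)) ^ 2 = Z := by
    rw [← cpow_nat_mul]
    norm_num
  have e4 : (Real.sqrt k : ℂ) ^ 2 = k := by
    rw [← ofReal_pow, Real.sq_sqrt hk'.le]
    norm_num
  have e5 : I ^ (3 / 2 : ℂ) * I ^ (1 / 2 : ℂ) = -1 := by
    rw [← cpow_add _ _ I_ne_zero, show (3 / 2 + 1 / 2 : ℂ) = (2 : ℕ) by norm_num, cpow_natCast, I_sq]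
  rw [e2]
  generalize exp (Real.pi / (6 * k * Z)) = E1
  generalize exp (-(Real.pi * I * negInv h k / (6 * k))) = E2
  generalize partialThetaMoment m ((h : ℂ) / k + I * Z / k) = F
  generalize chiHK h k = χ at *
  generalize I ^ (3 / 2 : ℂ) = u at *
  generalize I ^ (1 / 2 : ℂ) = v at *
  generalize (Real.sqrt k : ℂ) = s at *
  generalize Z ^ (1 / 2 : ℂ) = t at *
  rw [← e3, ← e4]
  have hs : s ≠ 0 := by
    rintro rfl
    simp at e4
    exact hk0 e4.symm
  field_simp
  linear_combination (4 * E2 * E1 * t ^ 2 * F) * e5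

theorem exists_norm_crankQuot_mul_moment_sub_le (n : ℕ) {m : ℕ} (hm : Even m) :
    ∃ A : ℝ, 0 < A ∧ ∀ k h : ℕ, 0 < k → h.Coprime k → ∀ Z : ℂ, (k : ℝ) / 2 ≤ (1 / Z).re →
      ‖iteratedDeriv n (fun z => crankQuot z ((h : ℂ) / k + I * Z / k)) 0 *
          partialThetaMoment m ((h : ℂ) / k + I * Z / k) -
        cuspPrefactor h k Z * iteratedDeriv n (cuspBracket k Z) 0 *
          cuspSegment (negInv h k) k m Z‖ ≤
        A * Real.log (k + 1) * ‖Z‖ ^ (1 / 2 - (n + m : ℕ) : ℝ) := by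
  obtain ⟨S, hS0, hS⟩ := exists_iteratedDeriv_crankQuot_cusp n
  set C := 80 * (Real.exp 2 / (1 - Real.exp (-(1 / 2)))) + (2 * Real.exp 2 + 2) with hC
  set c := m.factorial * Real.exp (2 * Real.pi) * 16 * 4 ^ (m + 1) with hcdef
  have hC0 : 0 < C := by
    have : Real.exp (-(1 / 2)) < 1 := Real.exp_lt_one_iff.2 (by norm_num)
    have : 0 < 1 - Real.exp (-(1 / 2)) := by linarith
    positivity
  have hc0 : 0 < c := by positivity
  refine ⟨(2 * S * C + 20 * S) * c * 40 ^ m, by positivity, fun k h hk hc Z hZ => ?_⟩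
  have hZ0 := ne_zero_of_le_re_inv hk hZ
  have hZn := norm_pos_iff.2 hZ0
  have hk' : (0 : ℝ) < k := by exact_mod_cast hk
  have hB := half_le_re_inv hk hZ
  obtain ⟨hg, E, hE, hEn⟩ := hS k h hk hc Z hZ
  have hK := halfIntegerPoles_cuspKernel (negInv h k) hk m
  have hL := hK.norm_integral_line_sub_le hB
  have hBn : 1 / 2 ≤ ‖1 / (k * Z)‖ := hB.trans (Complex.re_le_norm _)
  have hmul := crankQuot_mul_moment hk hc hm hZ (show 0 < 1 / (40 * ‖1 / (k * Z)‖) by positivity)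
  have hseg := norm_cuspSegment_le (negInv h k) hk m (Z := Z) (by linarith)
  rw [← cuspSegment, ← hC, ← hcdef] at hL
  rw [← hcdef] at hseg
  set g := iteratedDeriv n (cuspBracket k Z) 0
  set L := ∫ x : ℝ, gaussMul (1 / (k * Z)) (cuspKernel (negInv h k) k m)
    (x + (-(1 / (40 * ‖1 / (k * Z)‖)) : ℝ) * I)
  set σ := cuspSegment (negInv h k) k m Z
  set M := c * (k : ℝ) ^ (m + 1) * Real.log (k + 1) with hMdef
  have hM : 0 ≤ M := by
    have : 0 ≤ Real.log (k + 1) := Real.log_nonneg (by linarith)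
    positivity
  set β := (40 * ‖1 / (k * Z)‖) ^ m with hβ
  have hβ20 : (20 : ℝ) ^ (m + 1) ≤ 20 * β := by
    rw [pow_succ', hβ]
    have : (20 : ℝ) ≤ 40 * ‖1 / (k * Z)‖ := by linarith
    gcongr
  -- With L the full line and σ the segment, L - σ is the contour error and E the crank error. In Eσ
  -- the exponential decay of E offsets the growth of σ.
  have e1 : iteratedDeriv n (fun z => crankQuot z ((h : ℂ) / k + I * Z / k)) 0 *
      partialThetaMoment m ((h : ℂ) / k + I * Z / k) - cuspPrefactor h k Z * g * σ =
      cuspPrefactor h k Z * ((g + E) * (L - σ) + E * σ) := by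
    rw [hE]
    linear_combination (g + E) * hmul
  set ρ := (1 / (k * Z)).re
  have hρ : Real.exp (-(2 * Real.pi * ρ)) ≤ 1 := by
    rw [Real.exp_le_one_iff]
    have := Real.pi_pos
    have : 0 ≤ ρ := by linarith
    rw [neg_nonpos]
    positivity
  have h1 : ‖g + E‖ ≤ 2 * S / ‖Z‖ ^ n := by
    refine (norm_add_le _ _).trans ?_
    have : S * Real.exp (-(2 * Real.pi * ρ)) / ‖Z‖ ^ n ≤ S / ‖Z‖ ^ n := by
      refine div_le_div_of_nonneg_right ?_ (by positivity)
      exact mul_le_of_le_one_right hS0.le hρ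
    rw [mul_div_assoc]
    linarith
  have h2 : ‖E * σ‖ ≤ S / ‖Z‖ ^ n * (M * (20 * β)) := by
    rw [norm_mul]
    calc ‖E‖ * ‖σ‖ ≤ S * Real.exp (-(2 * Real.pi * ρ)) / ‖Z‖ ^ n *
          (Real.exp (2 * Real.pi * ρ) * M * 20 ^ (m + 1)) := by gcongr
      _ = S / ‖Z‖ ^ n * (M * 20 ^ (m + 1)) *
          (Real.exp (-(2 * Real.pi * ρ)) * Real.exp (2 * Real.pi * ρ)) := by ring
      _ = S / ‖Z‖ ^ n * (M * 20 ^ (m + 1)) := by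
          rw [← Real.exp_add, neg_add_cancel, Real.exp_zero, mul_one]
      _ ≤ _ := by gcongr
  have h3 : ‖(g + E) * (L - σ) + E * σ‖ ≤ (2 * S * C + 20 * S) / ‖Z‖ ^ n * (M * β) := by
    refine (norm_add_le _ _).trans ?_
    rw [norm_mul]
    calc ‖g + E‖ * ‖L - σ‖ + ‖E * σ‖ ≤
          2 * S / ‖Z‖ ^ n * (C * M * β) + S / ‖Z‖ ^ n * (M * (20 * β)) := by gcongr
      _ = _ := by ring
  -- Of k^(m+1) in the kernel bound, k^m is cancelled by ‖B‖^m = (k|Z|)^(-m); the last k cancels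
  -- against the prefactor.
  have h4 : M * β = c * 40 ^ m * Real.log (k + 1) * k / ‖Z‖ ^ m := by
    rw [hβ, hMdef, norm_div, norm_one, norm_mul, Complex.norm_natCast, mul_pow, div_pow, mul_pow,
      one_pow]
    field_simp
    ring
  rw [e1, norm_mul]
  refine (mul_le_mul (norm_cuspPrefactor_le hk hc hZ0) h3 (norm_nonneg _) (by positivity)).trans
    (le_of_eq ?_)
  rw [h4, Real.rpow_sub hZn, Real.rpow_natCast, pow_add]
  field_simp

/-- 12ν(ν+1) + 1 = 12(ν + 1/2)² - 2, and the -2 is the power of q' left over from the crank factor.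
-/
theorem cuspPhase_mul_exp (a : ℕ) {k : ℕ} (hk : 0 < k) (ν : ℕ) :
    exp (-(Real.pi * I * a / (6 * k))) * cuspPhase a k ν = (-1 : ℂ) ^ ν *
      exp (Real.pi * I * (a : ℂ) / (12 * k) * (12 * (ν : ℂ) * ((ν : ℂ) + 1) + 1)) := by
  have hk0 : (k : ℂ) ≠ 0 := by exact_mod_cast hk.ne'
  rw [cuspPhase, zpow_natCast, mul_left_comm, ← Complex.exp_add]
  congr 2
  push_cast
  field_simp
  ring

/-- The main term, sorted by the Taylor coefficients of the crank factor. -/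
theorem main_term_eq {h k : ℕ} (hk : 0 < k) {Z : ℂ} (hZ : Z ≠ 0) (ℓ : ℕ) :
    (2 * (Real.pi : ℂ) * I) ^ ℓ * I ^ (3 / 2 : ℂ) / (4 * (Real.sqrt 6 : ℂ) * k) *
      (chiHK h k)⁻¹ *
      ∑ ν ∈ Finset.range (2 * k),
        (-1 : ℂ) ^ ν *
        exp (Real.pi * I * (negInv h k : ℂ) / (12 * k) *
          (12 * (ν : ℂ) * ((ν : ℂ) + 1) + 1)) *
        ∑ j ∈ Finset.range (ℓ / 2 + 1),
          (Nat.choose ℓ (2 * j) : ℂ) *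
          ∑ p ∈ Finset.HasAntidiagonal.antidiagonal j, ∑ r ∈ Finset.HasAntidiagonal.antidiagonal p.2,
            (k : ℂ) ^ p.1 * (kappa p.1 r.1 r.2 : ℂ) *
            Z ^ ((1 / 2 : ℂ) - p.1 - 2 * r.2) *
            ∫ x in (-1 : ℝ)..1,
              cotDeriv (ℓ - 2 * j)
                (1 / (2 * (k : ℂ)) *
                  ((x : ℂ) / (Real.sqrt 6 : ℂ) - (ν : ℂ) - 1 / 2)) *
              exp (Real.pi / (6 * k * Z) * (1 - (x : ℂ) ^ 2)) =
    ∑ j ∈ Finset.range (ℓ / 2 + 1), (ℓ.choose (2 * j) : ℂ) * (2 * Real.pi * I) ^ (ℓ - 2 * j) *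
      (cuspPrefactor h k Z * iteratedDeriv (2 * j) (cuspBracket k Z) 0 *
        cuspSegment (negInv h k) k (ℓ - 2 * j) Z) := by
  have hpow : ∀ a c : ℕ, Z ^ ((1 / 2 : ℂ) - a - 2 * c) = Z ^ (1 / 2 : ℂ) * Z⁻¹ ^ (a + 2 * c) := by
    intro a c
    rw [show (1 / 2 : ℂ) - a - 2 * c = 1 / 2 - ((a + 2 * c : ℕ) : ℂ) by push_cast; ring,
      cpow_sub _ _ hZ, cpow_natCast, inv_pow, div_eq_mul_inv]
  simp only [hpow]
  rw [Finset.mul_sum, Finset.sum_congr rfl fun ν _ => by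
    rw [← cuspPhase_mul_exp _ hk, Finset.mul_sum, Finset.mul_sum], Finset.sum_comm]
  refine Finset.sum_congr rfl fun j hj => ?_
  have hj' : 2 * j ≤ ℓ := by
    have := Finset.mem_range.1 hj
    omega
  have h2 : (2 * Real.pi * I : ℂ) ^ ℓ = (2 * Real.pi * I) ^ (2 * j) * (2 * Real.pi * I) ^ (ℓ - 2 * j) := by
    rw [← pow_add, Nat.add_sub_cancel' hj']
  rw [cuspSegment_eq _ hk, iteratedDeriv_cuspBracket k hZ, cuspPrefactor, h2]
  simp only [← mul_assoc]
  rw [Finset.mul_sum]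
  refine Finset.sum_congr rfl fun ν _ => ?_
  have h3 : ∀ J : ℂ, ∑ p ∈ Finset.HasAntidiagonal.antidiagonal j,
      ∑ r ∈ Finset.HasAntidiagonal.antidiagonal p.2,
        (k : ℂ) ^ p.1 * (kappa p.1 r.1 r.2 : ℂ) * Z ^ (1 / 2 : ℂ) * Z⁻¹ ^ (p.1 + 2 * r.2) * J =
      Z ^ (1 / 2 : ℂ) * J * ∑ p ∈ Finset.HasAntidiagonal.antidiagonal j,
        ∑ r ∈ Finset.HasAntidiagonal.antidiagonal p.2,
          (k : ℂ) ^ p.1 * (kappa p.1 r.1 r.2 : ℂ) * Z⁻¹ ^ (p.1 + 2 * r.2) := by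
    intro J
    rw [Finset.mul_sum]
    refine Finset.sum_congr rfl fun p _ => ?_
    rw [Finset.mul_sum]
    refine Finset.sum_congr rfl fun r _ => ?_
    ring
  rw [h3]
  ring

end UnimodalRank

end

theorem theorem5p1 (ℓ : ℕ) (hℓ : Even ℓ) (c₀ : ℝ) (hc₀ : 0 < c₀) :
    ∃ A : ℝ, 0 < A ∧
      ∀ k h : ℕ, 0 < k → h < k → Nat.Coprime h k →
      ∀ Z : ℂ, (k : ℝ) / 2 ≤ (1 / Z).re → ‖Z‖ ≤ c₀ / k →
        AnalyticAt ℂ (fun z : ℂ => calU1 z ((h : ℂ) / k + I * Z / k)) 0 ∧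
        ‖iteratedDeriv ℓ (fun z : ℂ => calU1 z ((h : ℂ) / k + I * Z / k)) 0 -
          (2 * (Real.pi : ℂ) * I) ^ ℓ * I ^ (3 / 2 : ℂ) / (4 * (Real.sqrt 6 : ℂ) * k) *
            (chiHK h k)⁻¹ *
            ∑ ν ∈ Finset.range (2 * k),
              (-1 : ℂ) ^ ν *
              exp (Real.pi * I * (negInv h k : ℂ) / (12 * k) *
                (12 * (ν : ℂ) * ((ν : ℂ) + 1) + 1)) *
              ∑ j ∈ Finset.range (ℓ / 2 + 1),
                (Nat.choose ℓ (2 * j) : ℂ) *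
                ∑ p ∈ Finset.HasAntidiagonal.antidiagonal j, ∑ r ∈ Finset.HasAntidiagonal.antidiagonal p.2,
                  (k : ℂ) ^ p.1 * (kappa p.1 r.1 r.2 : ℂ) *
                  Z ^ ((1 / 2 : ℂ) - p.1 - 2 * r.2) *
                  ∫ x in (-1 : ℝ)..1,
                    cotDeriv (ℓ - 2 * j)
                      (1 / (2 * (k : ℂ)) *
                        ((x : ℂ) / (Real.sqrt 6 : ℂ) - (ν : ℂ) - 1 / 2)) *
                    exp (Real.pi / (6 * k * Z) * (1 - (x : ℂ) ^ 2))‖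
          ≤ A * Real.log (k + 1) * ‖Z‖ ^ ((1 / 2 : ℝ) - ℓ) := by
  have hm : ∀ j, Even (ℓ - 2 * j) := fun j => hℓ.tsub (even_two_mul j)
  choose A hA0 hA using fun j => exists_norm_crankQuot_mul_moment_sub_le (2 * j) (hm j)
  refine ⟨∑ j ∈ Finset.range (ℓ / 2 + 1), (ℓ.choose (2 * j) : ℝ) * (2 * Real.pi) ^ (ℓ - 2 * j) * A j,
    ?_, fun k h hk _ hc Z hZ _ => ?_⟩
  · refine Finset.sum_pos (fun j hj => ?_) (Finset.nonempty_range_iff.2 (Nat.succ_ne_zero _))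
    have h1 : 0 < ℓ.choose (2 * j) := Nat.choose_pos (by have := Finset.mem_range.1 hj; omega)
    have := hA0 j
    have := Real.pi_pos
    positivity
  · have hτ := cusp_im_pos hk h (re_pos_of_le_re_inv hk hZ)
    refine ⟨analyticAt_calU1 hτ, ?_⟩
    rw [main_term_eq hk (ne_zero_of_le_re_inv hk hZ) ℓ, iteratedDeriv_calU1 hτ hℓ,
      ← Finset.sum_sub_distrib, Finset.sum_mul, Finset.sum_mul]
    refine norm_sum_le_of_le _ fun j hj => ?_
    -- The orders of the crank derivative and of the moment always add up to ℓ, so every Leibniz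
    -- term has the same error |Z|^(1/2-ℓ) log(k+1).
    have hj' : 2 * j + (ℓ - 2 * j) = ℓ := by
      have := Finset.mem_range.1 hj
      omega
    have h1 := hA j k h hk hc Z hZ
    rw [hj'] at h1
    rw [show ∀ a b c d e : ℂ, a * b * (c * d) - a * c * e = a * c * (b * d - e) by
      intros; ring, norm_mul, norm_mul, norm_pow, Complex.norm_natCast,
      show ‖(2 * Real.pi * I : ℂ)‖ = 2 * Real.pi by
        rw [norm_mul, norm_I, mul_one, norm_mul, Complex.norm_real,
          Real.norm_of_nonneg Real.pi_pos.le]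
        norm_num]
    have hpi := Real.pi_pos
    refine (mul_le_mul_of_nonneg_left h1 (by positivity)).trans (le_of_eq ?_)
    ring
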